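/- Let $n\ge 0$ and let $\Sigma=\Sigma_1\sqcup\dots\sqcup\Sigma_n$ be a disjoint union of $n$ oriented 2-spheres. **Cut-diagrams.** Let $P\subset\Sigma$ be a compact oriented generically immersed 1-manifold, with over/under information at its double points (crossings) and with each univalent vertex marked as black ($\bullet$) or white ($\circ$). The connected components of $\Sigma\setminus P$ are called regions; the crossings split $P$ into cut arcs (cut at under-passages). A univalent vertex is positive (negative) if its incident arc is oriented away from (towards) it. A *cut-diagram* $\mathcal C$ is obtained by labeling each cut arc by a region such that: (1) at a crossing whose over-arc is labeled $C$ and whose under-arcs are labeled $A$ (on the right of the over-arc) and $B$ (on its left), the regions $A$ and $B$ are adjacent along a $C$-labeled cut arc, with $A$ on its right and $B$ on its left; (2) a cut arc with a $\bullet$ end in region $A$ is labeled $A$; (3) the $\circ$ dots of each component are partitioned into pairs $\{p_1,p_2\}$ such that, if $p_1$ lies in $X$ with incident arc labeled $Y$, then $p_2$ lies in $Y$ with incident arc labeled $X$ (an $(X,Y)$-pair), and $p_1,p_2$ have the same sign $\varepsilon(p_1,p_2)$. Cut-diagrams are considered up to orientation-preserving homeomorphisms of each component. A *basing* is the choice of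 a region $R_i$ of $\Sigma_i$ for each $i$. **Groups.** Write $x^y=y^{-1}xy$, $[x,y]=x^{-1}y^{-1}xy$. The group $G(\mathcal C)$ is generated by the regions, with a relation $B^{-1}A^{C}$ whenever $A$ (on the right) and $B$ (on the left) are adjacent along a $C$-labeled arc. For a group $G$ normally generated by $a_1,\dots,a_m$, the reduced group $\mathrm RG$ is the quotient of $G$ by the normal closure of all $[a_j,a_j^g]$, $g\in G$; here $\mathrm RG(\mathcal C)$ is formed with $R_1,\dots,R_n$, and $\mathrm RG(\mathcal C)_i$ is its quotient by the normal closure of all regions of $\Sigma_i$. Let $\mathrm RF^i_{n-1}$ be the reduced group of the free group on $\{x_j : j\ne i\}$. For a generic path $\gamma$ on $\Sigma$ successively crossing arcs labeled $A_1,\dots,A_k$, put $w_\gamma=A_1^{\varepsilon_1}\cdots A_k^{\varepsilon_k}$, with $\varepsilon_l=1$ if the arc is crossed from its right to its left and $-1$ otherwise. **Positivity.** Let $\Lambda_i$ be the ring of power series over $\mathbb Z$ in noncommuting variables $X_j$ ($j\neq i$) modulo the monomials containing a variable twice, and $E_i:\mathrm RF^i_{n-1}\to\Lambda_i$ the multiplicative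 map with $E_i(x_j^{\pm1})=1\pm X_j$. An element $x$ of $\mathrm RF^i_{n-1}$ is positive if $x=1$ or if the first non-vanishing term of $E_i(x)-1$, for the order of monomials by degree and then lexicographically, has positive coefficient. **Moves.** *Self-singular equivalence* of based cut-diagrams is generated by the following moves inside embedded disks, in all versions obtained by changing orientations of strands and by reflection, whenever the labeling rules hold before and after the move. Topological moves: creation or deletion of an arc with two $\bullet$ ends; creation or deletion of an embedded circle bounding a disk; creation or deletion of a kink whose strand has the same label at both ends; reconnection (saddle) of two antiparallel arcs with the same label; passage of a $\bullet$ end under a strand; fusion of two arcs at two facing $\bullet$ ends; Reidemeister moves 2 and 3. Self-singular moves: (a) a crossing change between two strands labeled $A$ and $B$, in the presence of an $(A,B)$-pair of $\circ$ dots; (b) two paired $\circ$ dots simultaneously pass under two strands with the same label, one moving forward and the other one backwards along its arc, both from the left to the right, or both from the right to the left, of the strand that it passes; (c) an $A$-labeled strand is interrupted between two $\circ$ dots, which are paired (respecting signs) with the two ends of a new arc in the region $A$ of the same component, or, starting from two disks not meeting $P$ on the same component, an arc with two $\circ$ ends is created in each of them, with ends paired; (d) a $\bullet$ end is replaced by a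 $\circ$ end, paired with a $\circ$ end of a new arc in the same region whose other end is a $\bullet$; and the inverses of these moves. Regions having a point outside the open disks in common correspond to each other; labels outside the disks and the chosen regions $R_i$ are preserved up to this correspondence (so if a region is split, each occurrence may be replaced by any of the resulting regions compatible with the labeling rules), and a region lying entirely inside the disks does not occur as a label. **The invariant.** For a based cut-diagram and $1\le i\le n$, let $\phi:\mathrm RG(\mathcal C)_i\to\mathrm RF^i_{n-1}$ be the isomorphism with $\phi(R_j)=x_j$ for $j\ne i$. For each pair $\{p_1,p_2\}$ of $\circ$ dots on $\Sigma_i$ choose paths $\alpha_1,\alpha_2$ from a point of $R_i$ to $p_1,p_2$, and let $w_{p_1,p_2}\in\mathrm RG(\mathcal C)_i$ be $w_{\alpha_1}w_{\alpha_2}^{-1}$ if $\phi(w_{\alpha_1}w_{\alpha_2}^{-1})$ is positive, and $w_{\alpha_2}w_{\alpha_1}^{-1}$ otherwise. Set $$S_i(\mathcal C)=\sum_{\{p_1,p_2\}}\varepsilon(p_1,p_2)\,\bigl(\phi(w_{p_1,p_2})-1\bigr)\in\mathbb Z\,\mathrm RF^i_{n-1},$$ where the sum runs over all pairs of $\circ$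 dots on $\Sigma_i$. **Theorem.** For every based cut-diagram $\mathcal C$ over $\Sigma$ and every $i$, $S_i(\mathcal C)$ is well defined (the isomorphism $\phi$ exists, and the sum does not depend on the choices of paths nor on the order of the two dots in each pair), and if $\mathcal C$ and $\mathcal C'$ are self-singular equivalent based cut-diagrams, then $S_i(\mathcal C)=S_i(\mathcal C')$. -/

import Mathlib

namespace KirkCut

/-! ## Reduced groups, the reduced Magnus expansion and positive elements -/

section Groups

/-- The normal subgroup generated by all commutators `[a_j, a_j ^ g]`, where
`[x, y] = x⁻¹ y⁻¹ x y` and `x ^ g = g⁻¹ x g`. -/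
def reducedKernel {G ι : Type*} [Group G] (a : ι → G) : Subgroup G :=
  Subgroup.normalClosure
    {x | ∃ (j : ι) (g : G),
      x = (a j)⁻¹ * (g⁻¹ * a j * g)⁻¹ * a j * (g⁻¹ * a j * g)}

instance reducedKernel_normal {G ι : Type*} [Group G] (a : ι → G) :
    (reducedKernel a).Normal :=
  Subgroup.normalClosure_normal

/-- The reduced group of `G` with respect to the (normally generating) family `a`. -/
abbrev ReducedGroup {G ι : Type*} [Group G] (a : ι → G) : Type _ := G ⧸ reducedKernel a

/-- The reduced free group on the alphabet `ι`. -/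
abbrev ReducedFree (ι : Type*) : Type _ :=
  ReducedGroup (fun j : ι => FreeGroup.of j)

/-- The generator `x_j` of the reduced free group. -/
def ReducedFree.gen {ι : Type*} (j : ι) : ReducedFree ι :=
  QuotientGroup.mk (FreeGroup.of j)

end Groups

/-- The target of the reduced Magnus expansion: power series in noncommuting variables `X_j`,
`j : ι`, modulo all monomials in which some variable occurs twice.  Such a series is given by
its coefficients at the monomials `X_w`, `w` a word without repetition. -/
structure Magnus (ι : Type*) where
  /-- the coefficient at a word without repetition -/
  coeff : {w : List ι // w.Nodup} → ℤ

namespace Magnus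

variable {ι : Type*}

@[ext] theorem ext {f g : Magnus ι} (h : ∀ w, f.coeff w = g.coeff w) : f = g := by
  cases f; cases g; congr; funext w; exact h w

/-- the first `k` letters of a word -/
def left (w : {w : List ι // w.Nodup}) (k : ℕ) : {w : List ι // w.Nodup} :=
  ⟨w.1.take k, w.2.sublist (List.take_sublist k w.1)⟩

/-- the word without its first `k` letters -/
def right (w : {w : List ι // w.Nodup}) (k : ℕ) : {w : List ι // w.Nodup} :=
  ⟨w.1.drop k, w.2.sublist (List.drop_sublist k w.1)⟩

instance : Zero (Magnus ι) := ⟨⟨fun _ => 0⟩⟩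
instance : Add (Magnus ι) := ⟨fun f g => ⟨fun w => f.coeff w + g.coeff w⟩⟩
instance : Neg (Magnus ι) := ⟨fun f => ⟨fun w => - f.coeff w⟩⟩
open Classical in
noncomputable instance : One (Magnus ι) := ⟨⟨fun w => if w.1 = [] then 1 else 0⟩⟩
/-- The product of power series: `(f g)_w = ∑ f_u g_v` over all `w = u v`. -/
instance : Mul (Magnus ι) :=
  ⟨fun f g => ⟨fun w => ∑ p ∈ Finset.HasAntidiagonal.antidiagonal w.1.length,
    f.coeff (left w p.1) * g.coeff (right w p.1)⟩⟩

theorem add_coeff (f g : Magnus ι) (w) : (f + g).coeff w = f.coeff w + g.coeff w := rfl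
theorem neg_coeff (f : Magnus ι) (w) : (-f).coeff w = - f.coeff w := rfl
theorem zero_coeff (w) : (0 : Magnus ι).coeff w = 0 := rfl
open Classical in
theorem one_coeff (w) : (1 : Magnus ι).coeff w = if w.1 = [] then 1 else 0 := rfl
theorem mul_coeff (f g : Magnus ι) (w) : (f * g).coeff w =
    ∑ p ∈ Finset.HasAntidiagonal.antidiagonal w.1.length, f.coeff (left w p.1) * g.coeff (right w p.1) := rfl

theorem mul_assoc' (f g h : Magnus ι) : f * g * h = f * (g * h) := by
  ext w
  simp only [mul_coeff, Finset.sum_mul, Finset.mul_sum]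
  rw [Finset.sum_sigma', Finset.sum_sigma']
  refine Finset.sum_bij' (fun x _ => ⟨(x.2.1, x.2.2 + x.1.2), (x.2.2, x.1.2)⟩)
    (fun x _ => ⟨(x.1.1 + x.2.1, x.2.2), (x.1.1, x.2.1)⟩) ?_ ?_ ?_ ?_ ?_
  · rintro ⟨⟨a, b⟩, ⟨c, d⟩⟩ hx
    simp [left, right] at hx ⊢
    omega
  · rintro ⟨⟨a, b⟩, ⟨c, d⟩⟩ hx
    simp [left, right] at hx ⊢
    omega
  · rintro ⟨⟨a, b⟩, ⟨c, d⟩⟩ hx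
    simp [left, right] at hx ⊢
    omega
  · rintro ⟨⟨a, b⟩, ⟨c, d⟩⟩ hx
    simp [left, right] at hx ⊢
    omega
  · rintro ⟨⟨a, b⟩, ⟨c, d⟩⟩ hx
    simp [left, right] at hx ⊢
    have h1 : c + d = a := by omega
    subst h1
    simp [List.take_take, List.drop_take, _root_.mul_assoc]

noncomputable instance : Ring (Magnus ι) where
  add_assoc f g h := by ext w; simp [add_coeff, add_assoc]
  zero_add f := by ext w; simp [add_coeff, zero_coeff]
  add_zero f := by ext w; simp [add_coeff, zero_coeff]
  add_comm f g := by ext w; simp [add_coeff, add_comm]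
  neg_add_cancel f := by ext w; simp [add_coeff, neg_coeff, zero_coeff]
  left_distrib f g h := by
    ext w; simp [add_coeff, mul_coeff, mul_add, Finset.sum_add_distrib]
  right_distrib f g h := by
    ext w; simp [add_coeff, mul_coeff, add_mul, Finset.sum_add_distrib]
  zero_mul f := by ext w; simp [mul_coeff, zero_coeff]
  mul_zero f := by ext w; simp [mul_coeff, zero_coeff]
  mul_assoc := mul_assoc'
  one_mul f := by
    ext w
    rw [mul_coeff, Finset.sum_eq_single (0, w.1.length)]
    · simp [one_coeff, left, right]
    · rintro ⟨a, b⟩ h1 h2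
      have : ¬ (a = 0 ∨ w.1 = []) := by
        rintro (h | h)
        · simp_all
        · simp_all
      simp [one_coeff, left, List.take_eq_nil_iff, this]
    · simp
  mul_one f := by
    ext w
    rw [mul_coeff, Finset.sum_eq_single (w.1.length, 0)]
    · simp [one_coeff, left, right]
    · rintro ⟨a, b⟩ h1 h2
      have : ¬ (w.1.length ≤ a) := by
        simp at h1 h2
        omega
      simp [one_coeff, right, List.drop_eq_nil_iff, this]
    · simp
  nsmul := nsmulRec
  zsmul := zsmulRec

open Classical in
/-- The variable `X_j`. -/
noncomputable def X (j : ι) : Magnus ι := ⟨fun w => if w.1 = [j] then 1 else 0⟩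

open Classical in
theorem X_mul_mul_X (j : ι) (f : Magnus ι) : X j * (f * X j) = 0 := by
  ext w
  rw [mul_coeff, zero_coeff]
  refine Finset.sum_eq_zero fun p _ => ?_
  rw [mul_coeff, Finset.mul_sum]
  refine Finset.sum_eq_zero fun q _ => ?_
  by_cases h1 : w.1.take p.1 = [j]
  · by_cases h2 : (w.1.drop p.1).drop q.1 = [j]
    · exfalso
      have hd : (w.1.take p.1).Disjoint (w.1.drop p.1) := by
        have := w.2
        rw [← List.take_append_drop p.1 w.1] at this
        exact List.disjoint_of_nodup_append this
      refine hd (a := j) (by simp [h1]) ?_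
      exact (List.drop_sublist q.1 _).subset (by simp [h2])
    · have h3 : (X j).coeff (right (right w p.1) q.1) = 0 := if_neg h2
      rw [h3, mul_zero, mul_zero]
  · simp [X, left, h1]

theorem X_mul_X (j : ι) : X j * X j = (0 : Magnus ι) := by
  simpa using X_mul_mul_X j (1 : Magnus ι)

/-- The unit `1 + X_j`, with inverse `1 - X_j`. -/
noncomputable def unit (j : ι) : (Magnus ι)ˣ where
  val := 1 + X j
  inv := 1 - X j
  val_inv := by
    have h := X_mul_X j
    noncomm_ring
    simp [h]
  inv_val := by
    have h := X_mul_X j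
    noncomm_ring
    simp [h]

theorem unit_commute (j : ι) (u : (Magnus ι)ˣ) :
    unit j * (u⁻¹ * unit j * u) = (u⁻¹ * unit j * u) * unit j := by
  ext1
  have h1 : X j * (↑u⁻¹ : Magnus ι) * X j = 0 := by
    rw [mul_assoc]; exact X_mul_mul_X j _
  have h2 : X j * (u : Magnus ι) * X j = 0 := by
    rw [mul_assoc]; exact X_mul_mul_X j _
  have hc : (↑u⁻¹ : Magnus ι) * (1 + X j) * u = 1 + ↑u⁻¹ * X j * u := by
    rw [mul_add, add_mul, mul_one, Units.inv_mul]
  simp only [Units.val_mul, unit, hc]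
  have e1 : X j * (↑u⁻¹ * X j * (u : Magnus ι)) = 0 := by
    rw [← mul_assoc, ← mul_assoc, h1, zero_mul]
  have e2 : (↑u⁻¹ * X j * (u : Magnus ι)) * X j = 0 := by
    rw [mul_assoc, mul_assoc, ← mul_assoc (X j), h2, mul_zero]
  rw [add_mul, one_mul, mul_add, mul_one, e1, mul_add, mul_one, add_mul, one_mul, e2]

end Magnus

section Expansion

variable {ι : Type*}

/-- The reduced Magnus expansion: the homomorphism from the reduced free group with
`x_j ↦ 1 + X_j` and `x_j⁻¹ ↦ 1 - X_j`. -/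
noncomputable def magnusExpansion : ReducedFree ι →* (Magnus ι)ˣ :=
  QuotientGroup.lift (reducedKernel (fun j : ι => FreeGroup.of j)) (FreeGroup.lift Magnus.unit) (by
    intro x hx
    refine (Subgroup.normalClosure_le_normal (N := (FreeGroup.lift Magnus.unit).ker) ?_) hx
    rintro _ ⟨j, g, rfl⟩
    have h := Magnus.unit_commute j ((FreeGroup.lift Magnus.unit) g)
    simp only [SetLike.mem_coe, MonoidHom.mem_ker, map_mul, map_inv, FreeGroup.lift_apply_of]
    rw [mul_assoc, h]
    group)

/-- The order on monomials: by degree, and lexicographically in each degree. -/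
def monomialLT [LinearOrder ι] (v w : List ι) : Prop :=
  v.length < w.length ∨ (v.length = w.length ∧ v < w)

/-- An element of the reduced free group is positive if it is trivial, or if the first
non-vanishing term of positive degree in its reduced Magnus expansion has positive
coefficient. -/
def IsPositive [LinearOrder ι] (x : ReducedFree ι) : Prop :=
  x = 1 ∨ ∃ w : {w : List ι // w.Nodup}, w.1 ≠ [] ∧
    0 < (magnusExpansion x : Magnus ι).coeff w ∧
    ∀ v : {w : List ι // w.Nodup}, v.1 ≠ [] → monomialLT v.1 w.1 →
      (magnusExpansion x : Magnus ι).coeff v = 0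

end Expansion

/-! ## Cut-diagrams over a disjoint union of spheres -/

/-- A cell decomposition of the disjoint union of `n` oriented 2-spheres, given by its
oriented edges (darts): `inv` reverses a dart and `next d` is the dart that follows `d` on the
boundary of the face on the left of `d` (faces are polygons, the vertices are recovered as the
orbits of `rot`). -/
structure SphereCells (n : ℕ) where
  Dart : Type
  finite : Finite Dart
  inv : Equiv.Perm Dart
  next : Equiv.Perm Dart
  /-- the component that contains a dart -/
  comp : Dart → Fin n
  inv_inv : ∀ d, inv (inv d) = d
  inv_ne : ∀ d, inv d ≠ d
  comp_inv : ∀ d, comp (inv d) = comp d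
  comp_next : ∀ d, comp (next d) = comp d
  comp_surjective : Function.Surjective comp
  /-- each of the `n` pieces is connected -/
  connected : ∀ d e, comp d = comp e →
    Relation.EqvGen (fun x y => y = inv x ∨ y = next x) d e
  /-- each of the `n` pieces has Euler characteristic 2: `#vertices + #faces = #edges + 2` -/
  euler : ∀ i : Fin n,
    (Quotient.mk (Equiv.Perm.SameCycle.setoid (next.symm.trans inv)) '' {d | comp d = i}).ncard
      + (Quotient.mk (Equiv.Perm.SameCycle.setoid next) '' {d | comp d = i}).ncard
      = (Quotient.mk (Equiv.Perm.SameCycle.setoid inv) '' {d | comp d = i}).ncard + 2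

namespace SphereCells

variable {n : ℕ} (S : SphereCells n)

/-- Counterclockwise rotation of the darts around their common origin. -/
def rot : Equiv.Perm S.Dart := S.next.symm.trans S.inv

end SphereCells

/-- How a dart leaves its origin.  `blank`: the edge does not belong to the immersed 1-manifold.
Otherwise the origin is a regular point, a crossing (at which the strand of the dart is the over-
or the under-strand), or a univalent vertex of type `•` (black) or `∘` (white). -/
inductive Kind
  | blank | reg | upper | lower | black | white

/-- A generically immersed oriented 1-manifold on a union of spheres, with over/under
information and black and white dots, drawn as a subcomplex of a cell decomposition. -/
structure Drawing (n : ℕ) extends SphereCells n where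
  kind : Dart → Kind
  /-- `dir d` is true if the dart `d` runs along the orientation of the 1-manifold -/
  dir : Dart → Bool
  blank_inv : ∀ d, kind (inv d) = Kind.blank ↔ kind d = Kind.blank
  dir_inv : ∀ d, kind d ≠ Kind.blank → dir (inv d) = !(dir d)

namespace Drawing

variable {n : ℕ} (P : Drawing n)

/-- the dart belongs to the 1-manifold -/
def IsCut (d : P.Dart) : Prop := P.kind d ≠ Kind.blank

/-- The first dart of the 1-manifold that is met strictly after `d` when turning
counterclockwise around the origin of `d`. -/
noncomputable def turn (d : P.Dart) : P.Dart :=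
  (P.rot ^ sInf {k : ℕ | 0 < k ∧ P.IsCut ((P.rot ^ k) d)}) d

/-- The regions: connected components of the complement of the 1-manifold, that is, classes of
faces under adjacency along blank edges.  A face is represented by the darts on its boundary. -/
def regionSetoid : Setoid P.Dart :=
  Relation.EqvGen.setoid (fun d e => e = P.next d ∨ (P.kind d = Kind.blank ∧ e = P.inv d))

/-- the regions of a drawing -/
def Region : Type := Quotient P.regionSetoid

/-- the region on the left of a dart -/
def reg (d : P.Dart) : P.Region := Quotient.mk P.regionSetoid d

end Drawing

/-- A cut-diagram over the union of `n` spheres. -/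
structure CutDiagram (n : ℕ) extends Drawing n where
  /-- the label of the cut arc that contains a dart (irrelevant on blank edges) -/
  label : Dart → toDrawing.Region
  /-- the partner of a white dot (a white dot is represented by the dart that leaves it) -/
  pair : Dart → Dart
  label_inv : ∀ d, toDrawing.IsCut d → label (inv d) = label d
  /-- at a regular point, exactly two darts meet, on the same cut arc -/
  regular : ∀ d, kind d = Kind.reg →
    toDrawing.turn d ≠ d ∧ toDrawing.turn (toDrawing.turn d) = d ∧
    kind (toDrawing.turn d) = Kind.reg ∧ dir (toDrawing.turn d) = !(dir d) ∧
    label (toDrawing.turn d) = label d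
  /-- at a crossing, exactly four darts meet, alternately over and under;
  the over-strand lies on one cut arc -/
  over_strand : ∀ d, kind d = Kind.upper →
    kind (toDrawing.turn d) = Kind.lower ∧
    kind (toDrawing.turn (toDrawing.turn d)) = Kind.upper ∧
    toDrawing.turn (toDrawing.turn d) ≠ d ∧
    toDrawing.turn (toDrawing.turn (toDrawing.turn (toDrawing.turn d))) = d ∧
    dir (toDrawing.turn (toDrawing.turn d)) = !(dir d) ∧
    label (toDrawing.turn (toDrawing.turn d)) = label d
  under_strand : ∀ d, kind d = Kind.lower →
    kind (toDrawing.turn d) = Kind.upper ∧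
    dir (toDrawing.turn (toDrawing.turn d)) = !(dir d)
  /-- at a univalent vertex there is only one dart -/
  univalent : ∀ d, kind d = Kind.black ∨ kind d = Kind.white → toDrawing.turn d = d
  /-- First labeling rule: at a crossing whose over-strand has label `C` and whose under-strand
  has label `A` on the right and label `B` on the left of the over-strand, the regions `A` and `B`
  are adjacent along a `C`-labeled cut arc, with `A` on its right and `B` on its left. -/
  rule_crossing : ∀ d, kind d = Kind.upper → dir d = true →
    ∃ c, toDrawing.IsCut c ∧ dir c = true ∧ label c = label d ∧
      toDrawing.reg c = label (toDrawing.turn d) ∧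
      toDrawing.reg (inv c) = label (toDrawing.turn (toDrawing.turn (toDrawing.turn d)))
  /-- Second labeling rule: a cut arc ending at a black dot in region `A` has label `A`. -/
  rule_black : ∀ d, kind d = Kind.black → label d = toDrawing.reg d
  /-- Third labeling rule: the white dots of each component are paired; if one dot of a pair lies
  in region `X` and is incident to a `Y`-labeled arc, then the other one lies in `Y` and is
  incident to an `X`-labeled arc; the local orientations agree. -/
  rule_white : ∀ d, kind d = Kind.white →
    kind (pair d) = Kind.white ∧ pair (pair d) = d ∧ pair d ≠ d ∧ comp (pair d) = comp d ∧
    toDrawing.reg (pair d) = label d ∧ label (pair d) = toDrawing.reg d ∧ dir (pair d) = dir d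

namespace CutDiagram

variable {n : ℕ} (C : CutDiagram n)

/-- The component that contains a region. -/
def regionComp : C.Region → Fin n :=
  Quotient.lift C.comp (by
    intro a b h
    have h' : Relation.EqvGen (fun d e => e = C.next d ∨
      (C.kind d = Kind.blank ∧ e = C.inv d)) a b := h
    induction h' with
    | rel x y h =>
      rename_i hxy
      rcases hxy with rfl | ⟨_, rfl⟩
      · exact (C.comp_next x).symm
      · exact (C.comp_inv x).symm
    | refl x => rfl
    | symm x y _ ih => exact (ih (by assumption)).symm
    | trans x y z _ _ ih1 ih2 => exact (ih1 (by assumption)).trans (ih2 (by assumption)))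

/-- The relations of the group of a cut-diagram: `B⁻¹ A ^ C`, with `A ^ C = C⁻¹ A C`, whenever
a cut arc labeled by `C` has `A` on its right and `B` on its left. -/
def relators : Set (FreeGroup C.Region) :=
  {r | ∃ c, C.IsCut c ∧ C.dir c = true ∧
    r = (FreeGroup.of (C.reg c))⁻¹ * ((FreeGroup.of (C.label c))⁻¹ *
      FreeGroup.of (C.reg (C.inv c)) * FreeGroup.of (C.label c))}

/-- The group of a cut-diagram. -/
abbrev Grp : Type := PresentedGroup C.relators

/-- The meridian associated with a region. -/
def mer (R : C.Region) : C.Grp := PresentedGroup.of R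

/-- A list of darts, read as the list of cut arcs that are successively crossed, from left to
right with respect to the dart, by a path running from region `R` to region `T`. -/
def IsPath : C.Region → List C.Dart → C.Region → Prop
  | R, [], T => R = T
  | R, c :: l, T => C.IsCut c ∧ C.reg c = R ∧ IsPath (C.reg (C.inv c)) l T

/-- The contribution of the crossing of one cut arc: the label, with exponent `1` if the arc is
crossed from its right to its left, and `-1` if it is crossed from its left to its right. -/
def letter (c : C.Dart) : C.Grp :=
  if C.dir c = true then (C.mer (C.label c))⁻¹ else C.mer (C.label c)

/-- The word `w_γ` of a path. -/
def word (l : List C.Dart) : C.Grp := (l.map C.letter).prod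

end CutDiagram

/-- A cut-diagram with a basing: the choice of one region on each component. -/
structure BasedCutDiagram (n : ℕ) extends CutDiagram n where
  base : Fin n → toCutDiagram.Region
  base_comp : ∀ i, toCutDiagram.regionComp (base i) = i

namespace BasedCutDiagram

variable {n : ℕ} (C : BasedCutDiagram n)

/-- The reduced group of a cut-diagram, with respect to the meridians chosen by the basing. -/
abbrev RGrp : Type := ReducedGroup (fun j : Fin n => C.mer (C.base j))

/-- The normal subgroup of the reduced group that is generated by the `i`th meridians. -/
def meridianKernel (i : Fin n) : Subgroup C.RGrp :=
  Subgroup.normalClosure {x | ∃ R : C.Region, C.regionComp R = i ∧ x = QuotientGroup.mk (C.mer R)}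

instance (i : Fin n) : (C.meridianKernel i).Normal := Subgroup.normalClosure_normal

/-- The quotient of the reduced group by the normal subgroup generated by `i`th meridians. -/
abbrev RGrpAt (i : Fin n) : Type := C.RGrp ⧸ C.meridianKernel i

/-- The projection from the group of a cut-diagram. -/
def toAt (i : Fin n) : C.Grp →* C.RGrpAt i :=
  (QuotientGroup.mk' (C.meridianKernel i)).comp (QuotientGroup.mk' _)

/-- The sign of a white dot: positive if the incident arc is oriented outwards. -/
def dotSign (p : C.Dart) : ℤ := if C.dir p = true then 1 else -1

open Classical in
/-- The positive one among `x` and `x⁻¹`, for `x = w_{α₁} w_{α₂}⁻¹`, transported by `φ`. -/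
noncomputable def pairElement (i : Fin n)
    (φ : C.RGrpAt i ≃* ReducedFree {j : Fin n // j ≠ i}) (α₁ α₂ : List C.Dart) :
    ReducedFree {j : Fin n // j ≠ i} :=
  if IsPositive (φ (C.toAt i (C.word α₁ * (C.word α₂)⁻¹)))
  then φ (C.toAt i (C.word α₁ * (C.word α₂)⁻¹))
  else φ (C.toAt i (C.word α₂ * (C.word α₁)⁻¹))

/-- `s` is a value of `S_i(C)`, computed by means of the isomorphism `φ` that is specified by the
basing, of an ordering `(p, pair p)` of each pair of white dots on the `i`th component
(`p ∈ T`), and of a choice of paths from the base region to all these dots. -/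
def IsKirkSum (i : Fin n) (s : MonoidAlgebra ℤ (ReducedFree {j : Fin n // j ≠ i})) : Prop :=
  ∃ (φ : C.RGrpAt i ≃* ReducedFree {j : Fin n // j ≠ i}) (T : Finset C.Dart)
    (α₁ α₂ : C.Dart → List C.Dart),
    (∀ j : {j : Fin n // j ≠ i}, φ (C.toAt i (C.mer (C.base j))) = ReducedFree.gen j) ∧
    (∀ p ∈ T, C.kind p = Kind.white ∧ C.comp p = i) ∧
    (∀ p, C.kind p = Kind.white → C.comp p = i → (p ∈ T ↔ C.pair p ∉ T)) ∧
    (∀ p ∈ T, C.IsPath (C.base i) (α₁ p) (C.reg p)) ∧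
    (∀ p ∈ T, C.IsPath (C.base i) (α₂ p) (C.reg (C.pair p))) ∧
    s = ∑ p ∈ T, C.dotSign p •
      (MonoidAlgebra.of ℤ _ (C.pairElement i φ (α₁ p) (α₂ p)) - 1)

end BasedCutDiagram

/-! ## Moves -/

/-- A local picture, drawn in one or several disks that are cut into polygons.  An edge is
denoted by a positive integer `k`, and its two darts by `k` and `-k`.  Each polygon is given by
the cyclic word of its boundary darts, counterclockwise.  An edge both darts of which occur is
interior; a dart whose opposite does not occur lies on the boundary of the disks. -/
structure Patch where
  faces : List (List ℤ)
  /-- interior edges `k` of the 1-manifold: number of a strand, which is oriented like `k` or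
  opposite to all its edges, then the kinds of `k` and of `-k` -/
  cuts : List (ℤ × ℕ × Kind × Kind) := []
  /-- interior edges that are blank -/
  blanks : List ℤ := []
  /-- pairs of white dots -/
  pairs : List (ℤ × ℤ) := []
  /-- darts with the same label -/
  sameLabel : List (ℤ × ℤ) := []
  /-- `(a, b)`: the label of `a` is the region of `b` -/
  labelRegion : List (ℤ × ℤ) := []
  /-- `(a, b)`: some paired white dots, not represented in the picture, form an `(A, B)`-pair, where
  `A` and `B` are the labels of `a` and `b` -/
  linked : List (ℤ × ℤ) := []

namespace Patch

variable (M : Patch)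

def darts : Set ℤ := {a | a ∈ M.faces.flatten}

def inner : Set ℤ := {a | a ∈ M.darts ∧ -a ∈ M.darts}

/-- `ι` identifies the patch with a union of faces of `C`; the strand number `s` is oriented
according to `o s`. -/
structure Embeds {n : ℕ} (o : ℕ → Bool) (C : CutDiagram n) (ι : ℤ → C.Dart) : Prop where
  injOn : Set.InjOn ι M.darts
  face : ∀ w ∈ M.faces, ∀ p ∈ w.zip (w.rotate 1), C.next (ι p.1) = ι p.2
  edge : ∀ a ∈ M.inner, C.inv (ι a) = ι (-a)
  cut : ∀ c ∈ M.cuts, C.kind (ι c.1) = c.2.2.1 ∧ C.kind (ι (-c.1)) = c.2.2.2 ∧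
    C.dir (ι c.1) = o c.2.1
  blank : ∀ a ∈ M.blanks, C.kind (ι a) = Kind.blank
  pair : ∀ p ∈ M.pairs, C.pair (ι p.1) = ι p.2
  same : ∀ p ∈ M.sameLabel, C.label (ι p.1) = C.label (ι p.2)
  labelReg : ∀ p ∈ M.labelRegion, C.label (ι p.1) = C.reg (ι p.2)
  link : ∀ p ∈ M.linked, ∃ d, C.kind d = Kind.white ∧
    C.reg d = C.label (ι p.1) ∧ C.label d = C.label (ι p.2)

/-- the darts of `C` that are not interior to the patch -/
def kept {n : ℕ} (C : CutDiagram n) (ι : ℤ → C.Dart) : Set C.Dart := {d | d ∉ ι '' M.inner}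

end Patch

/-- A local move: two patches with the same boundary darts. -/
structure Move where
  before : Patch
  after : Patch
  /-- interior darts that are identified before and after the move (the ends of the strands at
  the boundary of the disks) -/
  track : List (ℤ × ℤ) := []
  /-- white dots that are identified before and after the move -/
  dots : List (ℤ × ℤ) := []

namespace Move

/-- The diagrams `C` and `C'` differ by the replacement of the patch `M.before` by `M.after`.
The map `θ` identifies what is not changed.  Two regions correspond to each other if they have a
point outside the interior of the disks in common; labels, and the basing, are only preserved up
to this correspondence.  A region that lies in the interior of the disks is not a label. -/
structure Connects (M : Move) {n : ℕ} (C C' : BasedCutDiagram n) (o : ℕ → Bool)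
    (ι : ℤ → C.Dart) (ι' : ℤ → C'.Dart) (θ : C.Dart → C'.Dart) : Prop where
  embeds : M.before.Embeds o C.toCutDiagram ι
  embeds' : M.after.Embeds o C'.toCutDiagram ι'
  bij : Set.BijOn θ (M.before.kept C.toCutDiagram ι) (M.after.kept C'.toCutDiagram ι')
  inv : ∀ d ∈ M.before.kept C.toCutDiagram ι, θ (C.inv d) = C'.inv (θ d)
  next : ∀ d, d ∉ ι '' M.before.darts → θ (C.next d) = C'.next (θ d)
  boundary : ∀ a ∈ M.before.darts, a ∉ M.before.inner → θ (ι a) = ι' a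
  comp : ∀ d ∈ M.before.kept C.toCutDiagram ι, C'.comp (θ d) = C.comp d
  kind : ∀ d d', ((d ∈ M.before.kept C.toCutDiagram ι ∧ d' = θ d) ∨
      ∃ p ∈ M.track, d = ι p.1 ∧ d' = ι' p.2) →
    C'.kind d' = C.kind d ∧ (C.IsCut d → C'.dir d' = C.dir d ∧
      ∃ e ∈ M.before.kept C.toCutDiagram ι, C.reg e = C.label d ∧ C'.reg (θ e) = C'.label d')
  pair : ∀ d d', C.kind d = Kind.white →
    ((d ∈ M.before.kept C.toCutDiagram ι ∧ d' = θ d) ∨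
      ∃ p ∈ M.track ++ M.dots, d = ι p.1 ∧ d' = ι' p.2) →
    ((C.pair d ∈ M.before.kept C.toCutDiagram ι ∧ C'.pair d' = θ (C.pair d)) ∨
      ∃ p ∈ M.track ++ M.dots, C.pair d = ι p.1 ∧ C'.pair d' = ι' p.2)
  label : ∀ d, C.IsCut d → ∃ e ∈ M.before.kept C.toCutDiagram ι, C.reg e = C.label d
  label' : ∀ d, C'.IsCut d → ∃ e ∈ M.after.kept C'.toCutDiagram ι', C'.reg e = C'.label d
  base : ∀ i, ∃ e ∈ M.before.kept C.toCutDiagram ι, C.reg e = C.base i ∧ C'.reg (θ e) = C'.base i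

/-- `C'` is obtained from `C` by the move `M`, for some orientation of the strands. -/
def Applies (M : Move) {n : ℕ} (C C' : BasedCutDiagram n) : Prop :=
  ∃ o ι ι' θ, M.Connects C C' o ι ι' θ

end Move

open Kind

/-- the kind of a dart that leaves a crossing -/
def strandKind (isUpper : Bool) : Kind := if isUpper then upper else lower

/-! ### Changes of the auxiliary cell decomposition

These do not change the cut-diagram. -/

/-- Relabeling of the cells: a homeomorphism that preserves orientations and components. -/
def moveIso : Move where
  before := { faces := [] }
  after := { faces := [] }

/-- Subdivision of a polygon with `a + b` sides by a blank edge. -/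
def moveSplit (a b : ℕ) : Move where
  before := { faces := [(List.range (a + b)).map (fun k => (k : ℤ) + 1)] }
  after :=
    { faces := [(List.range a).map (fun k => (k : ℤ) + 1) ++ [((a + b + 1 : ℕ) : ℤ)],
        -((a + b + 1 : ℕ) : ℤ) :: (List.range b).map (fun k => ((a + k : ℕ) : ℤ) + 1)]
      blanks := [((a + b + 1 : ℕ) : ℤ)] }

/-- Subdivision of an edge (blank or not) by a new vertex. -/
def moveSubdivide : Move where
  before := { faces := [[3, 1], [-3, 2]] }
  after := { faces := [[3, 4, 1], [-4, -3, 2]] }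
  track := [(3, 3), (-3, -4)]

/-! ### Topological moves -/

/-- Creation of an arc with two black dots. -/
def moveArc : Move where
  before := { faces := [[1]] }
  after :=
    { faces := [[1, 2, 3, -3, -2]]
      cuts := [(3, 0, black, black)]
      blanks := [2] }

/-- Creation of a circle bounding a disk. -/
def moveCircle : Move where
  before := { faces := [[1]] }
  after :=
    { faces := [[1, 2, -3, -2], [3]]
      cuts := [(3, 0, reg, reg)]
      blanks := [2] }

/-- Creation of a kink (four types): the loop lies on the left of the strand if `l` is true, and
the first passage through the crossing is the over-passage if `f` is true. -/
def moveKink (l f : Bool) : Move where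
  before := { faces := [[3, 1], [-3, 2]], cuts := [(3, 0, reg, reg)] }
  after :=
    { faces := if l then [[4], [3, -4, 5, 1], [-5, -3, 2]] else [[-4], [3, 5, 1], [-5, 4, -3, 2]]
      cuts := [(3, 0, reg, strandKind f),
        (4, 0, strandKind f, strandKind (!f)),
        (5, 0, strandKind (!f), reg)]
      sameLabel := [(3, 5)] }
  track := [(3, 3), (-3, -5)]

/-- Reconnection of two antiparallel strands with the same label. -/
def moveSaddle : Move where
  before :=
    { faces := [[5, 4], [-5, 1, -6, 3], [6, 2]]
      cuts := [(5, 0, reg, reg), (6, 0, reg, reg)]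
      sameLabel := [(5, 6)] }
  after :=
    { faces := [[-7, 1], [7, 2, 8, 4], [-8, 3]]
      cuts := [(7, 0, reg, reg), (8, 0, reg, reg)]
      sameLabel := [(7, 8)] }
  track := [(5, 7), (-5, -8), (6, 8), (-6, -7)]

/-- A black dot passes under a strand. -/
def moveSlide : Move where
  before :=
    { faces := [[-4, 1], [4, 2, 5, -5, 3]]
      cuts := [(4, 0, reg, reg), (5, 1, reg, black)] }
  after :=
    { faces := [[6, 2, 5], [4, -5, 3], [-6, 7, -7, -4, 1]]
      cuts := [(4, 0, reg, upper), (6, 0, upper, reg), (5, 1, reg, lower), (7, 1, lower, black)] }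
  track := [(4, 4), (-4, -6), (5, 5)]

/-- Fusion of two arcs at two facing black dots. -/
def moveFuse : Move where
  before :=
    { faces := [[1, -4, 4, 2, 3, -3]]
      cuts := [(3, 0, reg, black), (4, 0, black, reg)] }
  after := { faces := [[3, 2], [-3, 1]], cuts := [(3, 0, reg, reg)] }
  track := [(3, 3), (-4, -3)]

/-- The Reidemeister 2 move. -/
def moveR2 : Move where
  before :=
    { faces := [[5, 4], [-5, 1, 6, 3], [-6, 2]]
      cuts := [(5, 0, reg, reg), (6, 1, reg, reg)] }
  after :=
    { faces := [[1, 6, -5], [5, 9, 8, 4], [-6, 2, -10, -7], [10, 3, -8], [7, -9]]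
      cuts := [(5, 0, reg, upper), (7, 0, upper, upper), (8, 0, upper, reg),
        (6, 1, reg, lower), (9, 1, lower, lower), (10, 1, lower, reg)] }
  track := [(5, 5), (-5, -8), (6, 6), (-6, -10)]

/-- The Reidemeister 3 move (two types): strand 0 lies over the two other ones, and strand 1 lies
over strand 2 if `f` is true, under it otherwise. -/
def moveR3 (f : Bool) : Move where
  before :=
    { faces := [[1, 21, -11], [2, 31, -12, -21], [3, -13, -31], [4, -23, -32, 13], [5, -33, 23],
        [6, 11, 22, 33], [12, 32, -22]]
      cuts := [(11, 0, reg, upper), (12, 0, upper, upper), (13, 0, upper, reg),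
        (21, 1, reg, lower), (22, 1, lower, strandKind f),
        (23, 1, strandKind f, reg),
        (31, 2, reg, lower), (32, 2, lower, strandKind (!f)),
        (33, 2, strandKind (!f), reg)] }
  after :=
    { faces := [[1, 21, 32, -11], [2, 31, -21], [3, -13, -22, -31], [4, -23, 13],
        [5, -33, 12, 23], [6, 11, 33], [-12, -32, 22]]
      cuts := [(11, 0, reg, upper), (12, 0, upper, upper), (13, 0, upper, reg),
        (21, 1, reg, strandKind f), (22, 1, strandKind f, lower),
        (23, 1, lower, reg),
        (31, 2, reg, strandKind (!f)), (32, 2, strandKind (!f), lower),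
        (33, 2, lower, reg)] }
  track := [(11, 11), (-13, -13), (21, 21), (-23, -23), (31, 31), (-33, -33)]

/-! ### Self-singular moves -/

/-- Crossing change between an `A`-labeled and a `B`-labeled strand (the over-strand having
label `A` or `B` on both sides of the under-strand as well), in the presence of an
`(A, B)`-pair of white dots. -/
def moveCrossingChange : Move where
  before :=
    { faces := [[1, -6, 8], [2, 7, 6], [3, 5, -7], [4, -8, -5]]
      cuts := [(5, 0, reg, upper), (6, 0, upper, reg), (7, 1, reg, lower), (8, 1, lower, reg)]
      sameLabel := [(7, 8)]
      linked := [(5, 7)] }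
  after :=
    { faces := [[1, -6, 8], [2, 7, 6], [3, 5, -7], [4, -8, -5]]
      cuts := [(5, 0, reg, lower), (6, 0, lower, reg), (7, 1, reg, upper), (8, 1, upper, reg)]
      sameLabel := [(5, 6)]
      linked := [(5, 7)] }
  track := [(5, 5), (-6, -6), (7, 7), (-8, -8)]

/-- Two paired white dots pass simultaneously under two strands with the same label, the one away
from its arc and the other one backwards along its arc. -/
def moveDotSlide : Move where
  before :=
    { faces := [[-4, 1], [4, 2, 5, -5, 3], [12, -16, -15], [11, 15, -14], [14, 17, -17, 16, 13]]
      cuts := [(4, 0, reg, reg), (5, 1, reg, white), (14, 0, reg, upper), (16, 0, upper, reg),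
        (15, 1, reg, lower), (17, 1, lower, white)]
      pairs := [(-5, -17)]
      sameLabel := [(4, 14)] }
  after :=
    { faces := [[6, 2, 5], [4, -5, 3], [-6, 7, -7, -4, 1], [14, 13], [-14, 11, 15, -15, 12]]
      cuts := [(4, 0, reg, upper), (6, 0, upper, reg), (5, 1, reg, lower), (7, 1, lower, white),
        (14, 0, reg, reg), (15, 1, reg, white)]
      pairs := [(-7, -15)]
      sameLabel := [(4, 14)] }
  track := [(4, 4), (-4, -6), (5, 5), (14, 14), (-16, -14), (15, 15)]
  dots := [(-5, -7), (-17, -15)]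

/-- Finger move: an `A`-labeled strand is interrupted between two white dots, which are paired
with the two ends of a new arc in the region `A`. -/
def moveFinger : Move where
  before :=
    { faces := [[3, 2], [-3, 1], [11]]
      cuts := [(3, 0, reg, reg)]
      labelRegion := [(3, 11)] }
  after :=
    { faces := [[1, -4, 4, 2, 3, -3], [11, 12, 13, -13, -12]]
      cuts := [(3, 0, reg, white), (4, 0, white, reg), (13, 0, white, white)]
      blanks := [12]
      pairs := [(-3, -13), (4, 13)] }
  track := [(3, 3), (-3, -4)]

/-- Finger move, second version: creation of two arcs with paired white ends in two disks. -/
def moveFinger' : Move where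
  before := { faces := [[1], [11]] }
  after :=
    { faces := [[1, 2, 3, -3, -2], [11, 12, 13, -13, -12]]
      cuts := [(3, 0, white, white), (13, 0, white, white)]
      blanks := [2, 12]
      pairs := [(3, 13), (-3, -13)] }

/-- Cusp homotopy: a black dot is replaced by a white dot, paired with the white end of a new arc
in the same region whose other end is a black dot. -/
def moveCusp : Move where
  before := { faces := [[1, 3, -3]], cuts := [(3, 0, reg, black)] }
  after :=
    { faces := [[1, 3, -3, 5, 4, -4, -5]]
      cuts := [(3, 0, reg, white), (4, 0, black, white)]
      blanks := [5]
      pairs := [(-3, -4)] }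
  track := [(3, 3)]

/-- The moves that generate the self-singular equivalence of cut-diagrams. -/
inductive IsMove : Move → Prop
  | iso : IsMove moveIso
  | split (a b : ℕ) : IsMove (moveSplit a b)
  | subdivide : IsMove moveSubdivide
  | arc : IsMove moveArc
  | circle : IsMove moveCircle
  | kink (l f : Bool) : IsMove (moveKink l f)
  | saddle : IsMove moveSaddle
  | slide : IsMove moveSlide
  | fuse : IsMove moveFuse
  | r2 : IsMove moveR2
  | r3 (f : Bool) : IsMove (moveR3 f)
  | crossingChange : IsMove moveCrossingChange
  | dotSlide : IsMove moveDotSlide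
  | finger : IsMove moveFinger
  | finger' : IsMove moveFinger'
  | cusp : IsMove moveCusp

/-- Self-singular equivalence of based cut-diagrams: the equivalence relation generated by
topological and self-singular moves. -/
def SelfSingularEquiv {n : ℕ} : BasedCutDiagram n → BasedCutDiagram n → Prop :=
  Relation.EqvGen (fun C C' => ∃ M, IsMove M ∧ M.Applies C C')

end KirkCut

/-! Fix a component `i`. A diagram is encoded by a framing: every region gets a color, consisting of
its component and an element of the reduced free group on the other components. Off component `i`
this element is the image of the meridian; on component `i` it is the class of a path from the base
region. Crossing an arc conjugates elements of the first kind by the letter of the arc and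
multiplies those of the second kind by it on the right, so that both obey one rule (`Color.act`).

Framings exist for two reasons. First, spheres are simply connected: a group-valued function on the
edges whose product around each vertex is trivial is a coboundary (`exists_potential`). The letters
on a component satisfy this condition once its own regions have trivial color: at crossings by the
first labeling rule, at dots because the label lies on the same component. Secondly, reduced groups
on finitely many generators are nilpotent, and a coloring with prescribed base values lifts through
central quotients (`exists_coloring`). A framing yields `φ`; it is invertible because normal
generators of a nilpotent group generate it.

By `IsFraming.map_word`, `φ` of the word of a path from the base on component `i` is the color of
its end, so the choice of paths is irrelevant. The order of the dots is irrelevant because exactly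
one of `x`, `x⁻¹` is positive for `x ≠ 1`, which rests on the injectivity of the reduced Magnus
expansion. Hence twice the sum is a sum over all white dots that only involves a framing
(`IsKirkSum.two_smul`), and doubling is injective in the group ring.

For invariance, a framing after a move is carried to a framing before it that agrees outside the
disks (`Move.Connects.exists_isFraming`); it remains to compare the white dots inside the disks.
Those created by a finger move cancel in opposite signs, those of a cusp have trivial group element,
and in the slide of two paired dots both colors are multiplied by the same letter, which leaves
their quotient unchanged. -/

namespace KirkCut

/-! ## Groups with a reduced family of normal generators -/

section ReducedFamilies

open Subgroup

/-- Every member of the family commutes with all of its conjugates. -/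
def IsReducedFamily {G ι : Type*} [Group G] (a : ι → G) : Prop :=
  ∀ j g, Commute (a j) (g⁻¹ * a j * g)

variable {G ι : Type*} [Group G] {a : ι → G}

theorem IsReducedFamily.map {H : Type*} [Group H] (ha : IsReducedFamily a) (f : G →* H)
    (hf : Function.Surjective f) : IsReducedFamily (fun j => f (a j)) := by
  intro j g
  obtain ⟨g, rfl⟩ := hf g
  simpa using (ha j g).map f

theorem isReducedFamily_reducedGroup (a : ι → G) :
    IsReducedFamily (fun j => (QuotientGroup.mk (a j) : ReducedGroup a)) := by
  intro j g
  obtain ⟨g, rfl⟩ := QuotientGroup.mk_surjective g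
  have h : (QuotientGroup.mk ((a j)⁻¹ * (g⁻¹ * a j * g)⁻¹ * a j * (g⁻¹ * a j * g)) :
      ReducedGroup a) = 1 :=
    (QuotientGroup.eq_one_iff _).2 (subset_normalClosure ⟨j, g, rfl⟩)
  rw [← QuotientGroup.mk_inv, ← QuotientGroup.mk_mul, ← QuotientGroup.mk_mul]
  have h2 : a j * (g⁻¹ * a j * g) = (g⁻¹ * a j * g) * a j *
      ((a j)⁻¹ * (g⁻¹ * a j * g)⁻¹ * a j * (g⁻¹ * a j * g)) := by group
  unfold Commute SemiconjBy
  rw [← QuotientGroup.mk_mul, h2, QuotientGroup.mk_mul, h, mul_one, QuotientGroup.mk_mul]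

theorem IsReducedFamily.commute_conj (ha : IsReducedFamily a) (j : ι) (g h : G) :
    Commute (g⁻¹ * a j * g) (h⁻¹ * a j * h) := by
  have h1 := ha j (h * g⁻¹)
  have h2 := h1.map (MulAut.conj g⁻¹).toMonoidHom
  simpa [mul_assoc] using h2

/-- The conjugates of one member commute pairwise and generate its normal closure, which is
therefore abelian. -/
theorem IsReducedFamily.commute_of_mem (ha : IsReducedFamily a) (j : ι) {x y : G}
    (hx : x ∈ normalClosure {a j}) (hy : y ∈ normalClosure {a j}) : Commute x y := by
  have hc : ∀ z ∈ Group.conjugatesOfSet {a j}, ∃ g : G, z = g⁻¹ * a j * g := by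
    intro z hz
    rw [Group.mem_conjugatesOfSet_iff] at hz
    obtain ⟨_, rfl, hz⟩ := hz
    obtain ⟨g, rfl⟩ := isConj_iff.1 hz
    exact ⟨g⁻¹, by simp⟩
  have key : ∀ y ∈ Group.conjugatesOfSet {a j}, ∀ x ∈ normalClosure {a j}, Commute x y := by
    intro y hy x hx
    refine closure_induction (p := fun x _ => Commute x y) ?_ ?_ ?_ ?_ hx
    · intro x hx
      obtain ⟨g, rfl⟩ := hc x hx
      obtain ⟨h, rfl⟩ := hc y hy
      exact ha.commute_conj j g h
    · exact Commute.one_left y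
    · intro _ _ _ _ h1 h2
      exact h1.mul_left h2
    · intro _ _ h
      exact h.inv_left
  refine closure_induction (p := fun y _ => Commute x y) ?_ ?_ ?_ ?_ hy
  · exact fun y hy => key y hy x hx
  · exact Commute.one_right x
  · intro _ _ _ _ h1 h2
    exact h1.mul_right h2
  · intro _ _ h
    exact h.inv_right

/-- Induction along central quotients: if `H` maps onto `G` modulo the center, every element of `G`
is a product of an element of `H` and a central one, so `H` is normal and equals its normal closure.
This turns normal generators into generators. -/
theorem eq_top_of_normalClosure_eq_top [Group.IsNilpotent G] (H : Subgroup G)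
    (hH : normalClosure (H : Set G) = ⊤) : H = ⊤ := by
  revert H
  refine Group.nilpotent_center_quotient_ind
    (P := fun G _ _ => ∀ H : Subgroup G, normalClosure (H : Set G) = ⊤ → H = ⊤) G ?_ ?_
  · intro G _ _ H _
    exact Subsingleton.elim _ _
  · intro G _ _ ih H hH
    have h1 := ih (H.map (QuotientGroup.mk' (center G))) (by
      rw [coe_map, ← map_normalClosure _ _ (QuotientGroup.mk'_surjective _), hH,
        ← MonoidHom.range_eq_map, MonoidHom.range_eq_top.2 (QuotientGroup.mk'_surjective _)])
    have hn : H.Normal := by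
      constructor
      intro x hx g
      have : (QuotientGroup.mk' (center G)) g ∈ H.map (QuotientGroup.mk' (center G)) := by
        rw [h1]; trivial
      obtain ⟨y, hy, hyg⟩ := this
      obtain ⟨z, hz, rfl⟩ := (QuotientGroup.mk'_eq_mk' _).1 hyg
      have : y * z * x * (y * z)⁻¹ = y * x * y⁻¹ := by
        have hzx : z * x = x * z := ((mem_center_iff.1 hz) x).symm
        rw [mul_assoc y, hzx]
        group
      rw [this]
      exact H.mul_mem (H.mul_mem hy hx) (H.inv_mem hy)
    rw [← hH, normalClosure_eq_self]

/-- Milnor's argument, by induction on the number of nontrivial members. An element that dies in the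
quotient by each member lies in all of their abelian normal closures, so it commutes with every
conjugate of every member, that is, with everything. Thus the kernel of the map to the finite
product of these nilpotent quotients is central. -/
theorem IsReducedFamily.isNilpotent [Finite ι] (ha : IsReducedFamily a)
    (hn : normalClosure (Set.range a) = ⊤) : Group.IsNilpotent G := by
  classical
  have := Fintype.ofFinite ι
  -- The group changes during the induction, which runs over a set `s` of indices outside which the
  -- family is trivial.
  suffices h : ∀ (s : Finset ι) {G : Type _} [Group G] (a : ι → G), IsReducedFamily a →
      normalClosure (Set.range a) = ⊤ → (∀ j ∉ s, a j = 1) → Group.IsNilpotent G from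
    h Finset.univ a ha hn (by simp)
  intro s
  induction s using Finset.strongInduction with
  | H s ih =>
    intro G _ a ha hn hs
    have hq : ∀ j : s, Group.IsNilpotent (G ⧸ normalClosure {a j}) := by
      intro j
      refine ih (s.erase j) (Finset.erase_ssubset j.2)
        (fun k => QuotientGroup.mk' (normalClosure {a j}) (a k))
        (ha.map _ (QuotientGroup.mk'_surjective _)) ?_ ?_
      · have := map_normalClosure (Set.range a) (QuotientGroup.mk' (normalClosure {a j}))
          (QuotientGroup.mk'_surjective _)
        rw [hn, ← MonoidHom.range_eq_map,
          MonoidHom.range_eq_top.2 (QuotientGroup.mk'_surjective _), ← Set.range_comp] at this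
        exact this.symm
      · intro k hk
        by_cases hkj : k = j
        · subst hkj
          exact (QuotientGroup.eq_one_iff _).2 (subset_normalClosure rfl)
        · rw [hs k (fun h => hk (Finset.mem_erase.2 ⟨hkj, h⟩)), map_one]
    let f : G →* (∀ j : s, G ⧸ normalClosure {a j}) :=
      MonoidHom.pi fun j : s => QuotientGroup.mk' (normalClosure {a (j : ι)})
    refine Subgroup.isNilpotent_of_ker_le_center f ?_
    intro x hx
    have hx' : ∀ j ∈ s, x ∈ normalClosure {a j} := by
      intro j hj
      have := congrFun (MonoidHom.mem_ker.1 hx) ⟨j, hj⟩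
      exact (QuotientGroup.eq_one_iff _).1 this
    have hle : normalClosure (Set.range a) ≤ centralizer {x} := by
      refine (closure_le _).2 ?_
      intro y hy
      rw [Group.mem_conjugatesOfSet_iff] at hy
      obtain ⟨_, ⟨j, rfl⟩, hy⟩ := hy
      obtain ⟨g, rfl⟩ := isConj_iff.1 hy
      rw [SetLike.mem_coe, mem_centralizer_singleton_iff]
      by_cases hj : j ∈ s
      · have h1 : a j ∈ normalClosure {a j} := subset_normalClosure (Set.mem_singleton _)
        have h2 : g * a j * g⁻¹ ∈ normalClosure {a j} :=
          Subgroup.Normal.conj_mem inferInstance _ h1 g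
        exact (ha.commute_of_mem j h2 (hx' j hj)).eq
      · simp [hs j hj]
    rw [hn] at hle
    rw [mem_center_iff]
    intro g
    exact mem_centralizer_singleton_iff.1 (hle (mem_top g))

theorem ReducedFree.isReducedFamily : IsReducedFamily (ReducedFree.gen (ι := ι)) :=
  isReducedFamily_reducedGroup _

theorem ReducedFree.closure_gen : closure (Set.range (ReducedFree.gen (ι := ι))) = ⊤ := by
  have := MonoidHom.map_closure (QuotientGroup.mk' (reducedKernel (fun j : ι => FreeGroup.of j)))
    (Set.range FreeGroup.of)
  rw [FreeGroup.closure_range_of, ← MonoidHom.range_eq_map,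
    MonoidHom.range_eq_top.2 (QuotientGroup.mk'_surjective _), ← Set.range_comp] at this
  exact this.symm

theorem ReducedFree.hom_ext {H : Type*} [Group H] {f g : ReducedFree ι →* H}
    (h : ∀ j, f (ReducedFree.gen j) = g (ReducedFree.gen j)) : f = g := by
  refine MonoidHom.eq_of_eqOn_top fun x _ => ?_
  have : x ∈ closure (Set.range (ReducedFree.gen (ι := ι))) := by
    rw [ReducedFree.closure_gen]; trivial
  refine MonoidHom.eqOn_closure ?_ this
  rintro _ ⟨j, rfl⟩
  exact h j

instance ReducedFree.isNilpotent [Finite ι] : Group.IsNilpotent (ReducedFree ι) :=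
  ReducedFree.isReducedFamily.isNilpotent (top_unique (by
    rw [← ReducedFree.closure_gen]; exact closure_le_normalClosure))

/-- The universal property of reduced groups: their relators die wherever the images form a reduced
family. -/
theorem IsReducedFamily.reducedKernel_le (ha : IsReducedFamily a) {H : Type*} [Group H]
    {b : ι → H} (f : H →* G) (hf : ∀ j, f (b j) = a j) : reducedKernel b ≤ f.ker := by
  refine normalClosure_le_normal ?_
  rintro _ ⟨j, g, rfl⟩
  rw [SetLike.mem_coe, MonoidHom.mem_ker]
  have h := (ha j (f g)).eq
  simp only [map_mul, map_inv, hf]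
  rw [mul_assoc, h]
  group

/-- A reduced family defines a homomorphism from the reduced free group. -/
def ReducedFree.lift (ha : IsReducedFamily a) : ReducedFree ι →* G :=
  QuotientGroup.lift _ (FreeGroup.lift a) (ha.reducedKernel_le _ (by simp))

@[simp] theorem ReducedFree.lift_gen (ha : IsReducedFamily a) (j : ι) :
    ReducedFree.lift ha (ReducedFree.gen j) = a j := by
  simp [ReducedFree.lift, ReducedFree.gen]

end ReducedFamilies
end KirkCut

namespace KirkCut

/-! ## The reduced Magnus expansion is injective -/

namespace Magnus

variable {ι : Type*}

open Classical in
theorem X_coeff (j : ι) (w) : (X j).coeff w = if w.1 = [j] then 1 else 0 := rfl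

theorem nodup_of_append {v : List ι} {j : ι} (h : (v ++ [j]).Nodup) : v.Nodup :=
  h.sublist (List.sublist_append_left v [j])

theorem nil_coeff_mul (f g : Magnus ι) (h : ([] : List ι).Nodup) :
    (f * g).coeff ⟨[], h⟩ = f.coeff ⟨[], h⟩ * g.coeff ⟨[], h⟩ := by
  simp [mul_coeff, left, right]

theorem mul_X_coeff_append (f : Magnus ι) (j : ι) (v : List ι) (h : (v ++ [j]).Nodup) :
    (f * X j).coeff ⟨v ++ [j], h⟩ = f.coeff ⟨v, nodup_of_append h⟩ := by
  rw [mul_coeff, Finset.sum_eq_single (v.length, 1)]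
  · simp [X_coeff, left, right]
  · rintro ⟨p, q⟩ hp hne
    have : (right ⟨v ++ [j], h⟩ p).1 ≠ [j] := by
      intro h'
      have := congrArg List.length h'
      simp [right] at this hp
      apply hne
      ext <;> simp <;> omega
    simp [X_coeff, this]
  · simp

theorem mul_X_coeff_eq_zero (f : Magnus ι) (j : ι) (w : {w : List ι // w.Nodup})
    (h : ∀ v, w.1 ≠ v ++ [j]) : (f * X j).coeff w = 0 := by
  rw [mul_coeff]
  refine Finset.sum_eq_zero fun p _ => ?_
  have : (right w p.1).1 ≠ [j] := fun h' => h (w.1.take p.1) (by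
    rw [← h']; exact (List.take_append_drop _ _).symm)
  simp [X_coeff, this]

/-- The letter `j` does not occur in `v`, so a prefix of `v ++ [j]` ending with `j` is the whole
word, and `g` only contributes its constant term. -/
theorem mul_X_mul_coeff_append (f g : Magnus ι) (j : ι) (v : List ι) (h : (v ++ [j]).Nodup)
    (hg : g.coeff ⟨[], List.nodup_nil⟩ = 1) :
    (f * X j * g).coeff ⟨v ++ [j], h⟩ = f.coeff ⟨v, nodup_of_append h⟩ := by
  rw [mul_coeff, Finset.sum_eq_single ((v ++ [j]).length, 0)]
  · have h1 : left ⟨v ++ [j], h⟩ (v ++ [j]).length = ⟨v ++ [j], h⟩ := by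
      ext1; exact List.take_length
    have h2 : right ⟨v ++ [j], h⟩ (v ++ [j]).length = ⟨[], List.nodup_nil⟩ := by
      ext1; exact List.drop_length
    simp only [h1, h2, hg, mul_one]
    exact mul_X_coeff_append f j v h
  · rintro ⟨p, q⟩ hp hne
    rw [mul_X_coeff_eq_zero, zero_mul]
    intro u hu
    simp only [left] at hu
    have hp' : p ≤ v.length := by
      have : ¬ (q = 0) := by rintro rfl; simp at hp hne; exact hne hp
      simp at hp
      omega
    rw [List.take_append_of_le_length hp'] at hu
    have h1 : j ∈ v := List.mem_of_mem_take (by rw [hu]; simp)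
    exact (List.nodup_append.1 h).2.2 j h1 j (by simp) rfl
  · simp

/-- The endomorphism that sends the variable `X_a` to zero. -/
noncomputable def kill (a : ι) : Magnus ι →* Magnus ι where
  toFun f := ⟨fun w => open Classical in if a ∈ w.1 then 0 else f.coeff w⟩
  map_one' := by
    ext w
    by_cases h : a ∈ w.1
    · have : w.1 ≠ [] := by rintro h'; simp [h'] at h
      simp [one_coeff, this]
    · simp [h]
  map_mul' f g := by
    classical
    ext w
    simp only [mul_coeff]
    have hw : ∀ k, a ∈ w.1 ↔ (a ∈ (left w k).1 ∨ a ∈ (right w k).1) := by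
      intro k
      rw [← List.mem_append]
      simp [left, right]
    by_cases h : a ∈ w.1
    · rw [if_pos h]
      symm
      refine Finset.sum_eq_zero fun p _ => ?_
      rcases (hw p.1).1 h with h | h <;> simp [h]
    · rw [if_neg h]
      refine Finset.sum_congr rfl fun p _ => ?_
      have h2 := h
      rw [hw p.1, not_or] at h2
      simp [h2]

theorem kill_coeff (a : ι) (f : Magnus ι) (w : {w : List ι // w.Nodup}) (h : a ∉ w.1) :
    (kill a f).coeff w = f.coeff w := by
  simp [kill, h]

theorem kill_X (a j : ι) : kill a (1 + X j) = open Classical in if j = a then 1 else 1 + X j := by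
  classical
  ext w
  by_cases h : a ∈ w.1
  · have h1 : w.1 ≠ [] := by rintro h'; simp [h'] at h
    by_cases hj : j = a
    · simp [kill, h, hj, one_coeff, h1]
    · have h2 : w.1 ≠ [j] := by rintro h'; simp [h'] at h; exact hj h.symm
      simp [kill, h, hj, one_coeff, h1, add_coeff, X_coeff, h2]
  · rw [kill_coeff _ _ _ h]
    by_cases hj : j = a
    · have h2 : w.1 ≠ [j] := by rintro h'; simp [h'] at h; exact h hj.symm
      simp [hj, add_coeff, X_coeff] at h2 ⊢
      exact h2
    · simp [hj]

section Substitution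

variable {R : Type*} [Ring R] (y : ι → R) [Fintype {w : List ι // w.Nodup}]

/-- Substitution of elements of a ring for the variables. -/
def subst (f : Magnus ι) : R := ∑ w, f.coeff w • (w.1.map y).prod

theorem subst_add (f g : Magnus ι) : subst y (f + g) = subst y f + subst y g := by
  simp [subst, add_coeff, add_smul, Finset.sum_add_distrib]

theorem subst_one : subst y 1 = 1 := by
  rw [subst, Finset.sum_eq_single ⟨[], List.nodup_nil⟩]
  · simp [one_coeff]
  · rintro ⟨w, hw⟩ _ hne
    have : w ≠ [] := fun h => hne (by subst h; rfl)
    simp [one_coeff, this]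
  · simp

/-- Words that contain `j` are annihilated by `y j` because of `hy`. Appending `j` matches the other
ones with the words ending in `j`, the only words where `f * X j` has a nonzero coefficient. -/
theorem subst_mul_X (hy : ∀ v : List ι, ∀ j ∈ v, (v.map y).prod * y j = 0) (f : Magnus ι)
    (j : ι) : subst y (f * X j) = subst y f * y j := by
  classical
  rw [subst, subst, Finset.sum_mul]
  have h1 : ∑ w : {w : List ι // w.Nodup}, (f.coeff w • (w.1.map y).prod) * y j
      = ∑ w ∈ Finset.univ.filter (fun w : {w : List ι // w.Nodup} => j ∉ w.1),
        (f.coeff w • (w.1.map y).prod) * y j := by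
    symm
    refine Finset.sum_subset (Finset.subset_univ _) ?_
    intro w _ hw
    simp only [Finset.mem_filter, Finset.mem_univ, true_and, not_not] at hw
    rw [smul_mul_assoc, hy _ _ hw, smul_zero]
  rw [h1]
  symm
  have hnd : ∀ w : {w : List ι // w.Nodup}, j ∉ w.1 → (w.1 ++ [j]).Nodup := by
    intro w hw
    rw [List.nodup_append]
    exact ⟨w.2, by simp, by rintro a ha b hb rfl; simp at hb; exact hw (hb ▸ ha)⟩
  -- The second branch is a dummy value: words that contain `j` are outside the range of summation.
  refine Finset.sum_of_injOn (fun w => if h : j ∉ w.1 then ⟨w.1 ++ [j], hnd w h⟩ else w)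
    ?_ ?_ ?_ ?_
  · intro w hw w' hw' h
    simp only [Finset.coe_filter, Finset.mem_univ, true_and, Set.mem_ofPred_eq] at hw hw'
    simp only [hw, hw', not_false_eq_true, dif_pos, Subtype.mk.injEq] at h
    exact Subtype.ext (List.append_cancel_right h)
  · intro _ _; simp
  · intro w _ hw
    rw [mul_X_coeff_eq_zero, zero_smul]
    intro v hv
    apply hw
    have hn := w.2
    rw [hv] at hn
    have hj : j ∉ v := fun h => (List.nodup_append.1 hn).2.2 j h j (by simp) rfl
    refine ⟨⟨v, nodup_of_append hn⟩, by simpa using hj, ?_⟩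
    simp only [hj, not_false_eq_true, dif_pos]
    exact Subtype.ext hv.symm
  · intro w hw
    simp only [Finset.mem_filter, Finset.mem_univ, true_and] at hw
    simp only [hw, not_false_eq_true, dif_pos]
    rw [mul_X_coeff_append]
    simp [mul_assoc]

end Substitution
end Magnus

/-! ### Recovering an element of the reduced free group from its Magnus coefficients -/

section Injectivity

open Subgroup Magnus

variable {ι : Type*}

theorem magnusExpansion_gen (j : ι) :
    (magnusExpansion (ReducedFree.gen j) : Magnus ι) = 1 + X j := by
  simp [magnusExpansion, ReducedFree.gen, Magnus.unit]

/-- The constant term is multiplicative and equals `1` on generators. -/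
theorem magnusExpansion_nil (x : ReducedFree ι) :
    (magnusExpansion x : Magnus ι).coeff ⟨[], List.nodup_nil⟩ = 1 := by
  let aug : Magnus ι →* ℤ :=
    { toFun := fun f => f.coeff ⟨[], List.nodup_nil⟩
      map_one' := by simp [one_coeff]
      map_mul' := fun f g => nil_coeff_mul f g _ }
  have h : (Units.map aug).comp magnusExpansion = 1 := by
    refine ReducedFree.hom_ext fun j => ?_
    ext1
    simp [magnusExpansion_gen, aug, add_coeff, one_coeff, X_coeff]
  have h2 := congrArg Units.val (DFunLike.congr_fun h x)
  simpa [aug] using h2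

/-- Substituting `ρ x_j - 1` for `X_j` turns `1 + X_j` into `ρ x_j`. Substitution is only controlled
under right multiplication by variables, so the induction carries a left factor `f`; for an inverse
it is applied to `f` times the inverse expansion. -/
theorem subst_magnusExpansion [Fintype {w : List ι // w.Nodup}] {R : Type*} [Ring R]
    (ρ : ReducedFree ι →* R)
    (hy : ∀ v : List ι, ∀ j ∈ v,
      (v.map fun j => ρ (ReducedFree.gen j) - 1).prod * (ρ (ReducedFree.gen j) - 1) = 0)
    (x : ReducedFree ι) (f : Magnus ι) :
    subst (fun j => ρ (ReducedFree.gen j) - 1) (f * magnusExpansion x) =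
      subst (fun j => ρ (ReducedFree.gen j) - 1) f * ρ x := by
  have hx : x ∈ closure (Set.range (ReducedFree.gen (ι := ι))) := by
    rw [ReducedFree.closure_gen]; trivial
  induction hx using closure_induction generalizing f with
  | mem x h =>
    obtain ⟨j, rfl⟩ := h
    rw [magnusExpansion_gen, mul_add, mul_one, subst_add, subst_mul_X _ hy]
    noncomm_ring
  | one => simp
  | mul x y _ _ hx hy => rw [map_mul, Units.val_mul, ← mul_assoc, hy, hx, map_mul, mul_assoc]
  | inv x _ hx =>
    have h := hx (f * ↑(magnusExpansion x)⁻¹)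
    rw [mul_assoc, Units.inv_mul, mul_one] at h
    rw [h, mul_assoc, ← map_mul ρ, mul_inv_cancel, map_one, mul_one, map_inv]

theorem kill_family_reduced (a : ι) [DecidableEq ι] :
    IsReducedFamily (fun j => if j = a then (1 : ReducedFree ι) else ReducedFree.gen j) := by
  intro j g
  by_cases h : j = a
  · simp [h]
  · simpa [h] using ReducedFree.isReducedFamily j g

open Classical in
/-- The endomorphism of the reduced free group that sends one generator to `1`. -/
noncomputable def ReducedFree.kill (a : ι) : ReducedFree ι →* ReducedFree ι :=
  ReducedFree.lift (kill_family_reduced a)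

open Classical in
theorem ReducedFree.kill_gen (a j : ι) :
    ReducedFree.kill a (ReducedFree.gen j) = if j = a then 1 else ReducedFree.gen j :=
  ReducedFree.lift_gen _ _

theorem magnusExpansion_kill (a : ι) (x : ReducedFree ι) :
    (magnusExpansion (ReducedFree.kill a x) : Magnus ι) = Magnus.kill a (magnusExpansion x) := by
  have h : (magnusExpansion (ι := ι)).comp (ReducedFree.kill a) =
      (Units.map (Magnus.kill a)).comp magnusExpansion := by
    refine ReducedFree.hom_ext fun j => ?_
    ext1
    simp only [MonoidHom.comp_apply, Units.coe_map, magnusExpansion_gen, ReducedFree.kill_gen,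
      Magnus.kill_X]
    split_ifs
    · simp
    · exact magnusExpansion_gen j
  exact congrArg Units.val (DFunLike.congr_fun h x)

/-- Killing `x_a` induces the identity modulo `x_a`, as is seen on generators. -/
theorem ReducedFree.mul_kill_inv_mem (a : ι) (x : ReducedFree ι) :
    (ReducedFree.kill a x)⁻¹ * x ∈ normalClosure {ReducedFree.gen a} := by
  have h : (QuotientGroup.mk' (normalClosure {ReducedFree.gen a})).comp (ReducedFree.kill a) =
      QuotientGroup.mk' (normalClosure {ReducedFree.gen a}) := by
    refine ReducedFree.hom_ext fun j => ?_
    rw [MonoidHom.comp_apply, ReducedFree.kill_gen]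
    split_ifs with hj
    · rw [map_one, hj]
      exact ((QuotientGroup.eq_one_iff _).2 (subset_normalClosure (Set.mem_singleton _))).symm
    · rfl
  exact QuotientGroup.eq.1 (DFunLike.congr_fun h x)

theorem ReducedFree.normalClosure_le_ker_kill (a : ι) :
    normalClosure {ReducedFree.gen a} ≤ (ReducedFree.kill a).ker := by
  refine normalClosure_le_normal ?_
  rintro _ rfl
  simp [MonoidHom.mem_ker, ReducedFree.kill_gen]

/-- The normal closure `K` of `x_a` is abelian, hence a module under conjugation, and the operators
`x_j - 1` on it satisfy the relations of the reduced Magnus ring. Evaluating the coefficients at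
words ending in `a` with these operators rebuilds an element of `K` from its expansion. -/
theorem eq_one_of_mem_normalClosure [Finite ι] (a : ι) (x : ReducedFree ι)
    (hx : x ∈ normalClosure {ReducedFree.gen a}) (h1 : magnusExpansion x = 1) : x = 1 := by
  classical
  have := Fintype.ofFinite ι
  let K : Subgroup (ReducedFree ι) := normalClosure {ReducedFree.gen a}
  have hcomm : ∀ x ∈ K, ∀ y ∈ K, x * y = y * x := fun x hx y hy =>
    (ReducedFree.isReducedFamily.commute_of_mem a hx hy).eq
  let _ : CommGroup K :=
    { (inferInstance : Group K) with
      mul_comm := fun x y => Subtype.ext (hcomm _ x.2 _ y.2) }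
  let ρ : ReducedFree ι →* AddMonoid.End (Additive K) :=
    { toFun := fun g => MonoidHom.toAdditive (MulAut.conjNormal (H := K) g).toMonoidHom
      map_one' := by rw [map_one]; rfl
      map_mul' := fun g h => by rw [map_mul]; rfl }
  have hρ : ∀ g (k : Additive K), (((ρ g k).toMul : K) : ReducedFree ι) = g * k.toMul * g⁻¹ := by
    intro g k
    exact MulAut.conjNormal_apply g k.toMul
  let y : ι → AddMonoid.End (Additive K) := fun j => ρ (ReducedFree.gen j) - 1
  have hyk : ∀ j (k : Additive K), (((y j k).toMul : K) : ReducedFree ι) =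
      ReducedFree.gen j * k.toMul * (ReducedFree.gen j)⁻¹ * (k.toMul : ReducedFree ι)⁻¹ := by
    intro j k
    rw [← hρ, show y j k = ρ (ReducedFree.gen j) k - k from rfl, toMul_sub]
    exact (congrArg Subtype.val (div_eq_mul_inv (G := K) _ _) :)
  -- The operator `y j` kills what lies in the normal closure of `x_j`, as this group is abelian; it
  -- takes its values there, being a commutator with `x_j`; and every `y i` preserves it.
  have hy1 : ∀ j (k : Additive K),
      ((k.toMul : K) : ReducedFree ι) ∈ normalClosure {ReducedFree.gen j} → y j k = 0 := by
    intro j k hk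
    refine Additive.toMul.injective (Subtype.ext ?_)
    rw [hyk]
    have : ReducedFree.gen j ∈ normalClosure {ReducedFree.gen (ι := ι) j} :=
      subset_normalClosure (Set.mem_singleton _)
    rw [(ReducedFree.isReducedFamily.commute_of_mem j this hk).eq]
    simp
  have hy2 : ∀ j (k : Additive K),
      (((y j k).toMul : K) : ReducedFree ι) ∈ normalClosure {ReducedFree.gen j} := by
    intro j k
    have h : ReducedFree.gen j ∈ normalClosure {ReducedFree.gen (ι := ι) j} :=
      subset_normalClosure (Set.mem_singleton _)
    rw [hyk, mul_assoc, mul_assoc, ← mul_assoc (k.toMul : ReducedFree ι)]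
    exact mul_mem h (Subgroup.Normal.conj_mem inferInstance _ (inv_mem h) _)
  have hy3 : ∀ j i (k : Additive K),
      ((k.toMul : K) : ReducedFree ι) ∈ normalClosure {ReducedFree.gen j} →
      (((y i k).toMul : K) : ReducedFree ι) ∈ normalClosure {ReducedFree.gen j} := by
    intro j i k hk
    rw [hyk]
    exact mul_mem (Subgroup.Normal.conj_mem inferInstance _ hk _) (inv_mem hk)
  -- The last letter of `v` acts first. The element stays in the normal closure of `x_j` until the
  -- letter `j` kills it.
  have hy : ∀ v : List ι, ∀ j ∈ v, ∀ k : Additive K,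
      ((k.toMul : K) : ReducedFree ι) ∈ normalClosure {ReducedFree.gen j} →
      (v.map y).prod k = 0 := by
    intro v j hj k hk
    induction v using List.reverseRecOn generalizing k with
    | nil => simp at hj
    | append_singleton v i ih =>
      simp only [List.map_append, List.map_cons, List.map_nil, List.prod_append,
        List.prod_singleton]
      change (v.map y).prod (y i k) = 0
      by_cases hij : i = j
      · subst hij
        rw [hy1 i k hk, map_zero]
      · refine ih ?_ _ (hy3 _ _ _ hk)
        simp at hj
        rcases hj with h | h
        · exact h
        · exact absurd h.symm hij
  have hy' : ∀ v : List ι, ∀ j ∈ v, (v.map y).prod * y j = 0 := by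
    intro v j hj
    ext1 k
    exact hy v j hj _ (hy2 j k)
  have ha : ReducedFree.gen a ∈ K := subset_normalClosure (Set.mem_singleton _)
  let xa : Additive K := Additive.ofMul ⟨ReducedFree.gen a, ha⟩
  let W := {w : {w : List ι // w.Nodup} // (w.1 ++ [a]).Nodup}
  -- The expansion of `g x_a g⁻¹` is `1 + E(g) X_a E(g)⁻¹`, whose coefficient at `w a` is that of
  -- `E(g)` at `w`. So `Θ` evaluates `E(g)` in the operators `y` and applies the result to `x_a`.
  let Θ : Magnus ι → Additive K := fun f =>
    ∑ w : W, f.coeff ⟨w.1.1 ++ [a], w.2⟩ • (w.1.1.map y).prod xa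
  -- Every nonconstant term of such a series contains `X_a`. A proper prefix of `w a` does not
  -- contain `a`, so in the product only the two trivial splittings of this word survive.
  have hΘadd : ∀ f g : Magnus ι, Magnus.kill a f = 1 → Magnus.kill a g = 1 →
      Θ (f * g) = Θ f + Θ g := by
    intro f g hf hg
    simp only [Θ, ← Finset.sum_add_distrib]
    refine Finset.sum_congr rfl fun w _ => ?_
    rw [← add_smul]
    congr 1
    have hc : ∀ f : Magnus ι, Magnus.kill a f = 1 → ∀ v : {w : List ι // w.Nodup}, a ∉ v.1 →
        f.coeff v = if v.1 = [] then 1 else 0 := by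
      intro f hf v hv
      rw [← kill_coeff a f v hv, hf, one_coeff]
    have haw : a ∉ w.1.1 := fun h => (List.nodup_append.1 w.2).2.2 a h a (by simp) rfl
    have hleft : ∀ p : ℕ × ℕ, p ∈ Finset.HasAntidiagonal.antidiagonal (w.1.1 ++ [a]).length →
        p.2 ≠ 0 → f.coeff (left ⟨w.1.1 ++ [a], w.2⟩ p.1) = if p.1 = 0 then 1 else 0 := by
      rintro ⟨p, q⟩ hp hq
      simp at hp hq
      rw [hc f hf]
      · simp [left]
      · simp only [left]
        rw [List.take_append_of_le_length (by omega)]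
        exact fun h => haw (List.mem_of_mem_take h)
    rw [mul_coeff, Finset.sum_eq_add ((w.1.1 ++ [a]).length, 0) (0, (w.1.1 ++ [a]).length)]
    · have e1 : left ⟨w.1.1 ++ [a], w.2⟩ (w.1.1 ++ [a]).length = ⟨w.1.1 ++ [a], w.2⟩ :=
        Subtype.ext List.take_length
      have e2 : right ⟨w.1.1 ++ [a], w.2⟩ (w.1.1 ++ [a]).length = ⟨[], List.nodup_nil⟩ :=
        Subtype.ext List.drop_length
      have e3 : left ⟨w.1.1 ++ [a], w.2⟩ 0 = ⟨[], List.nodup_nil⟩ := rfl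
      have e4 : right ⟨w.1.1 ++ [a], w.2⟩ 0 = ⟨w.1.1 ++ [a], w.2⟩ := rfl
      simp only [e1, e2, e3, e4]
      rw [hc f hf ⟨[], List.nodup_nil⟩ (by simp), hc g hg ⟨[], List.nodup_nil⟩ (by simp)]
      simp
    · simp
    · rintro ⟨p, q⟩ hp ⟨h1, h2⟩
      rw [hleft _ hp, if_neg, zero_mul]
      · rintro rfl
        simp at hp
        exact h2 (by simp [hp])
      · rintro rfl
        simp at hp
        exact h1 (by simp [hp])
    · simp
    · simp
  have hkill : ∀ x ∈ K, Magnus.kill a (magnusExpansion x) = 1 := by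
    intro x hx
    rw [← magnusExpansion_kill, (ReducedFree.normalClosure_le_ker_kill a hx : _ = _), map_one,
      Units.val_one]
  have hΘ1 : Θ 1 = 0 := by
    refine Finset.sum_eq_zero fun w _ => ?_
    simp [one_coeff]
  have hΘ : ∀ x (hx : x ∈ K), Θ (magnusExpansion x) = Additive.ofMul (⟨x, hx⟩ : K) := by
    intro x hx
    induction hx using closure_induction with
    | mem x h =>
      rw [Group.mem_conjugatesOfSet_iff] at h
      obtain ⟨_, rfl, h⟩ := h
      obtain ⟨g, rfl⟩ := isConj_iff.1 h
      have e : (magnusExpansion (g * ReducedFree.gen a * g⁻¹) : Magnus ι) =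
          1 + magnusExpansion g * X a * magnusExpansion g⁻¹ := by
        rw [map_mul, map_mul, Units.val_mul, Units.val_mul, magnusExpansion_gen, mul_add, mul_one,
          add_mul, ← Units.val_mul, ← map_mul, mul_inv_cancel, map_one, Units.val_one]
      have h2 : ∀ w : W, (magnusExpansion (g * ReducedFree.gen a * g⁻¹) : Magnus ι).coeff
          ⟨w.1.1 ++ [a], w.2⟩ = (magnusExpansion g : Magnus ι).coeff w.1 := by
        intro w
        rw [e, add_coeff, mul_X_mul_coeff_append _ _ _ _ _ (magnusExpansion_nil _)]
        simp [one_coeff]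
      have h3 := congrArg (fun r : AddMonoid.End (Additive K) => r xa)
        (subst_magnusExpansion ρ hy' g 1)
      simp only [one_mul, subst_one] at h3
      have h4 : Θ (magnusExpansion (g * ReducedFree.gen a * g⁻¹)) = ρ g xa := by
        rw [← h3]
        simp only [Θ, h2, subst]
        symm
        refine (map_sum (AddMonoidHom.eval xa : (Additive K →+ Additive K) →+ _) _ _).trans ?_
        -- Words that contain `a` are absent from `Θ`; their operators kill `x_a`.
        rw [← Finset.sum_subset (Finset.subset_univ
          (Finset.univ.filter fun w : {w : List ι // w.Nodup} => (w.1 ++ [a]).Nodup)),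
          Finset.sum_subtype (p := fun w : {w : List ι // w.Nodup} => (w.1 ++ [a]).Nodup)]
        · rfl
        · simp
        · intro w _ hw
          have hw' : a ∈ w.1 := by
            by_contra h'
            apply hw
            simp only [Finset.mem_filter, Finset.mem_univ, true_and]
            rw [List.nodup_append]
            exact ⟨w.2, by simp, by rintro b hb c hc rfl; simp at hc; exact h' (hc ▸ hb)⟩
          have := hy w.1 a hw' xa ha
          change (magnusExpansion g : Magnus ι).coeff w • (w.1.map y).prod xa = 0
          rw [this, smul_zero]
      rw [h4]
      exact Additive.toMul.injective (Subtype.ext (hρ g xa))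
    | one => simp only [map_one, Units.val_one, hΘ1]; rfl
    | mul x y hx hy ihx ihy =>
      rw [map_mul, Units.val_mul, hΘadd _ _ (hkill x hx) (hkill y hy), ihx, ihy]
      rfl
    | inv x hx ih =>
      have h := hΘadd _ _ (hkill x hx) (hkill x⁻¹ (inv_mem hx))
      rw [← Units.val_mul, ← map_mul, mul_inv_cancel, map_one, Units.val_one, hΘ1, ih] at h
      rw [eq_neg_of_add_eq_zero_right h.symm]
      rfl
  have h := hΘ x hx
  rw [h1, Units.val_one, hΘ1] at h
  exact congrArg Subtype.val (Additive.ofMul.injective h.symm)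

/-- Induction on the generators involved. Killing `x_a` keeps the expansion trivial and removes one
generator, so it sends the element to `1`; hence the element lies in the normal closure of `x_a`,
where the previous theorem applies. -/
theorem magnusExpansion_injective [Finite ι] :
    Function.Injective (magnusExpansion (ι := ι)) := by
  classical
  have := Fintype.ofFinite ι
  rw [injective_iff_map_eq_one]
  suffices h : ∀ s : Finset ι, ∀ x ∈ closure (ReducedFree.gen '' (s : Set ι)),
      magnusExpansion x = 1 → x = 1 by
    intro x
    refine h Finset.univ x ?_
    rw [Finset.coe_univ, Set.image_univ, ReducedFree.closure_gen]
    trivial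
  intro s
  induction s using Finset.induction_on with
  | empty => intro x hx _; simpa using hx
  | insert a s _ ih =>
    intro x hx h1
    have hk : ReducedFree.kill a x = 1 := by
      refine ih _ ?_ ?_
      · have h2 := mem_map_of_mem (ReducedFree.kill a) hx
        rw [MonoidHom.map_closure] at h2
        refine (closure_le _).2 ?_ h2
        rintro _ ⟨_, ⟨j, hj, rfl⟩, rfl⟩
        rw [ReducedFree.kill_gen]
        split_ifs with hja
        · exact one_mem _
        · refine subset_closure ⟨j, ?_, rfl⟩
          simpa [hja] using hj
      · ext1
        rw [magnusExpansion_kill, h1]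
        simp
    have h3 := ReducedFree.mul_kill_inv_mem a x
    rw [hk, inv_one, one_mul] at h3
    exact eq_one_of_mem_normalClosure a x h3 h1

end Injectivity
end KirkCut

namespace KirkCut

/-! ## Positive elements -/

section Positivity

variable {ι : Type*}

/-- In the coefficient at `w` of the product of both expansions, the splittings with a proper
nonempty prefix vanish by hypothesis, so the two trivial ones cancel. -/
theorem magnusExpansion_inv_coeff (x : ReducedFree ι) (w : {w : List ι // w.Nodup})
    (hw : w.1 ≠ []) (h : ∀ v : {w : List ι // w.Nodup}, v.1 ≠ [] → v.1.length < w.1.length →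
      (magnusExpansion x : Magnus ι).coeff v = 0) :
    (magnusExpansion x⁻¹ : Magnus ι).coeff w = - (magnusExpansion x : Magnus ι).coeff w := by
  have h1 : ((magnusExpansion x : Magnus ι) * magnusExpansion x⁻¹).coeff w = 0 := by
    rw [← Units.val_mul, ← map_mul, mul_inv_cancel, map_one, Units.val_one, Magnus.one_coeff,
      if_neg hw]
  have hl : 0 < w.1.length := List.length_pos_iff.2 hw
  rw [Magnus.mul_coeff, Finset.sum_eq_add (w.1.length, 0) (0, w.1.length)] at h1
  · have e1 : Magnus.left w w.1.length = w := Subtype.ext List.take_length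
    have e2 : Magnus.right w w.1.length = ⟨[], List.nodup_nil⟩ := Subtype.ext List.drop_length
    have e3 : Magnus.left w 0 = ⟨[], List.nodup_nil⟩ := rfl
    have e4 : Magnus.right w 0 = w := rfl
    simp only [e1, e2, e3, e4, magnusExpansion_nil] at h1
    linarith
  · simp; omega
  · rintro ⟨p, q⟩ hp ⟨hp1, hp2⟩
    simp at hp
    have hp0 : p ≠ 0 := by rintro rfl; exact hp2 (by simp [← hp])
    have hq0 : q ≠ 0 := by rintro rfl; exact hp1 (by simp [← hp])
    rw [h, zero_mul]
    · simp only [Magnus.left, ne_eq, List.take_eq_nil_iff]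
      tauto
    · simp [Magnus.left]
      omega
  · simp
  · simp

variable [LinearOrder ι]

theorem monomialLT_iff (v w : List ι) :
    monomialLT v w ↔ toLex (v.length, v) < toLex (w.length, w) := by
  rw [Prod.Lex.toLex_lt_toLex]
  rfl

theorem monomialLT_trichotomy (v w : List ι) : monomialLT v w ∨ v = w ∨ monomialLT w v := by
  simp only [monomialLT_iff]
  rcases lt_trichotomy (toLex (v.length, v)) (toLex (w.length, w)) with h | h | h
  · exact Or.inl h
  · exact Or.inr (Or.inl (congrArg Prod.snd (toLex.injective h)))
  · exact Or.inr (Or.inr h)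

/-- Injectivity of the expansion gives a nonzero coefficient of positive degree, and there are only
finitely many words without repetition. -/
theorem exists_leading_word [Finite ι] (x : ReducedFree ι) (hx : x ≠ 1) :
    ∃ w : {w : List ι // w.Nodup}, w.1 ≠ [] ∧ (magnusExpansion x : Magnus ι).coeff w ≠ 0 ∧
      ∀ v : {w : List ι // w.Nodup}, v.1 ≠ [] → monomialLT v.1 w.1 →
        (magnusExpansion x : Magnus ι).coeff v = 0 := by
  classical
  have := Fintype.ofFinite ι
  let s := Finset.univ.filter fun w : {w : List ι // w.Nodup} =>
    w.1 ≠ [] ∧ (magnusExpansion x : Magnus ι).coeff w ≠ 0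
  have hs : s.Nonempty := by
    by_contra h
    apply hx
    apply magnusExpansion_injective
    rw [map_one]
    ext1
    ext w
    rw [Units.val_one, Magnus.one_coeff]
    split_ifs with hw
    · obtain ⟨w, hn⟩ := w
      subst hw
      exact magnusExpansion_nil x
    · by_contra hc
      exact h ⟨w, by simp [s, hw, hc]⟩
  obtain ⟨w, hw, hmin⟩ := s.exists_min_image (fun w => toLex (w.1.length, w.1)) hs
  simp only [s, Finset.mem_filter, Finset.mem_univ, true_and] at hw hmin
  refine ⟨w, hw.1, hw.2, fun v hv hlt => ?_⟩
  by_contra hc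
  exact absurd (hmin v ⟨hv, hc⟩) (not_le.2 ((monomialLT_iff _ _).1 hlt))

/-- Words that precede `w` are not longer than `w`, so the formula for inverses applies to all of
them: the leading word is the same, with the opposite sign. -/
theorem magnusExpansion_inv_coeff_of_leading (x : ReducedFree ι) (w : {w : List ι // w.Nodup})
    (hw : w.1 ≠ []) (h : ∀ v : {w : List ι // w.Nodup}, v.1 ≠ [] → monomialLT v.1 w.1 →
      (magnusExpansion x : Magnus ι).coeff v = 0) :
    (magnusExpansion x⁻¹ : Magnus ι).coeff w = - (magnusExpansion x : Magnus ι).coeff w ∧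
    ∀ v : {w : List ι // w.Nodup}, v.1 ≠ [] → monomialLT v.1 w.1 →
      (magnusExpansion x⁻¹ : Magnus ι).coeff v = 0 := by
  refine ⟨magnusExpansion_inv_coeff x w hw fun v hv hl => h v hv (Or.inl hl), fun v hv hl => ?_⟩
  rw [magnusExpansion_inv_coeff x v hv, h v hv hl, neg_zero]
  intro u hu hul
  refine h u hu (Or.inl (hul.trans_le ?_))
  rcases hl with hl | hl
  · exact hl.le
  · exact hl.1.le

theorem IsPositive.or_inv [Finite ι] (x : ReducedFree ι) : IsPositive x ∨ IsPositive x⁻¹ := by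
  by_cases hx : x = 1
  · exact Or.inl (Or.inl hx)
  obtain ⟨w, hw, h0, hmin⟩ := exists_leading_word x hx
  have h := magnusExpansion_inv_coeff_of_leading x w hw hmin
  rcases lt_or_gt_of_ne h0 with h1 | h1
  · exact Or.inr (Or.inr ⟨w, hw, by rw [h.1]; omega, h.2⟩)
  · exact Or.inl (Or.inr ⟨w, hw, h1, hmin⟩)

theorem IsPositive.not_inv {x : ReducedFree ι} (h : IsPositive x) (hx : x ≠ 1) :
    ¬ IsPositive x⁻¹ := by
  rcases h with h | ⟨w, hw, hpos, hmin⟩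
  · exact absurd h hx
  rintro (h' | ⟨w', hw', hpos', hmin'⟩)
  · exact hx (inv_eq_one.1 h')
  have h := magnusExpansion_inv_coeff_of_leading x w hw hmin
  rcases monomialLT_trichotomy w'.1 w.1 with hlt | heq | hlt
  · rw [h.2 _ hw' hlt] at hpos'
    exact lt_irrefl _ hpos'
  · obtain rfl : w' = w := Subtype.ext heq
    omega
  · have := hmin' _ hw hlt
    omega

open Classical in
/-- The positive one among an element of the reduced free group and its inverse. -/
noncomputable def posPart (x : ReducedFree ι) : ReducedFree ι := if IsPositive x then x else x⁻¹

/-- Exactly one of `x` and `x⁻¹` is positive unless `x = 1`. This is what makes the order of the two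
dots of a pair irrelevant. -/
theorem posPart_inv [Finite ι] (x : ReducedFree ι) : posPart x⁻¹ = posPart x := by
  by_cases hx : x = 1
  · simp [hx]
  unfold posPart
  by_cases h : IsPositive x
  · rw [if_pos h, if_neg (h.not_inv hx), inv_inv]
  · rw [if_neg h, if_pos ((IsPositive.or_inv x).resolve_left h)]

theorem posPart_one : posPart (1 : ReducedFree ι) = 1 := by
  simp [posPart]

end Positivity
end KirkCut

namespace KirkCut

/-! ## Combinatorial spheres are simply connected -/

namespace SphereCells

variable {n : ℕ} (S : SphereCells n)

theorem rot_apply (d : S.Dart) : S.rot d = S.inv (S.next.symm d) := rfl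

theorem inv_rot (d : S.Dart) : S.inv (S.rot d) = S.next.symm d := S.inv_inv _

theorem comp_next_symm (d : S.Dart) : S.comp (S.next.symm d) = S.comp d := by
  rw [← S.comp_next, Equiv.apply_symm_apply]

theorem comp_rot (d : S.Dart) : S.comp (S.rot d) = S.comp d := by
  rw [rot_apply, S.comp_inv, comp_next_symm]

theorem comp_eq_of_sameCycle {f : Equiv.Perm S.Dart} (hf : ∀ d, S.comp (f d) = S.comp d)
    {d e : S.Dart} (h : f.SameCycle d e) : S.comp d = S.comp e := by
  have hn : ∀ (k : ℕ) d, S.comp ((f ^ k) d) = S.comp d := by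
    intro k
    induction k with
    | zero => simp
    | succ k ih => intro d; rw [pow_succ, Equiv.Perm.mul_apply, ih, hf]
  obtain ⟨k, rfl⟩ := h
  obtain ⟨k, rfl | rfl⟩ := k.eq_nat_or_neg
  · simp [hn]
  · have := hn k ((f ^ (-(k : ℤ))) d)
    rw [← this]
    simp

/-- Induction along the cells of one component. -/
theorem comp_induction {P : S.Dart → Prop} {d e : S.Dart} (h : S.comp d = S.comp e) (hd : P d)
    (hinv : ∀ x, P x ↔ P (S.inv x)) (hnext : ∀ x, P x ↔ P (S.next x)) : P e := by
  have key : ∀ x y, Relation.EqvGen (fun x y => y = S.inv x ∨ y = S.next x) x y → (P x ↔ P y) := by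
    intro x y h
    induction h with
    | rel x y h =>
      rcases h with rfl | rfl
      · exact hinv x
      · exact hnext x
    | refl => rfl
    | symm _ _ _ ih => exact ih.symm
    | trans _ _ _ _ _ ih1 ih2 => exact ih1.trans ih2
  exact (key d e (S.connected d e h)).1 hd

/-- The cells that correspond to a permutation of the darts. -/
abbrev Orbits (f : Equiv.Perm S.Dart) : Type := Quotient (Equiv.Perm.SameCycle.setoid f)

/-- The orbit of a dart. -/
def orbit (f : Equiv.Perm S.Dart) (d : S.Dart) : S.Orbits f := Quotient.mk _ d

theorem orbit_eq {f : Equiv.Perm S.Dart} {d e : S.Dart} :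
    S.orbit f d = S.orbit f e ↔ f.SameCycle d e := Quotient.eq

theorem orbit_apply (f : Equiv.Perm S.Dart) (d : S.Dart) : S.orbit f (f d) = S.orbit f d :=
  S.orbit_eq.2 (Equiv.Perm.sameCycle_apply_left.2 (Equiv.Perm.SameCycle.refl f d))

instance (f : Equiv.Perm S.Dart) : Finite (S.Orbits f) :=
  have := S.finite
  inferInstanceAs (Finite (Quotient _))

theorem sum_ncard_orbits {f : Equiv.Perm S.Dart} (hf : ∀ d, S.comp (f d) = S.comp d) :
    ∑ i : Fin n, (Quotient.mk (Equiv.Perm.SameCycle.setoid f) '' {d | S.comp d = i}).ncard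
      = Nat.card (S.Orbits f) := by
  classical
  have := Fintype.ofFinite (S.Orbits f)
  let c : S.Orbits f → Fin n :=
    Quotient.lift S.comp fun a b h => S.comp_eq_of_sameCycle hf h
  have h1 : ∀ i : Fin n, (Quotient.mk (Equiv.Perm.SameCycle.setoid f) '' {d | S.comp d = i})
      = ((Finset.univ.filter fun x : S.Orbits f => c x = i : Finset _) : Set (S.Orbits f)) := by
    intro i
    ext x
    constructor
    · rintro ⟨d, hd, rfl⟩
      simpa [c] using hd
    · intro hx
      induction x using Quotient.inductionOn with
      | h d => exact ⟨d, by simpa [c] using hx, rfl⟩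
  simp only [h1, Set.ncard_coe_finset, Nat.card_eq_fintype_card]
  exact (Finset.card_eq_sum_card_fiberwise (f := c) (t := Finset.univ) (by simp)).symm

/-- Every orbit lies on a single component, so the `n` Euler relations add up. -/
theorem card_orbits : Nat.card (S.Orbits S.rot) + Nat.card (S.Orbits S.next) =
    Nat.card (S.Orbits S.inv) + 2 * n := by
  rw [← S.sum_ncard_orbits S.comp_rot, ← S.sum_ncard_orbits S.comp_next,
    ← S.sum_ncard_orbits S.comp_inv, ← Finset.sum_add_distrib]
  refine (Finset.sum_congr rfl fun i _ => S.euler i).trans ?_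
  rw [Finset.sum_add_distrib]
  simp [mul_comm]

/-- Antisymmetric functions on the darts that are supported by a set. -/
def antisymm (Z : Set S.Dart) : Submodule ℚ (S.Dart → ℚ) where
  carrier := {z | (∀ d, z (S.inv d) = - z d) ∧ ∀ d ∉ Z, z d = 0}
  zero_mem' := by simp
  add_mem' := by
    rintro a b ⟨ha, ha'⟩ ⟨hb, hb'⟩
    refine ⟨fun d => ?_, fun d hd => ?_⟩
    · simp [ha, hb]; ring
    · simp [ha' d hd, hb' d hd]
  smul_mem' := by
    rintro c a ⟨ha, ha'⟩
    refine ⟨fun d => ?_, fun d hd => ?_⟩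
    · simp [ha]
    · simp [ha' d hd]

theorem finrank_antisymm (Z : Set S.Dart) (hZ : ∀ d ∈ Z, S.inv d ∈ Z) :
    2 * Module.finrank ℚ (S.antisymm Z) = Z.ncard := by
  classical
  have := S.finite
  have := Fintype.ofFinite S.Dart
  obtain ⟨k, hk⟩ : ∃ k : S.Dart → ℕ, Function.Injective k :=
    ⟨fun d => Fintype.equivFin S.Dart d,
      Fin.val_injective.comp (Fintype.equivFin S.Dart).injective⟩
  -- One dart is selected on each edge of `Z` by an injective numbering; an antisymmetric function
  -- is determined by its values there.
  let R : Set S.Dart := {d | d ∈ Z ∧ k d < k (S.inv d)}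
  have hR : ∀ d, d ∈ R → S.inv d ∉ R := by
    rintro d ⟨_, h⟩ ⟨_, h'⟩
    rw [S.inv_inv] at h'
    omega
  have hR' : ∀ d, d ∈ Z → d ∉ R → S.inv d ∈ R := by
    intro d hd h
    refine ⟨hZ d hd, ?_⟩
    rw [S.inv_inv]
    have h1 : k (S.inv d) ≠ k d := fun h => S.inv_ne d (hk h)
    have h2 : ¬ k d < k (S.inv d) := fun h' => h ⟨hd, h'⟩
    omega
  have hRZ : ∀ d, S.inv d ∈ R → d ∈ Z := fun d h => by
    rw [← S.inv_inv d]; exact hZ _ h.1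
  let e : S.antisymm Z ≃ₗ[ℚ] (R → ℚ) :=
    { toFun := fun z d => z.1 d
      map_add' := fun _ _ => rfl
      map_smul' := fun _ _ => rfl
      invFun := fun y => ⟨fun d => if h : d ∈ R then y ⟨d, h⟩ else
          if h : S.inv d ∈ R then - y ⟨S.inv d, h⟩ else 0, by
        refine ⟨fun d => ?_, fun d hd => ?_⟩
        · by_cases h : d ∈ R
          · have h1 := hR d h
            simp [h, h1, S.inv_inv]
          · by_cases h' : S.inv d ∈ R
            · simp [h, h']
            · simp [h, h', S.inv_inv]
        · have h1 : d ∉ R := fun h => hd h.1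
          have h2 : S.inv d ∉ R := fun h => hd (hRZ d h)
          simp [h1, h2]⟩
      left_inv := by
        rintro ⟨z, hz, hz'⟩
        ext d
        by_cases h : d ∈ R
        · simp [h]
        · by_cases h' : S.inv d ∈ R
          · simp [h, h', hz]
          · have : d ∉ Z := fun h'' => h' (hR' d h'' h)
            simp [h, h', hz' d this]
      right_inv := by
        intro y
        ext d
        simp }
  rw [e.finrank_eq, Module.finrank_fintype_fun_eq_card, ← Nat.card_eq_fintype_card,
    Nat.card_coe_set_eq]
  have hu : Z = R ∪ S.inv '' R := by
    ext d
    constructor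
    · intro hd
      by_cases h : d ∈ R
      · exact Or.inl h
      · exact Or.inr ⟨_, hR' d hd h, S.inv_inv d⟩
    · rintro (h | ⟨d, h, rfl⟩)
      · exact h.1
      · exact hZ d h.1
  have hd : Disjoint R (S.inv '' R) := by
    rw [Set.disjoint_left]
    rintro _ h ⟨d, h', rfl⟩
    exact hR d h' h
  conv_rhs => rw [hu]
  rw [Set.ncard_union_eq hd (Set.toFinite _) (Set.toFinite _),
    Set.ncard_image_of_injective _ S.inv.injective, two_mul]

theorem card_dart : Nat.card S.Dart = 2 * Nat.card (S.Orbits S.inv) := by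
  classical
  have := S.finite
  have := Fintype.ofFinite S.Dart
  have := Fintype.ofFinite (S.Orbits S.inv)
  simp only [Nat.card_eq_fintype_card]
  rw [← Finset.card_univ, Finset.card_eq_sum_card_fiberwise (f := S.orbit S.inv)
    (t := Finset.univ) (by simp)]
  have : ∀ x : S.Orbits S.inv,
      (Finset.univ.filter fun d => S.orbit S.inv d = x).card = 2 := by
    intro x
    induction x using Quotient.inductionOn with
    | h d =>
      have : (Finset.univ.filter fun e => S.orbit S.inv e = Quotient.mk _ d) = {d, S.inv d} := by
        ext e
        simp only [Finset.mem_filter, Finset.mem_univ, true_and, Finset.mem_insert,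
          Finset.mem_singleton]
        constructor
        · intro h
          have h' : S.inv.SameCycle d e := (S.orbit_eq.1 h).symm
          have hn : ∀ k : ℕ, (S.inv ^ k) d = d ∨ (S.inv ^ k) d = S.inv d := by
            intro k
            induction k with
            | zero => simp
            | succ k ih =>
              rw [pow_succ', Equiv.Perm.mul_apply]
              rcases ih with h | h <;> simp [h, S.inv_inv]
          have hs : S.inv⁻¹ = S.inv := by
            ext x
            rw [Equiv.Perm.inv_eq_iff_eq, S.inv_inv]
          obtain ⟨k, rfl⟩ := h'
          obtain ⟨k, rfl | rfl⟩ := k.eq_nat_or_neg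
          · simpa using hn k
          · rw [zpow_neg, zpow_natCast, ← inv_pow, hs]
            exact hn k
        · rintro (rfl | rfl)
          · rfl
          · exact S.orbit_apply _ _
      rw [this, Finset.card_pair (S.inv_ne d).symm]
  simp [this, mul_comm]

open Classical in
/-- The boundary of a chain, evaluated at a vertex. -/
noncomputable def boundary [Fintype S.Dart] : (S.Dart → ℚ) →ₗ[ℚ] (S.Orbits S.rot → ℚ) where
  toFun z v := ∑ d with S.orbit S.rot d = v, z d
  map_add' z z' := by ext v; simp [Finset.sum_add_distrib]
  map_smul' c z := by ext v; simp [Finset.mul_sum]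

open Classical in
theorem boundary_apply [Fintype S.Dart] (z : S.Dart → ℚ) (v) :
    S.boundary z v = ∑ d with S.orbit S.rot d = v, z d := rfl

/-- The coboundary of a function on the set of faces. -/
def coboundary : (S.Orbits S.next → ℚ) →ₗ[ℚ] (S.Dart → ℚ) where
  toFun p d := p (S.orbit S.next (S.inv d)) - p (S.orbit S.next d)
  map_add' z z' := by ext v; simp; ring
  map_smul' c z := by ext v; simp; ring

theorem coboundary_mem (p) : S.coboundary p ∈ S.antisymm Set.univ := by
  refine ⟨fun d => ?_, fun d hd => absurd trivial hd⟩
  simp [coboundary, S.inv_inv]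

/-- The face to the right of `rot d` is the face to the left of `d`, so the two sums around a vertex
agree after one rotation. -/
theorem boundary_coboundary [Fintype S.Dart] (p) : S.boundary (S.coboundary p) = 0 := by
  classical
  ext v
  rw [boundary_apply]
  simp only [coboundary, LinearMap.coe_mk, AddHom.coe_mk, Finset.sum_sub_distrib, Pi.zero_apply]
  rw [sub_eq_zero]
  symm
  refine Finset.sum_bij (fun d _ => S.rot d) ?_ ?_ ?_ ?_
  · intro d hd
    simpa [S.orbit_apply] using hd
  · intro a _ b _ h
    exact S.rot.injective h
  · intro d hd
    refine ⟨S.rot.symm d, ?_, by simp⟩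
    have h := S.orbit_apply S.rot (S.rot.symm d)
    rw [Equiv.apply_symm_apply] at h
    simpa [← h] using hd
  · intro d _
    rw [inv_rot, ← S.orbit_apply S.next (S.next.symm d), Equiv.apply_symm_apply]

/-- A function on faces with zero coboundary is constant on each connected component. -/
theorem finrank_ker_coboundary_le : Module.finrank ℚ (LinearMap.ker S.coboundary) ≤ n := by
  let b : Fin n → S.Dart := Function.surjInv S.comp_surjective
  let ev : LinearMap.ker S.coboundary →ₗ[ℚ] (Fin n → ℚ) :=
    { toFun := fun p i => p.1 (S.orbit S.next (b i))
      map_add' := fun _ _ => rfl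
      map_smul' := fun _ _ => rfl }
  have hev : Function.Injective ev := by
    rw [← LinearMap.ker_eq_bot, LinearMap.ker_eq_bot']
    rintro ⟨p, hp⟩ h
    ext x
    induction x using Quotient.inductionOn with
    | h d =>
      have hb : S.comp (b (S.comp d)) = S.comp d := Function.surjInv_eq S.comp_surjective _
      refine S.comp_induction (P := fun d => p (S.orbit S.next d) = 0) hb
        (congrFun h (S.comp d)) (fun x => ?_) (fun x => ?_)
      · have : p (S.orbit S.next (S.inv x)) - p (S.orbit S.next x) = 0 := congrFun hp x
        rw [sub_eq_zero.1 this]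
      · rw [S.orbit_apply]
  simpa using LinearMap.finrank_le_finrank_of_injective hev

/-- The two ends of an edge differ by a boundary, so the boundaries together with one base vertex
per component span all functions on vertices. -/
theorem le_finrank_range_boundary [Fintype S.Dart] : Nat.card (S.Orbits S.rot) ≤
    Module.finrank ℚ (LinearMap.range (S.boundary.domRestrict (S.antisymm Set.univ))) + n := by
  classical
  have := Fintype.ofFinite (S.Orbits S.rot)
  let b : Fin n → S.Dart := Function.surjInv S.comp_surjective
  let C : Submodule ℚ (S.Orbits S.rot → ℚ) :=
    Submodule.span ℚ (Set.range fun i => Pi.single (S.orbit S.rot (b i)) 1)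
  set B := LinearMap.range (S.boundary.domRestrict (S.antisymm Set.univ)) with hB
  have hz : ∀ d, Pi.single (S.orbit S.rot d) (1 : ℚ) - Pi.single (S.orbit S.rot (S.inv d)) 1 ∈ B := by
    intro d
    refine ⟨⟨Pi.single d 1 - Pi.single (S.inv d) 1, fun e => ?_, fun e he => absurd trivial he⟩, ?_⟩
    · simp only [Pi.sub_apply, Pi.single_apply, S.inv.injective.eq_iff]
      have : S.inv e = d ↔ e = S.inv d := by
        constructor
        · rintro rfl; rw [S.inv_inv]
        · rintro rfl; rw [S.inv_inv]
      simp [this]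
    · have hs : ∀ d, S.boundary (Pi.single d 1) = Pi.single (S.orbit S.rot d) 1 := by
        intro d
        ext v
        rw [boundary_apply, Finset.sum_filter, Finset.sum_eq_single d]
        · simp [Pi.single_apply, eq_comm]
        · intro e _ he
          simp [he]
        · simp
      simp [LinearMap.domRestrict_apply, hs]
  have hall : ∀ d, Pi.single (S.orbit S.rot d) (1 : ℚ) ∈ B ⊔ C := by
    intro d
    have hb : S.comp (b (S.comp d)) = S.comp d := Function.surjInv_eq S.comp_surjective _
    have hi : ∀ x, Pi.single (S.orbit S.rot x) (1 : ℚ) ∈ B ⊔ C ↔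
        Pi.single (S.orbit S.rot (S.inv x)) (1 : ℚ) ∈ B ⊔ C := by
      intro x
      have h := Submodule.mem_sup_left (T := C) (hz x)
      constructor
      · intro h'
        simpa using sub_mem h' h
      · intro h'
        simpa using add_mem h h'
    refine S.comp_induction (P := fun d => Pi.single (S.orbit S.rot d) (1 : ℚ) ∈ B ⊔ C) hb
      (Submodule.mem_sup_right (Submodule.subset_span ⟨_, rfl⟩)) hi (fun x => ?_)
    have hx : S.rot (S.next x) = S.inv x := by rw [rot_apply, Equiv.symm_apply_apply]
    rw [hi x, ← hx, S.orbit_apply]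
  have htop : B ⊔ C = ⊤ := by
    rw [eq_top_iff]
    intro y _
    have : y = ∑ v, y v • Pi.single v (1 : ℚ) := by
      ext v
      simp [Finset.sum_apply, Pi.single_apply]
    rw [this]
    refine Submodule.sum_mem _ fun v _ => Submodule.smul_mem _ _ ?_
    induction v using Quotient.inductionOn with
    | h d => exact hall d
  have h1 : Module.finrank ℚ (B ⊔ C : Submodule ℚ (S.Orbits S.rot → ℚ)) =
      Nat.card (S.Orbits S.rot) := by
    rw [htop, finrank_top, Module.finrank_fintype_fun_eq_card, Nat.card_eq_fintype_card]
  have h2 := Submodule.finrank_add_le_finrank_add_finrank B C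
  have h3 : Module.finrank ℚ C ≤ n := by
    have h := finrank_range_le_card (R := ℚ)
      (fun i : Fin n => (Pi.single (S.orbit S.rot (b i)) 1 : S.Orbits S.rot → ℚ))
    rwa [Fintype.card_fin] at h
  omega

/-- The first cohomology group of a union of spheres vanishes. -/
theorem exists_coboundary_eq [Fintype S.Dart] (z : S.Dart → ℚ) (hz : z ∈ S.antisymm Set.univ)
    (h : S.boundary z = 0) : ∃ p, S.coboundary p = z := by
  have := Fintype.ofFinite (S.Orbits S.next)
  let K := LinearMap.ker (S.boundary.domRestrict (S.antisymm Set.univ))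
  let δ : (S.Orbits S.next → ℚ) →ₗ[ℚ] S.antisymm Set.univ :=
    S.coboundary.codRestrict _ S.coboundary_mem
  have hle : LinearMap.range δ ≤ K := by
    rintro _ ⟨p, rfl⟩
    exact S.boundary_coboundary p
  have hA := S.finrank_antisymm Set.univ (by simp)
  have hK := LinearMap.finrank_range_add_finrank_ker
    (S.boundary.domRestrict (S.antisymm Set.univ))
  have hδ := LinearMap.finrank_range_add_finrank_ker δ
  rw [LinearMap.ker_codRestrict, Module.finrank_fintype_fun_eq_card,
    ← Nat.card_eq_fintype_card] at hδ
  have h1 := S.finrank_ker_coboundary_le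
  have h2 := S.le_finrank_range_boundary
  have h3 := S.card_orbits
  have h4 := S.card_dart
  rw [Set.ncard_univ] at hA
  -- With `V`, `E`, `F` the numbers of cells, cycles have dimension at most `E - V + n` and
  -- coboundaries at least `F - n`; both numbers agree because `V + F = E + 2n`.
  have heq : LinearMap.range δ = K := by
    refine Submodule.eq_of_le_of_finrank_le hle ?_
    have : Module.finrank ℚ K = Module.finrank ℚ
      (LinearMap.ker (S.boundary.domRestrict (S.antisymm Set.univ))) := rfl
    omega
  have hzK : (⟨z, hz⟩ : S.antisymm Set.univ) ∈ K := h
  rw [← heq] at hzK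
  obtain ⟨p, hp⟩ := hzK
  exact ⟨p, congrArg Subtype.val hp⟩

/-- A nonempty set of edges without vertices of degree one carries a cycle. -/
theorem exists_cycle [Fintype S.Dart] (Z : Set S.Dart) (hZ : ∀ d ∈ Z, S.inv d ∈ Z)
    (hne : Z.Nonempty)
    (hdeg : ∀ d ∈ Z, ∃ e ∈ Z, e ≠ d ∧ S.orbit S.rot e = S.orbit S.rot d) :
    ∃ z ∈ S.antisymm Z, S.boundary z = 0 ∧ z ≠ 0 := by
  classical
  have := Fintype.ofFinite (S.Orbits S.rot)
  obtain ⟨d₀, hd₀⟩ := hne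
  let VZ : Finset (S.Orbits S.rot) := Z.toFinset.image (S.orbit S.rot)
  let v₀ := S.orbit S.rot d₀
  have hv₀ : v₀ ∈ VZ := Finset.mem_image_of_mem _ (by simpa using hd₀)
  -- Each vertex met by `Z` is the origin of at least two darts of `Z`, so `Z` has at least as many
  -- edges as vertices.
  have hcard : 2 * VZ.card ≤ Z.ncard := by
    rw [Set.ncard_eq_toFinset_card']
    refine Finset.mul_card_image_le_card Z.toFinset 2 ?_
    intro v hv
    obtain ⟨d, hd, rfl⟩ := Finset.mem_image.1 hv
    rw [Set.mem_toFinset] at hd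
    obtain ⟨e, he, hne, hde⟩ := hdeg d hd
    have h1 : 1 < (Z.toFinset.filter fun x => S.orbit S.rot x = S.orbit S.rot d).card :=
      Finset.one_lt_card.2 ⟨e, by simp [he, hde], d, by simp [hd], hne⟩
    exact h1
  -- Dropping the equation at `v₀` leaves fewer equations than unknowns. It follows from the others,
  -- since the values of the boundary of an antisymmetric function add up to zero.
  let r : S.antisymm Z →ₗ[ℚ] ((VZ.erase v₀ :) → ℚ) :=
    (LinearMap.funLeft ℚ ℚ (fun v : (VZ.erase v₀ :) => (v : S.Orbits S.rot))) ∘ₗ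
      S.boundary.domRestrict (S.antisymm Z)
  have hker : LinearMap.ker r ≠ ⊥ := by
    apply LinearMap.ker_ne_bot_of_finrank_lt
    have h1 := S.finrank_antisymm Z hZ
    rw [Module.finrank_fintype_fun_eq_card, Fintype.card_coe, Finset.card_erase_of_mem hv₀]
    have h2 : 0 < VZ.card := Finset.card_pos.2 ⟨_, hv₀⟩
    omega
  obtain ⟨⟨z, hz⟩, hz0, hzne⟩ := Submodule.exists_mem_ne_zero_of_ne_bot hker
  have hb : ∀ v, v ≠ v₀ → S.boundary z v = 0 := by
    intro v hv
    by_cases hvZ : v ∈ VZ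
    · exact congrFun hz0 ⟨v, Finset.mem_erase.2 ⟨hv, hvZ⟩⟩
    · rw [boundary_apply]
      refine Finset.sum_eq_zero fun d hd => hz.2 d fun hdZ => hvZ ?_
      rw [Finset.mem_filter] at hd
      exact Finset.mem_image.2 ⟨d, by simpa using hdZ, hd.2⟩
  refine ⟨z, hz, ?_, fun h => hzne (Subtype.ext h)⟩
  have htot : ∑ v, S.boundary z v = 0 := by
    simp only [boundary_apply]
    rw [Finset.sum_fiberwise]
    have h : ∑ d, z d = ∑ d, z (S.inv d) := (Equiv.sum_comp S.inv z).symm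
    simp only [hz.1, Finset.sum_neg_distrib] at h
    linarith
  ext v
  by_cases hv : v = v₀
  · rw [Finset.sum_eq_single v₀ (fun v _ hv => hb v hv) (by simp)] at htot
    rw [hv, htot]
    rfl
  · exact hb v hv

/-- On a union of spheres, a function on the darts with values in a group is the coboundary of a
function on the faces if it is the coboundary of a function on the corners. -/
theorem exists_potential {H : Type*} [Group H] (h : S.Dart → H) (hinv : ∀ d, h (S.inv d) = (h d)⁻¹)
    (p : S.Dart → H) (hp : ∀ d, p (S.rot d) = p d * h (S.inv (S.rot d))) :
    ∃ f : S.Dart → H, (∀ d, f (S.next d) = f d) ∧ ∀ d, f (S.inv d) = f d * h d := by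
  classical
  have := S.finite
  have := Fintype.ofFinite S.Dart
  -- The induction is on the number of darts where `h` is nontrivial. The hypothesis on `p` says
  -- that the product of `h` around each vertex is trivial.
  induction hk : (Finset.univ.filter fun d => h d ≠ 1).card using Nat.strong_induction_on
    generalizing h p with
  | _ k ih =>
  -- Faces are merged across the edges where `h` is trivial.
  let s : Setoid S.Dart :=
    Relation.EqvGen.setoid (fun d e => e = S.next d ∨ (h d = 1 ∧ e = S.inv d))
  have hs1 : ∀ d, s (S.next d) d := fun d => Relation.EqvGen.symm _ _ (.rel _ _ (Or.inl rfl))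
  have hs2 : ∀ d, h d = 1 → s (S.inv d) d := fun d hd =>
    Relation.EqvGen.symm _ _ (.rel _ _ (Or.inr ⟨hd, rfl⟩))
  by_cases hA : ∃ d, ¬ s (S.inv d) d
  · obtain ⟨d, hd⟩ := hA
    -- A gauge change on the merged class of `d` makes `h d` trivial. Edges where `h` is trivial
    -- have both sides in one class and stay trivial.
    let g : S.Dart → H := fun e => if s e d then (h d)⁻¹ else 1
    have hg : ∀ e e', s e e' → g e = g e' := by
      intro e e' hee
      have : s e d ↔ s e' d := ⟨fun h => s.trans (s.symm hee) h, fun h => s.trans hee h⟩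
      simp [g, this]
    have hgn : ∀ e, g (S.next e) = g e := fun e => hg _ _ (hs1 e)
    have hlt : (Finset.univ.filter fun e => g e * h e * (g (S.inv e))⁻¹ ≠ 1).card < k := by
      rw [← hk]
      refine Finset.card_lt_card ((Finset.ssubset_iff_of_subset ?_).2 ⟨d, ?_, ?_⟩)
      · intro e
        simp only [Finset.mem_filter, Finset.mem_univ, true_and]
        refine mt fun h1 => ?_
        rw [h1, hg _ _ (hs2 e h1)]
        group
      · simp only [Finset.mem_filter, Finset.mem_univ, true_and]
        exact fun h1 => hd (hs2 d h1)
      · simp [g, hd]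
    have hginv : ∀ e, g (S.inv (S.rot e)) = g e := fun e => by
      rw [inv_rot, ← hgn, Equiv.apply_symm_apply]
    obtain ⟨f, hf1, hf2⟩ := ih _ hlt (fun e => g e * h e * (g (S.inv e))⁻¹)
      (fun e => by simp only [S.inv_inv, hinv]; group) (fun e => p e * (g e)⁻¹)
      (fun e => by simp only [S.inv_inv, hginv, hp]; group) rfl
    refine ⟨fun e => f e * g e, fun e => by simp only [hf1, hgn], fun e => ?_⟩
    simp only [hf2]
    group
  · push Not at hA
    have hall : ∀ d, h d = 1 := by
      by_contra hcon
      push Not at hcon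
      -- Now both sides of every edge are in the same class. The edges where `h` is nontrivial form
      -- a graph without vertices of degree one: around a vertex with a single such dart, `p` would
      -- be constant, and `hp` would make `h` trivial at that dart.
      obtain ⟨z, hz, hz0, hzne⟩ := S.exists_cycle {d | h d ≠ 1}
        (fun d hd => by simpa [hinv] using hd) hcon (by
          intro d hd
          by_contra hno
          push Not at hno
          have hpk : ∀ k : ℕ, p ((S.rot ^ k) d) = p d := by
            intro k
            induction k with
            | zero => rfl
            | succ k ih =>
              rw [pow_succ', Equiv.Perm.mul_apply]
              by_cases hrd : S.rot ((S.rot ^ k) d) = d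
              · rw [hrd]
              · rw [hp, ih]
                have : h (S.rot ((S.rot ^ k) d)) = 1 := by
                  by_contra h1
                  refine hno _ h1 hrd (S.orbit_eq.2 ?_)
                  simpa using Equiv.Perm.SameCycle.refl S.rot d
                rw [hinv, this]
                simp
          have hc : S.rot.SameCycle d (S.rot.symm d) := by
            have h := S.orbit_apply S.rot (S.rot.symm d)
            rw [Equiv.apply_symm_apply] at h
            exact S.orbit_eq.1 h
          obtain ⟨k, hk⟩ := hc.exists_nat_pow_eq
          have h1 := hp (S.rot.symm d)
          rw [← hk, hpk, hk, Equiv.apply_symm_apply, hinv] at h1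
          apply hd
          have h2 : (h d)⁻¹ = 1 := by simpa using h1
          simpa using h2)
      obtain ⟨q, rfl⟩ := S.exists_coboundary_eq z ⟨hz.1, fun d hd => absurd trivial hd⟩ hz0
      apply hzne
      -- The cycle is the coboundary of `q`, and it vanishes where `h` is trivial; so `q` is
      -- constant on merged classes and the cycle is zero. This is a discrete Jordan curve argument.
      have hq : ∀ d e, s d e → q (S.orbit S.next d) = q (S.orbit S.next e) := by
        intro d e hde
        have hde' : Relation.EqvGen (fun d e => e = S.next d ∨ (h d = 1 ∧ e = S.inv d)) d e := hde
        induction hde' with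
        | rel x y hxy =>
          rcases hxy with rfl | ⟨h1, rfl⟩
          · rw [S.orbit_apply]
          · have := hz.2 x (by simpa using h1)
            exact (sub_eq_zero.1 this).symm
        | refl => rfl
        | symm _ _ h' ih => exact (ih h').symm
        | trans _ _ _ h1 h2 ih1 ih2 => exact (ih1 h1).trans (ih2 h2)
      ext d
      exact sub_eq_zero.2 (hq _ _ (hA d))
    exact ⟨fun _ => 1, fun _ => rfl, fun d => by simp [hall d]⟩

end SphereCells
end KirkCut

namespace KirkCut

/-! ## Colorings of cut-diagrams -/

namespace Drawing

variable {n : ℕ} (P : Drawing n)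

theorem reg_next (d : P.Dart) : P.reg (P.next d) = P.reg d :=
  Quotient.sound (Relation.EqvGen.symm _ _ (.rel _ _ (Or.inl rfl)))

theorem reg_inv (d : P.Dart) (h : P.kind d = Kind.blank) : P.reg (P.inv d) = P.reg d :=
  Quotient.sound (Relation.EqvGen.symm _ _ (.rel _ _ (Or.inr ⟨h, rfl⟩)))

/-- A function on the set of darts that is constant on regions. -/
def regionLift {α : Type*} (f : P.Dart → α) (h1 : ∀ d, f (P.next d) = f d)
    (h2 : ∀ d, P.kind d = Kind.blank → f (P.inv d) = f d) : P.Region → α :=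
  Quotient.lift f (by
    intro a b h
    have h' : Relation.EqvGen (fun d e => e = P.next d ∨
      (P.kind d = Kind.blank ∧ e = P.inv d)) a b := h
    induction h' with
    | rel x y h =>
      rename_i hxy
      rcases hxy with rfl | ⟨hb, rfl⟩
      · exact (h1 x).symm
      · exact (h2 x hb).symm
    | refl x => rfl
    | symm x y _ ih => exact (ih (by assumption)).symm
    | trans x y z _ _ ih1 ih2 => exact (ih1 (by assumption)).trans (ih2 (by assumption)))

theorem reg_surjective (R : P.Region) : ∃ d, P.reg d = R := Quotient.exists_rep R

theorem isCut_inv {d : P.Dart} : P.IsCut (P.inv d) ↔ P.IsCut d := not_congr (P.blank_inv d)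

theorem exists_pow_rot_eq (d : P.Dart) : ∃ k : ℕ, 0 < k ∧ (P.rot ^ k) d = d := by
  have := P.finite
  exact ⟨orderOf P.rot, orderOf_pos _, by rw [pow_orderOf_eq_one]; rfl⟩

theorem turn_eq_rot {d : P.Dart} (h : P.IsCut (P.rot d)) : P.turn d = P.rot d := by
  have h1 : sInf {k : ℕ | 0 < k ∧ P.IsCut ((P.rot ^ k) d)} = 1 := by
    refine le_antisymm (Nat.sInf_le ⟨one_pos, by simpa using h⟩) ?_
    exact (Nat.sInf_mem (s := {k : ℕ | 0 < k ∧ P.IsCut ((P.rot ^ k) d)})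
      ⟨1, one_pos, by simpa using h⟩).1
  rw [turn, h1, pow_one]

/-- A blank dart is skipped in the search for the next cut dart. The second alternative is a vertex
without cut darts, where the infimum of the empty set is `0` and `turn` is the identity. -/
theorem turn_rot {d : P.Dart} (h : ¬ P.IsCut (P.rot d)) :
    P.turn (P.rot d) = P.turn d ∨ (¬ P.IsCut (P.turn d) ∧ ¬ P.IsCut (P.turn (P.rot d))) := by
  by_cases hne : {k : ℕ | 0 < k ∧ P.IsCut ((P.rot ^ k) d)}.Nonempty
  · left
    have hmem := Nat.sInf_mem hne
    obtain ⟨m, hm⟩ : ∃ m, sInf {k : ℕ | 0 < k ∧ P.IsCut ((P.rot ^ k) d)} = m + 1 :=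
      Nat.exists_eq_succ_of_ne_zero hmem.1.ne'
    have hm0 : 0 < m := by
      rcases Nat.eq_zero_or_pos m with rfl | h0
      · rw [hm] at hmem
        exact absurd (by simpa using hmem.2) h
      · exact h0
    have h2 : sInf {k : ℕ | 0 < k ∧ P.IsCut ((P.rot ^ k) (P.rot d))} = m := by
      rw [hm] at hmem
      have hmem' : m ∈ {k : ℕ | 0 < k ∧ P.IsCut ((P.rot ^ k) (P.rot d))} := by
        refine ⟨hm0, ?_⟩
        rw [← Equiv.Perm.mul_apply, ← pow_succ]
        exact hmem.2
      refine le_antisymm (Nat.sInf_le hmem') ?_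
      have h3 := Nat.sInf_mem ⟨m, hmem'⟩
      have h4 : sInf {k : ℕ | 0 < k ∧ P.IsCut ((P.rot ^ k) d)} ≤
          sInf {k : ℕ | 0 < k ∧ P.IsCut ((P.rot ^ k) (P.rot d))} + 1 := by
        refine Nat.sInf_le ⟨by omega, ?_⟩
        rw [pow_succ, Equiv.Perm.mul_apply]
        exact h3.2
      omega
    rw [turn, turn, h2, hm, pow_succ, Equiv.Perm.mul_apply]
  · right
    rw [Set.not_nonempty_iff_eq_empty] at hne
    have hno : ∀ k : ℕ, 0 < k → ¬ P.IsCut ((P.rot ^ k) d) := by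
      intro k hk hc
      have : k ∈ {k : ℕ | 0 < k ∧ P.IsCut ((P.rot ^ k) d)} := ⟨hk, hc⟩
      rw [hne] at this
      exact this
    have hd : ¬ P.IsCut d := by
      obtain ⟨k, hk, he⟩ := P.exists_pow_rot_eq d
      have := hno k hk
      rwa [he] at this
    have h0 : {k : ℕ | 0 < k ∧ P.IsCut ((P.rot ^ k) (P.rot d))} = ∅ := by
      rw [Set.eq_empty_iff_forall_notMem]
      rintro k ⟨_, hk⟩
      rw [← Equiv.Perm.mul_apply, ← pow_succ] at hk
      exact hno (k + 1) (Nat.succ_pos k) hk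
    rw [turn, turn, hne, h0]
    simpa using ⟨hd, h⟩

theorem turn_set_nonempty {d : P.Dart} (h : P.IsCut d) :
    {k : ℕ | 0 < k ∧ P.IsCut ((P.rot ^ k) d)}.Nonempty := by
  obtain ⟨k, hk, he⟩ := P.exists_pow_rot_eq d
  exact ⟨k, hk, by rwa [he]⟩

theorem isCut_turn {d : P.Dart} (h : P.IsCut d) : P.IsCut (P.turn d) :=
  (Nat.sInf_mem (P.turn_set_nonempty h)).2

/-- If the two numbers of steps differed, the longer turn would already have stopped at the starting
dart of the shorter one. -/
theorem turn_injOn {d e : P.Dart} (hd : P.IsCut d) (he : P.IsCut e) (h : P.turn d = P.turn e) :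
    d = e := by
  wlog hle : sInf {k : ℕ | 0 < k ∧ P.IsCut ((P.rot ^ k) d)} ≤
      sInf {k : ℕ | 0 < k ∧ P.IsCut ((P.rot ^ k) e)} generalizing d e
  · exact (this he hd h.symm (not_le.1 hle).le).symm
  obtain ⟨m, hm⟩ := Nat.exists_eq_add_of_le hle
  unfold turn at h
  rw [hm, pow_add, Equiv.Perm.mul_apply, (P.rot ^ _).injective.eq_iff] at h
  rcases Nat.eq_zero_or_pos m with rfl | hm0
  · simpa using h
  · have h1 := (Nat.sInf_mem (P.turn_set_nonempty hd)).1
    have h2 : sInf {k : ℕ | 0 < k ∧ P.IsCut ((P.rot ^ k) e)} ≤ m :=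
      Nat.sInf_le ⟨hm0, by rwa [← h]⟩
    omega

end Drawing

/-! ### Colorings of regions by group elements, and their holonomy -/

namespace CutDiagram

variable {n : ℕ} (C : CutDiagram n) {K : Type*} [Group K]

@[simp] theorem regionComp_reg (d : C.Dart) : C.regionComp (C.reg d) = C.comp d := rfl

theorem region_induction {P : C.Region → Prop} {R T : C.Region}
    (h : C.regionComp R = C.regionComp T) (hR : P R)
    (hcut : ∀ d, C.IsCut d → (P (C.reg d) ↔ P (C.reg (C.inv d)))) : P T := by
  obtain ⟨d, rfl⟩ := C.reg_surjective R
  obtain ⟨e, rfl⟩ := C.reg_surjective T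
  refine C.comp_induction (P := fun d => P (C.reg d)) h hR (fun x => ?_) (fun x => ?_)
  · by_cases hx : C.IsCut x
    · exact hcut x hx
    · rw [C.reg_inv x (not_not.1 hx)]
  · rw [C.reg_next]

/-- The letter contributed by the crossing of a cut arc from its left to its right, with respect
to an assignment of group elements to regions. -/
def colorLetter (c : C.Region → K) (d : C.Dart) : K :=
  if C.dir d = true then (c (C.label d))⁻¹ else c (C.label d)

theorem colorLetter_inv (c : C.Region → K) {d : C.Dart} (h : C.IsCut d) :
    C.colorLetter c (C.inv d) = (C.colorLetter c d)⁻¹ := by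
  unfold colorLetter
  rw [C.dir_inv d h, C.label_inv d h]
  cases C.dir d <;> simp

theorem map_colorLetter {H : Type*} [Group H] (π : K →* H) (c : C.Region → K) (d : C.Dart) :
    π (C.colorLetter c d) = C.colorLetter (fun R => π (c R)) d := by
  unfold colorLetter
  split_ifs <;> simp

/-- The regions are sent to elements of a group that satisfy the relations of the group of the
cut-diagram. -/
def IsColoring (c : C.Region → K) : Prop :=
  ∀ d, C.IsCut d → C.dir d = true →
    c (C.reg d) = (c (C.label d))⁻¹ * c (C.reg (C.inv d)) * c (C.label d)

variable {C} {c : C.Region → K}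

theorem IsColoring.reg_inv (hc : C.IsColoring c) {d : C.Dart} (hd : C.IsCut d) :
    c (C.reg (C.inv d)) = (C.colorLetter c d)⁻¹ * c (C.reg d) * C.colorLetter c d := by
  unfold colorLetter
  split_ifs with h
  · rw [hc d hd h]
    group
  · have := hc (C.inv d) (C.isCut_inv.2 hd) (by rw [C.dir_inv d hd]; simpa using h)
    rwa [C.label_inv d hd, C.inv_inv] at this

theorem isColoring_of_reg_inv (h : ∀ d, C.IsCut d →
    c (C.reg (C.inv d)) = (C.colorLetter c d)⁻¹ * c (C.reg d) * C.colorLetter c d) :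
    C.IsColoring c := by
  intro d hd hdir
  have := h d hd
  simp only [colorLetter, hdir, if_true] at this
  rw [this]
  group

theorem IsColoring.map {H : Type*} [Group H] (hc : C.IsColoring c) (π : K →* H) :
    C.IsColoring (fun R => π (c R)) := by
  intro d hd hdir
  simp [hc d hd hdir]

theorem IsColoring.exists_conj (hc : C.IsColoring c) {R T : C.Region}
    (h : C.regionComp R = C.regionComp T) : ∃ g, c T = g⁻¹ * c R * g := by
  refine C.region_induction (P := fun T => ∃ g, c T = g⁻¹ * c R * g) h ⟨1, by simp⟩ ?_
  intro d hd
  rw [hc.reg_inv hd]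
  constructor
  · rintro ⟨g, hg⟩
    exact ⟨g * C.colorLetter c d, by rw [hg]; group⟩
  · rintro ⟨g, hg⟩
    refine ⟨g * (C.colorLetter c d)⁻¹, ?_⟩
    have : c (C.reg d) = C.colorLetter c d * ((C.colorLetter c d)⁻¹ * c (C.reg d) *
        C.colorLetter c d) * (C.colorLetter c d)⁻¹ := by group
    rw [this, hg]
    group

/-- The value at a corner of the product of the letters around a vertex. -/
noncomputable def vertexPotential (c : C.Region → K) (e : C.Dart) : K :=
  match C.kind e with
  | Kind.reg => if C.dir e = true then 1 else (C.colorLetter c (C.turn e))⁻¹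
  | Kind.upper => if C.dir e = true then 1 else
      (C.colorLetter c (C.turn (C.turn e)))⁻¹ * (C.colorLetter c (C.turn (C.turn (C.turn e))))⁻¹
  | Kind.lower => if C.dir (C.turn e) = true then C.colorLetter c e else
      (C.colorLetter c (C.turn (C.turn (C.turn e))))⁻¹
  | _ => 1

/-- The first labeling rule exhibits an arc whose relation is that of the crossing: the label of the
over-strand conjugates one label of the under-strand into the other. -/
theorem IsColoring.crossing (hc : C.IsColoring c) {u : C.Dart} (hu : C.kind u = Kind.upper)
    (hdir : C.dir u = true) :
    C.colorLetter c (C.turn (C.turn (C.turn u))) * C.colorLetter c (C.turn (C.turn u)) *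
      C.colorLetter c (C.turn u) * C.colorLetter c u = 1 := by
  obtain ⟨hl, _, _, _, hd2, hlab⟩ := C.over_strand u hu
  obtain ⟨_, hd3⟩ := C.under_strand _ hl
  obtain ⟨e, he, hedir, hlabel, he1, he2⟩ := C.rule_crossing u hu hdir
  have h := hc e he hedir
  rw [he1, he2, hlabel] at h
  simp only [colorLetter, hd3, hd2, hlab, hdir]
  cases C.dir (C.turn u)
  all_goals simp [h]
  group

/-- Regular points and crossings are settled by the labels around them. At a dot the letter must be
trivial, and it is: the label of the arc is the region of a black dot, or the region of the partner
of a white dot, which lies on component `j` in both cases. -/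
theorem IsColoring.vertexPotential_turn (hc : C.IsColoring c) (j : Fin n)
    (hj : ∀ R, C.regionComp R = j → c R = 1) {e : C.Dart} (he : C.IsCut e) (hej : C.comp e = j) :
    vertexPotential c (C.turn e) = vertexPotential c e * (C.colorLetter c e)⁻¹ := by
  have h4 : C.kind e = Kind.upper ∨ C.kind e = Kind.lower →
      C.turn (C.turn (C.turn (C.turn e))) = e := by
    rintro (h | h)
    · exact (C.over_strand e h).2.2.2.1
    · have h1 := (C.over_strand _ (C.under_strand e h).1).2.2.2.1
      refine C.turn_injOn ?_ he h1
      exact C.isCut_turn (C.isCut_turn (C.isCut_turn (C.isCut_turn he)))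
  cases hk : C.kind e with
  | blank => exact absurd hk he
  | reg =>
    obtain ⟨_, h2, h3, h5, h6⟩ := C.regular e hk
    simp only [vertexPotential, hk, h3, h5, h2, colorLetter, h6]
    cases C.dir e <;> simp
  | upper =>
    obtain ⟨hl, hu2, _, h4', hd2, hlab⟩ := C.over_strand e hk
    cases hdir : C.dir e with
    | true =>
      rw [hdir] at hd2
      simp [vertexPotential, hk, hl, hdir, hd2, h4']
    | false =>
      rw [hdir] at hd2
      obtain ⟨hl3, _⟩ := C.over_strand _ hu2
      have hcr := hc.crossing hu2 hd2
      rw [h4'] at hcr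
      simp only [vertexPotential, hk, hl, hdir, hd2, if_true, Bool.false_eq_true, if_false,
        Bool.not_false]
      rw [← mul_inv_rev, ← mul_inv_rev, eq_inv_iff_mul_eq_one, ← mul_assoc, ← mul_assoc]
      exact hcr
  | lower =>
    obtain ⟨hu, _⟩ := C.under_strand e hk
    have h4' := h4 (Or.inr hk)
    cases hdir : C.dir (C.turn e) with
    | true => simp [vertexPotential, hk, hu, hdir]
    | false => simp [vertexPotential, hk, hu, hdir, h4']
  | black =>
    have ht := C.univalent e (Or.inl hk)
    have : c (C.label e) = 1 := hj _ (by rw [C.rule_black e hk]; exact hej)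
    simp [ht, colorLetter, this]
  | white =>
    have ht := C.univalent e (Or.inr hk)
    obtain ⟨_, _, _, h1, h2, _⟩ := C.rule_white e hk
    have : c (C.label e) = 1 := hj _ (by rw [← h2]; exact h1.trans hej)
    simp [ht, colorLetter, this]

/-- If the regions of one component have trivial color, then the product of the letters along a
path on this component only depends on its ends. -/
theorem IsColoring.exists_holonomy (hc : C.IsColoring c) (j : Fin n)
    (hj : ∀ R, C.regionComp R = j → c R = 1) :
    ∃ f : C.Region → K, ∀ d, C.comp d = j → C.IsCut d →
      f (C.reg (C.inv d)) = f (C.reg d) * C.colorLetter c d := by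
  classical
  let h : C.Dart → K := fun d => if C.IsCut d ∧ C.comp d = j then C.colorLetter c d else 1
  -- The corner that follows `d` counterclockwise receives the value attached to the next cut dart,
  -- since blank darts contribute nothing.
  let p : C.Dart → K := fun d =>
    if C.IsCut (C.turn d) ∧ C.comp d = j then vertexPotential c (C.turn d) else 1
  obtain ⟨f, hf1, hf2⟩ := C.exists_potential h (fun d => by
    by_cases hd : C.IsCut d ∧ C.comp d = j
    · have hd' : C.IsCut (C.inv d) ∧ C.comp (C.inv d) = j :=
        ⟨C.isCut_inv.2 hd.1, (C.comp_inv d).trans hd.2⟩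
      simp only [h, if_pos hd, if_pos hd', C.colorLetter_inv c hd.1]
    · have hd' : ¬ (C.IsCut (C.inv d) ∧ C.comp (C.inv d) = j) := fun h =>
        hd ⟨C.isCut_inv.1 h.1, (C.comp_inv d).symm.trans h.2⟩
      simp only [h, if_neg hd, if_neg hd', inv_one]) p (fun d => by
    by_cases hdj : C.comp d = j
    · have hrj : C.comp (C.rot d) = j := (C.comp_rot d).trans hdj
      have hij : C.comp (C.inv (C.rot d)) = j := (C.comp_inv _).trans hrj
      simp only [p, h, hdj, hrj, hij, and_true, C.isCut_inv]
      by_cases hcut : C.IsCut (C.rot d)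
      · rw [C.turn_eq_rot hcut, if_pos hcut, if_pos hcut, if_pos (C.isCut_turn hcut),
          hc.vertexPotential_turn j hj hcut hrj, C.colorLetter_inv c hcut]
      · rw [if_neg hcut, mul_one]
        rcases C.turn_rot hcut with h1 | ⟨h1, h2⟩
        · rw [h1]
        · rw [if_neg h1, if_neg h2]
    · have hrj : ¬ C.comp (C.rot d) = j := fun h => hdj ((C.comp_rot d).symm.trans h)
      have hij : ¬ C.comp (C.inv (C.rot d)) = j := fun h => hrj ((C.comp_inv _).symm.trans h)
      simp only [p, h, hdj, hrj, hij, and_false, if_false, mul_one])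
  refine ⟨C.regionLift f hf1 (fun d hd => ?_), fun d hdj hd => ?_⟩
  · rw [hf2]
    have : ¬ (C.IsCut d ∧ C.comp d = j) := fun h => h.1 hd
    simp [h, this]
  · change f (C.inv d) = f d * _
    rw [hf2]
    simp [h, hd, hdj]

open Subgroup in
/-- In a nilpotent group, a coloring with arbitrary values on a basing exists, provided that these
values commute with their conjugates. -/
theorem exists_coloring (C : CutDiagram n) (b : Fin n → C.Region)
    (hb : ∀ j, C.regionComp (b j) = j) (G : Type*) [Group G] [Group.IsNilpotent G] (x : Fin n → G)
    (hx : IsReducedFamily x) : ∃ c : C.Region → G, C.IsColoring c ∧ ∀ j, c (b j) = x j := by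
  revert x
  refine Group.nilpotent_center_quotient_ind (P := fun G _ _ => ∀ x : Fin n → G,
    IsReducedFamily x → ∃ c : C.Region → G, C.IsColoring c ∧ ∀ j, c (b j) = x j) G ?_ ?_
  · intro G _ _ x _
    exact ⟨fun _ => 1, fun d _ _ => by simp, fun j => Subsingleton.elim _ _⟩
  · intro G _ _ ih x hx
    let π : G →* G ⧸ center G := QuotientGroup.mk' (center G)
    have hπ : Function.Surjective π := QuotientGroup.mk'_surjective _
    obtain ⟨cq, hcq, hcqb⟩ := ih _ (hx.map π hπ)
    -- An arbitrary lift of a coloring of the central quotient. Its letters are defined up to the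
    -- center, so conjugation by them is unambiguous.
    choose c hcπ using fun R => hπ (cq R)
    let N : Fin n → Subgroup (G ⧸ center G) := fun j => normalClosure {π (x j)}
    -- Modulo `x j` the colors on component `j` are trivial, so the holonomy there is independent of
    -- the path. A lift `u` of it fails to be multiplicative only by an element of the normal
    -- closure of `x j` times a central one; both commute with `x j`.
    have hhol : ∀ j, ∃ u : C.Region → G, u (b j) = 1 ∧ ∀ d, C.comp d = j → C.IsCut d →
        Commute (u (C.reg (C.inv d)) * (u (C.reg d) * C.colorLetter c d)⁻¹) (x j) := by
      intro j
      have hNn : (N j).Normal := normalClosure_normal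
      let τ : G ⧸ center G →* (G ⧸ center G) ⧸ N j := QuotientGroup.mk' (N j)
      obtain ⟨f, hf⟩ := (hcq.map τ).exists_holonomy j (by
        intro R hR
        obtain ⟨g, hg⟩ := hcq.exists_conj ((hb j).trans hR.symm)
        have : τ (π (x j)) = 1 :=
          (QuotientGroup.eq_one_iff _).2 (subset_normalClosure (Set.mem_singleton _))
        rw [hg, hcqb, map_mul, map_mul, this]
        simp)
      choose v hv using fun R => ((QuotientGroup.mk'_surjective (N j)).comp hπ) (f R)
      refine ⟨fun R => (v (b j))⁻¹ * v R, by simp, fun d hd hcut => ?_⟩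
      have h1 := hf d hd hcut
      rw [← C.map_colorLetter τ, ← hv, ← hv] at h1
      have h2 : C.colorLetter cq d = π (C.colorLetter c d) := by
        rw [C.map_colorLetter]
        simp only [hcπ]
      rw [h2] at h1
      simp only [Function.comp_apply] at h1
      set s := (v (b j))⁻¹ * v (C.reg (C.inv d)) *
        ((v (b j))⁻¹ * v (C.reg d) * C.colorLetter c d)⁻¹ with hs
      have h3 : π s ∈ N j := by
        rw [← QuotientGroup.eq_one_iff]
        change τ (π s) = 1
        rw [hs]
        simp only [map_mul, map_inv]
        change τ (π (v (C.reg (C.inv d)))) = τ (π (v (C.reg d))) * _ at h1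
        rw [h1]
        group
      have h5 := map_normalClosure {x j} π hπ
      rw [Set.image_singleton] at h5
      change π s ∈ normalClosure {π (x j)} at h3
      rw [← h5] at h3
      obtain ⟨ν, hν, hνs⟩ := h3
      obtain ⟨z, hz, hsz⟩ := (QuotientGroup.mk'_eq_mk' _).1 hνs
      rw [← hsz]
      exact (hx.commute_of_mem j hν (subset_normalClosure (Set.mem_singleton _))).mul_left
        ((mem_center_iff.1 hz (x j)).symm)
    choose u hub hu using hhol
    -- The base values are transported by `u`. The result obeys the rule for the letters of `c`, and
    -- these differ from its own letters by central elements only.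
    let c' : C.Region → G := fun R =>
      (u (C.regionComp R) R)⁻¹ * x (C.regionComp R) * u (C.regionComp R) R
    have h1 : ∀ d, C.IsCut d → c' (C.reg (C.inv d)) =
        (C.colorLetter c d)⁻¹ * c' (C.reg d) * C.colorLetter c d := by
      intro d hd
      have h := (hu (C.comp d) d rfl hd).eq
      simp only [c', regionComp_reg, C.comp_inv]
      set w := u (C.comp d) (C.reg (C.inv d))
      set y := u (C.comp d) (C.reg d) * C.colorLetter c d with hy
      have h' : w * y⁻¹ * x (C.comp d) * (w * y⁻¹)⁻¹ = x (C.comp d) := by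
        rw [h]; group
      calc w⁻¹ * x (C.comp d) * w
          = w⁻¹ * (w * y⁻¹ * x (C.comp d) * (w * y⁻¹)⁻¹) * w := by rw [h']
        _ = y⁻¹ * x (C.comp d) * y := by group
        _ = _ := by rw [hy]; group
    have hc'b : ∀ j, c' (b j) = x j := fun j => by simp [c', hb, hub]
    have h2 : ∀ d, π (C.colorLetter c d) = C.colorLetter cq d := by
      intro d
      rw [C.map_colorLetter]
      simp only [hcπ]
    have h3 : ∀ R, π (c' R) = cq R := by
      intro R
      refine C.region_induction (P := fun T => π (c' T) = cq T) (hb (C.regionComp R)) ?_ ?_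
      · rw [hc'b, hcqb]
      · intro d hd
        rw [h1 d hd, hcq.reg_inv hd, ← h2]
        generalize c' (C.reg d) = y
        rw [map_mul, map_mul, map_inv, mul_left_inj, mul_right_inj]
    refine ⟨c', isColoring_of_reg_inv fun d hd => ?_, hc'b⟩
    have h4 : π (C.colorLetter c d) = π (C.colorLetter c' d) := by
      rw [h2, C.map_colorLetter]
      simp only [h3]
    obtain ⟨z, hz, hzd⟩ := (QuotientGroup.mk'_eq_mk' _).1 h4
    rw [h1 d hd, ← hzd]
    have hz' := mem_center_iff.1 hz ((C.colorLetter c d)⁻¹ * c' (C.reg d) * C.colorLetter c d)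
    calc (C.colorLetter c d)⁻¹ * c' (C.reg d) * C.colorLetter c d
        = z⁻¹ * (z * ((C.colorLetter c d)⁻¹ * c' (C.reg d) * C.colorLetter c d)) := by group
      _ = _ := by rw [← hz']; group

end CutDiagram
end KirkCut

namespace KirkCut

/-! ## Framings and the sums over white dots -/

variable {n : ℕ}

/-- The values at the basing, in the reduced free group on the components that differ from the
`i`th one. -/
def baseValue (i j : Fin n) : ReducedFree {j : Fin n // j ≠ i} :=
  if h : j ≠ i then ReducedFree.gen ⟨j, h⟩ else 1

theorem baseValue_of_ne {i : Fin n} (j : {j : Fin n // j ≠ i}) :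
    baseValue i j = ReducedFree.gen j := dif_pos j.2

theorem baseValue_self (i : Fin n) : baseValue i i = 1 := dif_neg (by simp)

theorem isReducedFamily_baseValue (i : Fin n) : IsReducedFamily (baseValue i) := by
  intro j g
  by_cases h : j = i
  · subst h
    simp [baseValue_self]
  · rw [show j = ((⟨j, h⟩ : {j : Fin n // j ≠ i}) : Fin n) from rfl, baseValue_of_ne]
    exact ReducedFree.isReducedFamily _ g

/-- A color: the number of a component, and an element of the reduced free group, which stands for
a meridian if the component is not the `i`th one, and for the homotopy class of a path on the
`i`th component. -/
abbrev Color (i : Fin n) : Type := Fin n × ReducedFree {j : Fin n // j ≠ i}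

namespace Color

variable {i : Fin n}

/-- The action of the reduced free group on colors. -/
def act (a : Color i) (g : ReducedFree {j : Fin n // j ≠ i}) : Color i :=
  (a.1, if a.1 = i then a.2 * g else g⁻¹ * a.2 * g)

/-- The meridian of a color. -/
def mer (a : Color i) : ReducedFree {j : Fin n // j ≠ i} := if a.1 = i then 1 else a.2

@[simp] theorem act_fst (a : Color i) (g) : (a.act g).1 = a.1 := rfl

theorem act_snd_of_eq {a : Color i} (h : a.1 = i) (g) : (a.act g).2 = a.2 * g := if_pos h

theorem act_snd_of_ne {a : Color i} (h : a.1 ≠ i) (g) : (a.act g).2 = g⁻¹ * a.2 * g := if_neg h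

theorem act_one (a : Color i) : a.act 1 = a := by
  unfold act
  ext <;> simp

theorem act_mul (a : Color i) (g h) : a.act (g * h) = (a.act g).act h := by
  unfold act
  ext
  · rfl
  · dsimp only
    split_ifs <;> group

theorem act_inv_act (a : Color i) (g) : (a.act g⁻¹).act g = a := by
  rw [← act_mul, inv_mul_cancel, act_one]

theorem act_act_inv (a : Color i) (g) : (a.act g).act g⁻¹ = a := by
  rw [← act_mul, mul_inv_cancel, act_one]

theorem act_left_inj {a b : Color i} (g) : a.act g = b.act g ↔ a = b :=
  ⟨fun h => by rw [← act_act_inv a g, h, act_act_inv], fun h => by rw [h]⟩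

theorem mer_act (a : Color i) (g) : (a.act g).mer = g⁻¹ * a.mer * g := by
  unfold act mer
  dsimp only
  split_ifs <;> simp

end Color

namespace BasedCutDiagram

variable (C : BasedCutDiagram n) (i : Fin n)

/-- A coherent system of colors of all regions. -/
structure IsFraming (v : C.Region → Color i) : Prop where
  comp : ∀ R, (v R).1 = C.regionComp R
  base : ∀ j, v (C.base j) = (j, baseValue i j)
  cut : ∀ d, C.IsCut d →
    v (C.reg (C.inv d)) = (v (C.reg d)).act (C.colorLetter (fun R => (v R).mer) d)

variable {C i}

namespace IsFraming

variable {v : C.Region → Color i}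

theorem isColoring (hv : C.IsFraming i v) : C.IsColoring (fun R => (v R).mer) :=
  CutDiagram.isColoring_of_reg_inv fun d hd => by rw [hv.cut d hd, Color.mer_act]

theorem mer_base (hv : C.IsFraming i v) (j : Fin n) : (v (C.base j)).mer = baseValue i j := by
  rw [hv.base]
  unfold Color.mer
  dsimp only
  split_ifs with h
  · rw [h, baseValue_self]
  · rfl

theorem mer_eq_one (hv : C.IsFraming i v) {R : C.Region} (h : C.regionComp R = i) :
    (v R).mer = 1 := by
  rw [Color.mer, hv.comp, if_pos h]

/-- On component `i` meridians are trivial. Elsewhere the two meridians are conjugates of one base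
value and commute by reducedness. Hence an arc labeled by a region of its own component, as at any
dot, separates regions of the same color. -/
theorem act_mer (hv : C.IsFraming i v) {R T : C.Region} (h : C.regionComp R = C.regionComp T) :
    (v R).act (v T).mer = v R := by
  by_cases hi : C.regionComp T = i
  · rw [hv.mer_eq_one hi, Color.act_one]
  · have hb := C.base_comp (C.regionComp T)
    obtain ⟨g, hg⟩ := hv.isColoring.exists_conj (hb.trans h.symm)
    obtain ⟨k, hk⟩ := hv.isColoring.exists_conj hb
    have hne : (v R).1 ≠ i := by rw [hv.comp, h]; exact hi
    have hc : Commute (v R).mer (v T).mer := by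
      rw [hg, hk, hv.mer_base]
      exact (isReducedFamily_baseValue i).commute_conj _ _ _
    have hm : (v R).mer = (v R).2 := if_neg hne
    rw [hm] at hc
    ext
    · rfl
    · rw [Color.act, if_neg hne, mul_assoc, hc.eq, inv_mul_cancel_left]

end IsFraming

variable (C i)

/-- The reduced free group is nilpotent, so it admits a coloring with the required base values. The
value `1` at `base i` makes all of component `i` trivial, which therefore has a holonomy function;
it is normalized to `1` at the base. -/
theorem exists_isFraming : ∃ v, C.IsFraming i v := by
  classical
  obtain ⟨c, hc, hcb⟩ := CutDiagram.exists_coloring C.toCutDiagram C.base C.base_comp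
    (ReducedFree {j : Fin n // j ≠ i}) (baseValue i) (isReducedFamily_baseValue i)
  have hci : ∀ R, C.regionComp R = i → c R = 1 := by
    intro R hR
    obtain ⟨g, hg⟩ := hc.exists_conj ((C.base_comp i).trans hR.symm)
    rw [hg, hcb, baseValue_self]
    simp
  obtain ⟨f, hf⟩ := hc.exists_holonomy i hci
  let v : C.Region → Color i := fun R =>
    (C.regionComp R, if C.regionComp R = i then (f (C.base i))⁻¹ * f R else c R)
  have hm : ∀ R, (v R).mer = c R := by
    intro R
    unfold Color.mer
    simp only [v]
    split_ifs with h
    · exact (hci R h).symm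
    · rfl
  refine ⟨v, fun R => rfl, fun j => ?_, fun d hd => ?_⟩
  · simp only [v, C.base_comp]
    split_ifs with h
    · subst h
      rw [inv_mul_cancel, baseValue_self]
    · rw [hcb]
  · simp only [hm]
    have hcut := C.comp_inv d
    by_cases h : C.comp d = i
    · have h1 : (v (C.reg d)).2 = (f (C.base i))⁻¹ * f (C.reg d) := if_pos h
      have h2 : (v (C.reg (C.inv d))).2 = (f (C.base i))⁻¹ * f (C.reg (C.inv d)) :=
        if_pos (hcut.trans h)
      refine Prod.ext hcut ?_
      rw [Color.act_snd_of_eq h, h1, h2, hf d h hd, mul_assoc]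
    · have h1 : (v (C.reg d)).2 = c (C.reg d) := if_neg h
      have h2 : (v (C.reg (C.inv d))).2 = c (C.reg (C.inv d)) :=
        if_neg fun h' => h (hcut.symm.trans h')
      refine Prod.ext hcut ?_
      rw [Color.act_snd_of_ne h, h1, h2]
      exact hc.reg_inv hd

-- Every region is conjugate to the base region of its component, and those of component `i` die, so
-- the remaining base meridians generate normally. They form a finite reduced family; the group is
-- nilpotent, and normal generators generate it.
open Subgroup in
theorem closure_toAt : closure (Set.range fun j : {j : Fin n // j ≠ i} =>
    C.toAt i (C.mer (C.base j))) = ⊤ := by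
  have hsurj : Function.Surjective (C.toAt i) :=
    (QuotientGroup.mk'_surjective _).comp (QuotientGroup.mk'_surjective _)
  have hcol : C.IsColoring (fun R => C.toAt i (C.mer R)) := by
    refine CutDiagram.IsColoring.map (c := C.mer) ?_ (C.toAt i)
    intro d hd hdir
    have h : (QuotientGroup.mk ((FreeGroup.of (C.reg d))⁻¹ * ((FreeGroup.of (C.label d))⁻¹ *
        FreeGroup.of (C.reg (C.inv d)) * FreeGroup.of (C.label d))) : C.Grp) = 1 :=
      (QuotientGroup.eq_one_iff _).2 (subset_normalClosure ⟨d, hd, hdir, rfl⟩)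
    have h' : (C.mer (C.reg d))⁻¹ * ((C.mer (C.label d))⁻¹ * C.mer (C.reg (C.inv d)) *
      C.mer (C.label d)) = 1 := h
    exact inv_mul_eq_one.1 h'
  have hi : C.toAt i (C.mer (C.base i)) = 1 :=
    (QuotientGroup.eq_one_iff _).2 (subset_normalClosure ⟨C.base i, C.base_comp i, rfl⟩)
  have hgen : ∀ N : Subgroup (C.RGrpAt i), N.Normal →
      (∀ j : {j : Fin n // j ≠ i}, C.toAt i (C.mer (C.base j)) ∈ N) → N = ⊤ := by
    intro N hN hj
    have hR : ∀ R, C.toAt i (C.mer R) ∈ N := by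
      intro R
      obtain ⟨g, hg⟩ := hcol.exists_conj (C.base_comp (C.regionComp R))
      rw [hg]
      have hb : C.toAt i (C.mer (C.base (C.regionComp R))) ∈ N := by
        by_cases h : C.regionComp R = i
        · rw [h, hi]; exact one_mem _
        · exact hj ⟨_, h⟩
      simpa using hN.conj_mem _ hb g⁻¹
    rw [eq_top_iff]
    intro x _
    obtain ⟨y, rfl⟩ := hsurj x
    have hy : y ∈ closure (Set.range C.mer) := by
      have := PresentedGroup.closure_range_of C.relators
      change y ∈ closure (Set.range PresentedGroup.of)
      rw [this]
      trivial
    have := mem_map_of_mem (C.toAt i) hy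
    rw [MonoidHom.map_closure] at this
    refine (closure_le N).2 ?_ this
    rintro _ ⟨_, ⟨R, rfl⟩, rfl⟩
    exact hR R
  have hred : IsReducedFamily fun j : {j : Fin n // j ≠ i} => C.toAt i (C.mer (C.base j)) := by
    intro j g
    exact ((isReducedFamily_reducedGroup fun j : Fin n => C.mer (C.base j)).map
      (QuotientGroup.mk' (C.meridianKernel i)) (QuotientGroup.mk'_surjective _)) j g
  have hnorm : normalClosure (Set.range fun j : {j : Fin n // j ≠ i} =>
      C.toAt i (C.mer (C.base j))) = ⊤ :=
    hgen _ normalClosure_normal fun j => subset_normalClosure ⟨j, rfl⟩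
  have := hred.isNilpotent hnorm
  exact eq_top_of_normalClosure_eq_top _ (by rw [normalClosure_closure_eq_normalClosure, hnorm])

variable {C i}

theorem equiv_ext {φ ψ : C.RGrpAt i →* ReducedFree {j : Fin n // j ≠ i}}
    (h : ∀ j : {j : Fin n // j ≠ i},
      φ (C.toAt i (C.mer (C.base j))) = ψ (C.toAt i (C.mer (C.base j)))) : φ = ψ := by
  refine MonoidHom.eq_of_eqOn_dense (C.closure_toAt i) ?_
  rintro _ ⟨j, rfl⟩
  exact h j

-- The coloring gives a homomorphism to the reduced free group, and reducedness of the base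
-- meridians gives one back. They are inverse to each other on the distinguished elements, which
-- generate both groups.
open Subgroup in
theorem IsFraming.exists_equiv {v : C.Region → Color i} (hv : C.IsFraming i v) :
    ∃ φ : C.RGrpAt i ≃* ReducedFree {j : Fin n // j ≠ i},
      ∀ R, φ (C.toAt i (C.mer R)) = (v R).mer := by
  let φ₀ : C.Grp →* ReducedFree {j : Fin n // j ≠ i} :=
    PresentedGroup.toGroup (f := fun R => (v R).mer) (by
      rintro _ ⟨d, hd, hdir, rfl⟩
      have := hv.isColoring d hd hdir
      simp only [map_mul, map_inv, FreeGroup.lift_apply_of]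
      dsimp only at this
      rw [this]
      group)
  have h₀ : ∀ R, φ₀ (C.mer R) = (v R).mer := fun R => PresentedGroup.toGroup.of _
  let φ₁ : C.RGrp →* ReducedFree {j : Fin n // j ≠ i} :=
    QuotientGroup.lift _ φ₀ ((isReducedFamily_baseValue i).reducedKernel_le φ₀ fun j => by
      rw [h₀, hv.mer_base])
  let φ₂ : C.RGrpAt i →* ReducedFree {j : Fin n // j ≠ i} :=
    QuotientGroup.lift (C.meridianKernel i) φ₁ (by
      refine normalClosure_le_normal (N := φ₁.ker) ?_
      rintro _ ⟨R, hR, rfl⟩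
      exact (h₀ R).trans (hv.mer_eq_one hR))
  have h₂ : ∀ R, φ₂ (C.toAt i (C.mer R)) = (v R).mer := h₀
  have hred : IsReducedFamily fun j : {j : Fin n // j ≠ i} => C.toAt i (C.mer (C.base j)) := by
    intro j g
    exact ((isReducedFamily_reducedGroup fun j : Fin n => C.mer (C.base j)).map
      (QuotientGroup.mk' (C.meridianKernel i)) (QuotientGroup.mk'_surjective _)) j g
  let ψ := ReducedFree.lift hred
  have h1 : φ₂.comp ψ = MonoidHom.id _ := ReducedFree.hom_ext fun j => by
    rw [MonoidHom.comp_apply, ReducedFree.lift_gen, h₂, hv.mer_base, baseValue_of_ne]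
    rfl
  have h2 : ψ.comp φ₂ = MonoidHom.id _ := by
    refine MonoidHom.eq_of_eqOn_dense (C.closure_toAt i) ?_
    rintro _ ⟨j, rfl⟩
    simp only [MonoidHom.comp_apply]
    rw [h₂, hv.mer_base, baseValue_of_ne, ReducedFree.lift_gen]
    rfl
  exact ⟨MonoidHom.toMulEquiv φ₂ ψ h2 h1, h₂⟩

theorem IsFraming.map_mer {v : C.Region → Color i} (hv : C.IsFraming i v)
    (φ : C.RGrpAt i ≃* ReducedFree {j : Fin n // j ≠ i})
    (hφ : ∀ j : {j : Fin n // j ≠ i}, φ (C.toAt i (C.mer (C.base j))) = ReducedFree.gen j)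
    (R : C.Region) : φ (C.toAt i (C.mer R)) = (v R).mer := by
  obtain ⟨ψ, hψ⟩ := hv.exists_equiv
  have : (φ : C.RGrpAt i →* _) = (ψ : C.RGrpAt i →* _) := equiv_ext fun j => by
    simp only [MonoidHom.coe_coe]
    rw [hφ, hψ, hv.mer_base, baseValue_of_ne]
  rw [← hψ]
  exact DFunLike.congr_fun this _

/-- Each crossing acts by its letter and the actions compose. Starting from the base of component
`i`, the image of a word is thus read off from the end of the path. -/
theorem IsFraming.map_word {v : C.Region → Color i} (hv : C.IsFraming i v)
    (φ : C.RGrpAt i ≃* ReducedFree {j : Fin n // j ≠ i})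
    (hφ : ∀ j : {j : Fin n // j ≠ i}, φ (C.toAt i (C.mer (C.base j))) = ReducedFree.gen j)
    (l : List C.Dart) (R T : C.Region) (hl : C.IsPath R l T) :
    v T = (v R).act (φ (C.toAt i (C.word l))) := by
  induction l generalizing R with
  | nil =>
    have hRT : R = T := hl
    rw [hRT, CutDiagram.word, List.map_nil, List.prod_nil, map_one, map_one, Color.act_one]
  | cons d l ih =>
    obtain ⟨hd, rfl, hl⟩ := hl
    have : φ (C.toAt i (C.letter d)) = C.colorLetter (fun R => (v R).mer) d := by
      unfold CutDiagram.letter CutDiagram.colorLetter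
      split_ifs
      · rw [map_inv, map_inv, hv.map_mer φ hφ]
      · rw [hv.map_mer φ hφ]
    have hw : C.word (d :: l) = C.letter d * C.word l := by simp [CutDiagram.word]
    rw [ih _ hl, hv.cut d hd, hw, map_mul, map_mul, this, ← Color.act_mul]

theorem IsFraming.snd_eq {v : C.Region → Color i} (hv : C.IsFraming i v)
    (φ : C.RGrpAt i ≃* ReducedFree {j : Fin n // j ≠ i})
    (hφ : ∀ j : {j : Fin n // j ≠ i}, φ (C.toAt i (C.mer (C.base j))) = ReducedFree.gen j)
    (l : List C.Dart) (T : C.Region) (hl : C.IsPath (C.base i) l T) :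
    (v T).2 = φ (C.toAt i (C.word l)) := by
  rw [hv.map_word φ hφ l _ T hl, hv.base, baseValue_self]
  simp [Color.act]

/-- The contribution of a white dot to twice the sum over all pairs of white dots. -/
noncomputable def dotTerm (v : C.Region → Color i) (p : C.Dart) :
    MonoidAlgebra ℤ (ReducedFree {j : Fin n // j ≠ i}) :=
  C.dotSign p • (MonoidAlgebra.of ℤ _
    (posPart ((v (C.reg p)).2 * ((v (C.reg (C.pair p))).2)⁻¹)) - 1)

variable (C i)

/-- The white dots on the `i`th component. -/
def whiteDots : Set C.Dart := {p | C.kind p = Kind.white ∧ C.comp p = i}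

variable {C i}

theorem pair_mem_whiteDots {p : C.Dart} (hp : p ∈ C.whiteDots i) : C.pair p ∈ C.whiteDots i := by
  obtain ⟨h1, _, _, h2, _⟩ := C.rule_white p hp.1
  exact ⟨h1, h2.trans hp.2⟩

theorem dotTerm_pair (v : C.Region → Color i) {p : C.Dart} (hp : p ∈ C.whiteDots i) :
    dotTerm v (C.pair p) = dotTerm v p := by
  obtain ⟨_, h1, _, _, _, _, h2⟩ := C.rule_white p hp.1
  have : (v (C.reg (C.pair p))).2 * ((v (C.reg p)).2)⁻¹ =
      ((v (C.reg p)).2 * ((v (C.reg (C.pair p))).2)⁻¹)⁻¹ := by group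
  rw [dotTerm, dotTerm, h1, dotSign, dotSign, h2, this, posPart_inv]

theorem IsFraming.pairElement_eq {v : C.Region → Color i} (hv : C.IsFraming i v)
    (φ : C.RGrpAt i ≃* ReducedFree {j : Fin n // j ≠ i})
    (hφ : ∀ j : {j : Fin n // j ≠ i}, φ (C.toAt i (C.mer (C.base j))) = ReducedFree.gen j)
    (l₁ l₂ : List C.Dart) (R T : C.Region) (h₁ : C.IsPath (C.base i) l₁ R)
    (h₂ : C.IsPath (C.base i) l₂ T) :
    C.pairElement i φ l₁ l₂ = posPart ((v R).2 * ((v T).2)⁻¹) := by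
  rw [pairElement, posPart, hv.snd_eq φ hφ l₁ R h₁, hv.snd_eq φ hφ l₂ T h₂]
  have e : ∀ x y : C.Grp, φ (C.toAt i (x * y⁻¹)) = φ (C.toAt i x) * (φ (C.toAt i y))⁻¹ :=
    fun x y => by rw [map_mul, map_mul, map_inv, map_inv]
  rw [e, e, mul_inv_rev, inv_inv]

/-- Both dots of a pair contribute the same term, so the sum over all dots counts each pair twice.
It involves neither paths nor an order of the dots. -/
theorem IsKirkSum.two_smul {v : C.Region → Color i} (hv : C.IsFraming i v)
    {s : MonoidAlgebra ℤ (ReducedFree {j : Fin n // j ≠ i})} (hs : C.IsKirkSum i s) :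
    s + s = ∑ᶠ p ∈ C.whiteDots i, dotTerm v p := by
  have := C.finite
  obtain ⟨φ, T, α₁, α₂, hφ, hT, hT', h₁, h₂, rfl⟩ := hs
  have e : ∑ p ∈ T, C.dotSign p • (MonoidAlgebra.of ℤ (ReducedFree {j : Fin n // j ≠ i})
      (C.pairElement i φ (α₁ p) (α₂ p)) - 1) = ∑ p ∈ T, dotTerm v p := by
    refine Finset.sum_congr rfl fun p hp => ?_
    rw [dotTerm, hv.pairElement_eq φ hφ _ _ _ _ (h₁ p hp) (h₂ p hp)]
  rw [e]
  have hW : C.whiteDots i = (T : Set C.Dart) ∪ C.pair '' T := by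
    ext p
    constructor
    · intro hp
      by_cases hpT : p ∈ T
      · exact Or.inl hpT
      · refine Or.inr ⟨C.pair p, ?_, (C.rule_white p hp.1).2.1⟩
        by_contra h
        exact hpT ((hT' p hp.1 hp.2).2 h)
    · rintro (hp | ⟨p, hp, rfl⟩)
      · exact hT p hp
      · exact pair_mem_whiteDots (hT p hp)
  have hd : Disjoint (T : Set C.Dart) (C.pair '' T) := by
    rw [Set.disjoint_left]
    rintro _ hp ⟨q, hq, rfl⟩
    exact (hT' q (hT q hq).1 (hT q hq).2).1 hq hp
  have hinj : Set.InjOn C.pair (T : Set C.Dart) := by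
    intro p hp q hq h
    rw [← (C.rule_white p (hT p hp).1).2.1, h, (C.rule_white q (hT q hq).1).2.1]
  rw [hW, finsum_mem_union hd (Set.toFinite _) (Set.toFinite _), finsum_mem_image hinj,
    finsum_mem_coe_finset, finsum_mem_coe_finset]
  congr 1
  exact Finset.sum_congr rfl fun p hp => (dotTerm_pair v (hT p hp)).symm

theorem _root_.KirkCut.CutDiagram.IsPath.snoc {C : CutDiagram n} {R T : C.Region}
    {l : List C.Dart} (h : C.IsPath R l T) {d : C.Dart} (hd : C.IsCut d) (hdT : C.reg d = T) :
    C.IsPath R (l ++ [d]) (C.reg (C.inv d)) := by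
  induction l generalizing R with
  | nil =>
    have hRT : R = T := h
    exact ⟨hd, hdT.trans hRT.symm, rfl⟩
  | cons e l ih => exact ⟨h.1, h.2.1, ih h.2.2⟩

theorem _root_.KirkCut.CutDiagram.exists_isPath (C : CutDiagram n) {R T : C.Region}
    (h : C.regionComp R = C.regionComp T) : ∃ l, C.IsPath R l T := by
  refine C.region_induction (P := fun T => ∃ l, C.IsPath R l T) h ⟨[], rfl⟩ fun d hd => ?_
  constructor
  · rintro ⟨l, hl⟩
    exact ⟨_, hl.snoc hd rfl⟩
  · rintro ⟨l, hl⟩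
    have := hl.snoc (C.isCut_inv.2 hd) rfl
    rw [C.inv_inv] at this
    exact ⟨_, this⟩

variable (C i)

theorem exists_isKirkSum : ∃ s, C.IsKirkSum i s := by
  classical
  have := C.finite
  have := Fintype.ofFinite C.Dart
  obtain ⟨v, hv⟩ := C.exists_isFraming i
  obtain ⟨φ, hφ⟩ := hv.exists_equiv
  obtain ⟨k, hk⟩ : ∃ k : C.Dart → ℕ, Function.Injective k :=
    ⟨fun d => Fintype.equivFin C.Dart d,
      Fin.val_injective.comp (Fintype.equivFin C.Dart).injective⟩
  -- An injective numbering of the darts selects one dot of each pair.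
  let T : Finset C.Dart := Finset.univ.filter fun p => p ∈ C.whiteDots i ∧ k p < k (C.pair p)
  have hT : ∀ p ∈ T, p ∈ C.whiteDots i := fun p hp => (Finset.mem_filter.1 hp).2.1
  have hpath : ∀ p : C.Dart, ∃ l, p ∈ C.whiteDots i → C.IsPath (C.base i) l (C.reg p) := by
    intro p
    by_cases hp : p ∈ C.whiteDots i
    · obtain ⟨l, hl⟩ := C.exists_isPath (T := C.reg p) ((C.base_comp i).trans hp.2.symm)
      exact ⟨l, fun _ => hl⟩
    · exact ⟨[], fun h => absurd h hp⟩
  choose α hα using hpath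
  refine ⟨_, φ, T, α, fun p => α (C.pair p), fun j => ?_, hT, fun p h1 h2 => ?_,
    fun p hp => hα p (hT p hp), fun p hp => hα _ (pair_mem_whiteDots (hT p hp)), rfl⟩
  · rw [hφ, hv.mer_base, baseValue_of_ne]
  · have hp : p ∈ C.whiteDots i := ⟨h1, h2⟩
    obtain ⟨_, hpp, hne, _⟩ := C.rule_white p h1
    have h3 : k (C.pair p) ≠ k p := fun h => hne (hk h)
    simp only [T, Finset.mem_filter, Finset.mem_univ, true_and, hp, pair_mem_whiteDots hp, hpp]
    omega

variable {C i}

theorem add_self_injective {s t : MonoidAlgebra ℤ (ReducedFree {j : Fin n // j ≠ i})}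
    (h : s + s = t + t) : s = t := by
  ext x
  have := congrArg (fun f : MonoidAlgebra ℤ (ReducedFree {j : Fin n // j ≠ i}) => f.coeff x) h
  simp only [MonoidAlgebra.coeff_add, Finsupp.add_apply] at this
  omega

theorem IsKirkSum.unique {s t : MonoidAlgebra ℤ (ReducedFree {j : Fin n // j ≠ i})}
    (hs : C.IsKirkSum i s) (ht : C.IsKirkSum i t) : s = t := by
  obtain ⟨v, hv⟩ := C.exists_isFraming i
  exact add_self_injective ((hs.two_smul hv).trans (ht.two_smul hv).symm)

end BasedCutDiagram
end KirkCut

namespace KirkCut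

/-! ## Transfer of framings along a local move -/

instance : DecidableEq Kind := fun a b => by
  cases a <;> cases b <;> first | exact isTrue rfl | exact isFalse fun h => by cases h

section Lists

variable {α β : Type*}

theorem exists_mem_zip_rotate_left {w : List α} {a : α} (ha : a ∈ w) :
    ∃ b, (a, b) ∈ w.zip (w.rotate 1) := by
  obtain ⟨k, hk, rfl⟩ := List.mem_iff_getElem.1 ha
  have hk' : k < (w.rotate 1).length := by simpa using hk
  refine ⟨(w.rotate 1)[k], ?_⟩
  rw [← List.getElem_zip (h := by simpa using hk)]
  exact List.getElem_mem _

theorem exists_mem_zip_rotate_right {w : List α} {b : α} (hb : b ∈ w) :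
    ∃ a, (a, b) ∈ w.zip (w.rotate 1) := by
  obtain ⟨k, hk, rfl⟩ := List.mem_iff_getElem.1 (List.mem_rotate.2 hb : b ∈ w.rotate 1)
  have hk' : k < w.length := by simpa using hk
  refine ⟨w[k], ?_⟩
  rw [← List.getElem_zip (h := by simpa using hk')]
  exact List.getElem_mem _

theorem eq_of_mem_zip_rotate (f : α → β) {w : List α}
    (h : ∀ p ∈ w.zip (w.rotate 1), f p.1 = f p.2) {a b : α} (ha : a ∈ w) (hb : b ∈ w) :
    f a = f b := by
  have key : ∀ k (hk : k < w.length), f w[k] = f (w[0]'(by omega)) := by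
    intro k
    induction k with
    | zero => intro _; rfl
    | succ k ih =>
      intro hk
      have hk' : k < (w.rotate 1).length := by simp; omega
      have hm : (w[k], (w.rotate 1)[k]) ∈ w.zip (w.rotate 1) := by
        rw [← List.getElem_zip (h := by simp; omega)]
        exact List.getElem_mem _
      have h1 := h _ hm
      simp only [List.getElem_rotate, Nat.mod_eq_of_lt hk] at h1
      rw [← h1, ih]
  obtain ⟨k, hk, rfl⟩ := List.mem_iff_getElem.1 ha
  obtain ⟨l, hl, rfl⟩ := List.mem_iff_getElem.1 hb
  rw [key k hk, key l hl]

end Lists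

variable {n : ℕ}

namespace Patch

variable {M : Patch}

theorem mem_darts {a : ℤ} : a ∈ M.darts ↔ ∃ w ∈ M.faces, a ∈ w := by
  simp [darts]

theorem neg_mem_inner {a : ℤ} (h : a ∈ M.inner) : -a ∈ M.inner := ⟨h.2, by simpa using h.1⟩

namespace Embeds

variable {o : ℕ → Bool} {C : CutDiagram n} {ι : ℤ → C.Dart}

theorem reg_eq (E : M.Embeds o C ι) {w : List ℤ} (hw : w ∈ M.faces) {a b : ℤ} (ha : a ∈ w)
    (hb : b ∈ w) : C.reg (ι a) = C.reg (ι b) :=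
  eq_of_mem_zip_rotate (fun a => C.reg (ι a))
    (fun p hp => by rw [← E.face w hw p hp, C.reg_next]) ha hb

theorem mem_kept (E : M.Embeds o C ι) {a : ℤ} (ha : a ∈ M.darts) (ha' : a ∉ M.inner) :
    ι a ∈ M.kept C ι := by
  rintro ⟨b, hb, hab⟩
  rw [E.injOn hb.1 ha hab] at hb
  exact ha' hb

theorem inv_mem_kept (E : M.Embeds o C ι) {d : C.Dart} (hd : d ∈ M.kept C ι) :
    C.inv d ∈ M.kept C ι := by
  rintro ⟨a, ha, had⟩
  refine hd ⟨-a, neg_mem_inner ha, ?_⟩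
  rw [← E.edge a ha, had, C.inv_inv]

theorem mem_image_darts_next (E : M.Embeds o C ι) {d : C.Dart} :
    C.next d ∈ ι '' M.darts ↔ d ∈ ι '' M.darts := by
  constructor
  · rintro ⟨b, hb, hbd⟩
    obtain ⟨w, hw, hbw⟩ := mem_darts.1 hb
    obtain ⟨a, hab⟩ := exists_mem_zip_rotate_right hbw
    refine ⟨a, mem_darts.2 ⟨w, hw, (List.of_mem_zip hab).1⟩, ?_⟩
    have := E.face w hw _ hab
    dsimp only at this
    rw [hbd] at this
    exact C.next.injective this
  · rintro ⟨a, ha, rfl⟩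
    obtain ⟨w, hw, haw⟩ := mem_darts.1 ha
    obtain ⟨b, hab⟩ := exists_mem_zip_rotate_left haw
    exact ⟨b, mem_darts.2 ⟨w, hw, List.mem_rotate.1 (List.of_mem_zip hab).2⟩,
      (E.face w hw _ hab).symm⟩

theorem mem_kept_of_notMem (_E : M.Embeds o C ι) {d : C.Dart} (hd : d ∉ ι '' M.darts) :
    d ∈ M.kept C ι := by
  rintro ⟨a, ha, rfl⟩
  exact hd ⟨a, ha.1, rfl⟩

end Embeds
end Patch

namespace BasedCutDiagram

variable {C : BasedCutDiagram n} {i : Fin n} {v : C.Region → Color i}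

theorem IsFraming.act_letter (hv : C.IsFraming i v) {R : C.Region} {d : C.Dart}
    (h : C.regionComp R = C.regionComp (C.label d)) :
    (v R).act (C.colorLetter (fun R => (v R).mer) d) = v R := by
  have := hv.act_mer h
  unfold CutDiagram.colorLetter
  split_ifs
  · conv_lhs => rw [← this]
    rw [Color.act_act_inv]
  · exact this

/-- A framing is determined by its behavior at the cut arcs and at the basing. -/
theorem isFraming_of_cut (hb : ∀ j, v (C.base j) = (j, baseValue i j))
    (hc : ∀ d, C.IsCut d →
      v (C.reg (C.inv d)) = (v (C.reg d)).act (C.colorLetter (fun R => (v R).mer) d)) :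
    C.IsFraming i v where
  comp R := by
    have h := C.region_induction (P := fun T => (v T).1 = C.regionComp R)
      (C.base_comp (C.regionComp R)) (by rw [hb]) fun d hd => by rw [hc d hd, Color.act_fst]
    exact h
  base := hb
  cut := hc

end BasedCutDiagram

namespace Move.Connects

open BasedCutDiagram

variable {M : Move} {C C' : BasedCutDiagram n} {o : ℕ → Bool} {ι : ℤ → C.Dart} {ι' : ℤ → C'.Dart}
  {θ : C.Dart → C'.Dart} {i : Fin n}

/-- The values of two systems of colors agree outside of the disks. -/
def Agree (M : Move) (ι : ℤ → C.Dart) (θ : C.Dart → C'.Dart) (v : C.Region → Color i)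
    (v' : C'.Region → Color i) : Prop :=
  ∀ d ∈ M.before.kept C.toCutDiagram ι, v (C.reg d) = v' (C'.reg (θ d))

/-- The pair consists of corresponding darts before and after the move. -/
def Tracked (M : Move) (ι : ℤ → C.Dart) (ι' : ℤ → C'.Dart) (θ : C.Dart → C'.Dart) (d : C.Dart)
    (d' : C'.Dart) : Prop :=
  (d ∈ M.before.kept C.toCutDiagram ι ∧ d' = θ d) ∨ ∃ p ∈ M.track, d = ι p.1 ∧ d' = ι' p.2

theorem tracked_of_mem {p : ℤ × ℤ} (h : p ∈ M.track) : Tracked M ι ι' θ (ι p.1) (ι' p.2) :=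
  Or.inr ⟨p, h, rfl, rfl⟩

variable {v : C.Region → Color i} {v' : C'.Region → Color i}

theorem isCut_iff (H : M.Connects C C' o ι ι' θ)
    {d : C.Dart} {d' : C'.Dart} (h : Tracked M ι ι' θ d d') :
    C'.IsCut d' ↔ C.IsCut d := by
  unfold Drawing.IsCut
  rw [(H.kind d d' h).1]

/-- Labels of corresponding darts share a point outside the disks, where both systems of colors
agree. -/
theorem colorLetter_eq (H : M.Connects C C' o ι ι' θ)
    (hA : Agree M ι θ v v') {d : C.Dart} {d' : C'.Dart}
    (h : Tracked M ι ι' θ d d') (hd : C.IsCut d) :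
    C'.colorLetter (fun R => (v' R).mer) d' = C.colorLetter (fun R => (v R).mer) d := by
  obtain ⟨hdir, e, he, he1, he2⟩ := (H.kind d d' h).2 hd
  unfold CutDiagram.colorLetter
  rw [hdir, ← he1, ← he2]
  beta_reduce
  rw [hA e he]

theorem regionComp_label (H : M.Connects C C' o ι ι' θ)
    {d : C.Dart} {d' : C'.Dart} (h : Tracked M ι ι' θ d d')
    (hd : C.IsCut d) : C'.regionComp (C'.label d') = C.regionComp (C.label d) := by
  obtain ⟨hdir, e, he, he1, he2⟩ := (H.kind d d' h).2 hd
  rw [← he1, ← he2]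
  exact H.comp e he

theorem comp_boundary (H : M.Connects C C' o ι ι' θ)
    {a : ℤ} (ha : a ∈ M.before.darts) (ha' : a ∉ M.before.inner) :
    C'.comp (ι' a) = C.comp (ι a) := by
  rw [← H.boundary a ha ha', H.comp _ (H.embeds.mem_kept ha ha')]

/-- Outside the disks the colors come from `v'`; inside, `u` prescribes them polygon by polygon. The
letters of interior arcs depend on the colors of their labels, hence on the system under
construction; `hcut` may therefore use that it agrees with `v'` and obeys the rule outside. -/
theorem exists_isFraming (H : M.Connects C C' o ι ι' θ)
    (hv' : C'.IsFraming i v') (u : ℤ → Color i)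
    (hface : ∀ w ∈ M.before.faces, ∀ a ∈ w, ∀ b ∈ w, u a = u b)
    (hbd : ∀ a ∈ M.before.darts, a ∉ M.before.inner → u a = v' (C'.reg (ι' a)))
    (hblank : ∀ a ∈ M.before.inner, C.kind (ι a) = Kind.blank → u (-a) = u a)
    (hcut : ∀ v : C.Region → Color i, Agree M ι θ v v' →
      (∀ a ∈ M.before.darts, v (C.reg (ι a)) = u a) →
      (∀ d ∈ M.before.kept C.toCutDiagram ι, C.IsCut d →
        v (C.reg (C.inv d)) = (v (C.reg d)).act (C.colorLetter (fun R => (v R).mer) d)) →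
      ∀ a ∈ M.before.inner, C.IsCut (ι a) →
        u (-a) = (u a).act (C.colorLetter (fun R => (v R).mer) (ι a))) :
    ∃ v, C.IsFraming i v ∧ Agree M ι θ v v' ∧ ∀ a ∈ M.before.darts, v (C.reg (ι a)) = u a := by
  classical
  have E := H.embeds
  let g : C.Dart → Color i := fun d =>
    if h : ∃ a ∈ M.before.inner, ι a = d then u h.choose else v' (C'.reg (θ d))
  have hgk : ∀ d ∈ M.before.kept C.toCutDiagram ι, g d = v' (C'.reg (θ d)) := fun d hd => dif_neg hd
  have hgp : ∀ a ∈ M.before.darts, g (ι a) = u a := by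
    intro a ha
    by_cases hi : a ∈ M.before.inner
    · have h : ∃ b ∈ M.before.inner, ι b = ι a := ⟨a, hi, rfl⟩
      have hc : h.choose = a := E.injOn h.choose_spec.1.1 ha h.choose_spec.2
      simp only [g, dif_pos h, hc]
    · rw [hgk _ (E.mem_kept ha hi), H.boundary a ha hi, hbd a ha hi]
  have hnext : ∀ d, g (C.next d) = g d := by
    intro d
    by_cases hd : d ∈ ι '' M.before.darts
    · obtain ⟨a, ha, rfl⟩ := hd
      obtain ⟨w, hw, haw⟩ := Patch.mem_darts.1 ha
      obtain ⟨b, hab⟩ := exists_mem_zip_rotate_left haw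
      have hbw : b ∈ w := List.mem_rotate.1 (List.of_mem_zip hab).2
      have h1 := E.face w hw _ hab
      dsimp only at h1
      rw [h1, hgp a ha, hgp b (Patch.mem_darts.2 ⟨w, hw, hbw⟩), hface w hw a haw b hbw]
    · have hd' : C.next d ∉ ι '' M.before.darts := fun h => hd (E.mem_image_darts_next.1 h)
      rw [hgk _ (E.mem_kept_of_notMem hd), hgk _ (E.mem_kept_of_notMem hd'), H.next d hd,
        C'.reg_next]
  have hinv : ∀ d, C.kind d = Kind.blank → g (C.inv d) = g d := by
    intro d hd
    by_cases hk : d ∈ M.before.kept C.toCutDiagram ι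
    · rw [hgk _ hk, hgk _ (E.inv_mem_kept hk), H.inv d hk, C'.reg_inv]
      rw [(H.kind d (θ d) (Or.inl ⟨hk, rfl⟩)).1, hd]
    · obtain ⟨a, ha, rfl⟩ := not_not.1 hk
      rw [E.edge a ha, hgp _ ha.2, hgp _ ha.1, hblank a ha hd]
  let v : C.Region → Color i := C.regionLift g hnext hinv
  have hvg : ∀ d, v (C.reg d) = g d := fun d => rfl
  have hA : Agree M ι θ v v' := fun d hd => by rw [hvg, hgk d hd]
  have hkc : ∀ d ∈ M.before.kept C.toCutDiagram ι, C.IsCut d →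
      v (C.reg (C.inv d)) = (v (C.reg d)).act (C.colorLetter (fun R => (v R).mer) d) := by
    intro d hd hdc
    have ht : Tracked M ι ι' θ d (θ d) := Or.inl ⟨hd, rfl⟩
    rw [hA _ (E.inv_mem_kept hd), hA d hd, H.inv d hd, hv'.cut _ ((H.isCut_iff ht).2 hdc),
      H.colorLetter_eq hA ht hdc]
  have hp : ∀ a ∈ M.before.darts, v (C.reg (ι a)) = u a := hgp
  refine ⟨v, isFraming_of_cut (fun j => ?_) (fun d hd => ?_), hA, hp⟩
  · obtain ⟨e, he, he1, he2⟩ := H.base j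
    rw [← he1, hA e he, he2, hv'.base]
  · by_cases hk : d ∈ M.before.kept C.toCutDiagram ι
    · exact hkc d hk hd
    · obtain ⟨a, ha, rfl⟩ := not_not.1 hk
      rw [E.edge a ha, hp _ ha.2, hp _ ha.1, hcut v hA hp hkc a ha hd]

theorem dotTerm_eq (H : M.Connects C C' o ι ι' θ)
    (hA : Agree M ι θ v v') {d : C.Dart} {d' : C'.Dart}
    (h : Tracked M ι ι' θ d d') (hd : C.kind d = Kind.white)
    (h1 : v (C.reg d) = v' (C'.reg d'))
    (ht : ∀ p ∈ M.track ++ M.dots, C.pair d = ι p.1 → C'.pair d' = ι' p.2 →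
      v (C.reg (ι p.1)) = v' (C'.reg (ι' p.2))) : dotTerm v' d' = dotTerm v d := by
  have hc : C.IsCut d := by
    unfold Drawing.IsCut
    rw [hd]
    simp
  have h2 : v (C.reg (C.pair d)) = v' (C'.reg (C'.pair d')) := by
    have h' : (d ∈ M.before.kept C.toCutDiagram ι ∧ d' = θ d) ∨
        ∃ p ∈ M.track ++ M.dots, d = ι p.1 ∧ d' = ι' p.2 := by
      rcases h with h | ⟨p, hp, hp'⟩
      · exact Or.inl h
      · exact Or.inr ⟨p, List.mem_append_left _ hp, hp'⟩
    rcases H.pair d d' hd h' with ⟨hk, he⟩ | ⟨p, hp, he1, he2⟩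
    · rw [he, hA _ hk]
    · rw [he1, he2, ht p hp he1 he2]
  rw [dotTerm, dotTerm, ← h1, ← h2, dotSign, dotSign, ((H.kind d d' h).2 hc).1]

/-- The map `θ` matches the white dots outside the disks. The partner of such a dot is outside too,
or it is an identified dot inside, where `ht` compares the colors. -/
theorem finsum_eq (H : M.Connects C C' o ι ι' θ) (hA : Agree M ι θ v v')
    (ht : ∀ p ∈ M.track ++ M.dots, C.kind (ι p.1) = Kind.white →
      C.pair (ι p.1) ∈ M.before.kept C.toCutDiagram ι →
      v (C.reg (ι p.1)) = v' (C'.reg (ι' p.2)))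
    (hin : ∑ᶠ p ∈ C.whiteDots i ∩ ι '' M.before.inner, dotTerm v p =
      ∑ᶠ p ∈ C'.whiteDots i ∩ ι' '' M.after.inner, dotTerm v' p) :
    ∑ᶠ p ∈ C.whiteDots i, dotTerm v p = ∑ᶠ p ∈ C'.whiteDots i, dotTerm v' p := by
  have := C.finite
  have := C'.finite
  rw [← finsum_mem_inter_add_sdiff (ι '' M.before.inner) (Set.toFinite (C.whiteDots i)),
    ← finsum_mem_inter_add_sdiff (ι' '' M.after.inner) (Set.toFinite (C'.whiteDots i)), hin]
  congr 1
  have hk : ∀ d, d ∈ C.whiteDots i \ ι '' M.before.inner ↔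
      d ∈ C.whiteDots i ∧ d ∈ M.before.kept C.toCutDiagram ι := fun d => Iff.rfl
  have hiff : ∀ d ∈ M.before.kept C.toCutDiagram ι, (θ d ∈ C'.whiteDots i ↔ d ∈ C.whiteDots i) := by
    intro d hd
    have h1 := (H.kind d (θ d) (Or.inl ⟨hd, rfl⟩)).1
    have h2 := H.comp d hd
    change C'.kind (θ d) = _ ∧ C'.comp (θ d) = i ↔ C.kind d = _ ∧ C.comp d = i
    rw [h1, h2]
  refine finsum_mem_eq_of_bijOn θ ⟨?_, ?_, ?_⟩ ?_
  · rintro d ⟨hd, hdk⟩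
    exact ⟨(hiff d hdk).2 hd, H.bij.mapsTo hdk⟩
  · exact H.bij.injOn.mono fun d hd => hd.2
  · rintro d' ⟨hd', hdk'⟩
    obtain ⟨d, hdk, rfl⟩ := H.bij.surjOn hdk'
    exact ⟨d, ⟨(hiff d hdk).1 hd', hdk⟩, rfl⟩
  · rintro d ⟨hd, hdk⟩
    refine (H.dotTerm_eq hA (Or.inl ⟨hdk, rfl⟩) hd.1 (hA d hdk) ?_).symm
    intro p hp he _
    refine ht p hp ?_ ?_
    · rw [← he]
      exact (C.rule_white d hd.1).1
    · rw [← he, (C.rule_white d hd.1).2.1]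
      exact hdk

end Move.Connects

namespace Patch.Embeds

open BasedCutDiagram

variable {M : Patch} {o : ℕ → Bool} {C : BasedCutDiagram n} {ι : ℤ → C.Dart} {i : Fin n}

theorem finsum_inner (E : M.Embeds o C.toCutDiagram ι) (v : C.Region → Color i) (S : Finset ℤ)
    (hS : ∀ a, a ∈ M.inner ↔ a ∈ S) :
    ∑ᶠ p ∈ C.whiteDots i ∩ ι '' M.inner, dotTerm v p =
      ∑ a ∈ S, if C.kind (ι a) = Kind.white ∧ C.comp (ι a) = i then dotTerm v (ι a) else 0 := by
  have h1 : C.whiteDots i ∩ ι '' M.inner =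
      ι '' ((S.filter fun a => C.kind (ι a) = Kind.white ∧ C.comp (ι a) = i : Finset ℤ) : Set ℤ) := by
    ext p
    constructor
    · rintro ⟨hp, a, ha, rfl⟩
      exact ⟨a, by simpa using ⟨(hS a).1 ha, hp⟩, rfl⟩
    · rintro ⟨a, ha, rfl⟩
      rw [Finset.coe_filter] at ha
      exact ⟨ha.2, a, (hS a).2 ha.1, rfl⟩
  have h2 : Set.InjOn ι
      ((S.filter fun a => C.kind (ι a) = Kind.white ∧ C.comp (ι a) = i : Finset ℤ) : Set ℤ) := by
    refine E.injOn.mono fun a ha => ?_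
    rw [Finset.coe_filter] at ha
    exact ((hS a).2 ha.1).1
  rw [h1, finsum_mem_image h2, finsum_mem_coe_finset, Finset.sum_filter]

theorem finsum_inner_eq_zero (v : C.Region → Color i)
    (h : ∀ a ∈ M.inner, C.kind (ι a) ≠ Kind.white) :
    ∑ᶠ p ∈ C.whiteDots i ∩ ι '' M.inner, dotTerm v p = 0 := by
  have : C.whiteDots i ∩ ι '' M.inner = ∅ := by
    rw [Set.eq_empty_iff_forall_notMem]
    rintro _ ⟨hp, a, ha, rfl⟩
    exact h a ha hp.1
  rw [this, finsum_mem_empty]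

end Patch.Embeds
end KirkCut

namespace KirkCut

/-! ## Computations in a local picture -/

variable {n : ℕ}

namespace Patch

variable (M : Patch)

/-- Both darts of the edge occur in the patch. -/
def IsInner (a : ℤ) : Prop := a ∈ M.faces.flatten ∧ -a ∈ M.faces.flatten

instance (a : ℤ) : Decidable (M.IsInner a) := inferInstanceAs (Decidable (_ ∧ _))

/-- The patch prescribes the kind of the dart. -/
def HasKind (a : ℤ) (k : Kind) : Prop :=
  ∃ c ∈ M.cuts, (a = c.1 ∧ k = c.2.2.1) ∨ (a = -c.1 ∧ k = c.2.2.2)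

instance (a : ℤ) (k : Kind) : Decidable (M.HasKind a k) :=
  inferInstanceAs (Decidable (∃ c ∈ M.cuts, _))

/-- The patch shows a cut arc at the dart. -/
def ShowsCut (a : ℤ) : Prop :=
  ∃ c ∈ M.cuts, (a = c.1 ∧ c.2.2.1 ≠ Kind.blank) ∨ (a = -c.1 ∧ c.2.2.1 ≠ Kind.blank)

instance (a : ℤ) : Decidable (M.ShowsCut a) := inferInstanceAs (Decidable (∃ c ∈ M.cuts, _))

/-- The patch shows that the dart is no white dot. -/
def ShowsNonwhite (a : ℤ) : Prop :=
  (∃ b ∈ M.blanks, a = b ∨ a = -b) ∨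
    ∃ c ∈ M.cuts, (a = c.1 ∧ c.2.2.1 ≠ Kind.white) ∨ (a = -c.1 ∧ c.2.2.2 ≠ Kind.white)

instance (a : ℤ) : Decidable (M.ShowsNonwhite a) := inferInstanceAs (Decidable (_ ∨ _))

/-- `a` and `b` lie on the boundary of the same polygon. -/
def SameFace (a b : ℤ) : Prop := ∃ w ∈ M.faces, a ∈ w ∧ b ∈ w

instance (a b : ℤ) : Decidable (M.SameFace a b) := inferInstanceAs (Decidable (∃ w ∈ M.faces, _))

variable {M} {o : ℕ → Bool}

namespace Embeds

section CutDiagram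

variable {C : CutDiagram n} {ι : ℤ → C.Dart}

theorem inv_eq (E : M.Embeds o C ι) (a : ℤ) (h : M.IsInner a := by decide) :
    C.inv (ι a) = ι (-a) := E.edge a h

theorem kind_eq (E : M.Embeds o C ι) {a : ℤ} {k : Kind} (h : M.HasKind a k := by decide) :
    C.kind (ι a) = k := by
  obtain ⟨c, hc, ⟨rfl, rfl⟩ | ⟨rfl, rfl⟩⟩ := h
  · exact (E.cut c hc).1
  · exact (E.cut c hc).2.1

theorem isCut (E : M.Embeds o C ι) (a : ℤ)
    (h : M.ShowsCut a ∧ M.IsInner a := by decide) : C.IsCut (ι a) := by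
  obtain ⟨⟨c, hc, ⟨rfl, h'⟩ | ⟨rfl, h'⟩⟩, hi⟩ := h
  · unfold Drawing.IsCut
    rwa [(E.cut c hc).1]
  · have hi' : c.1 ∈ M.inner := by simpa using neg_mem_inner hi
    rw [← E.edge c.1 hi', C.isCut_inv]
    unfold Drawing.IsCut
    rwa [(E.cut c hc).1]

theorem kind_ne_white (E : M.Embeds o C ι) (a : ℤ)
    (h : M.ShowsNonwhite a ∧ M.IsInner a := by decide) : C.kind (ι a) ≠ Kind.white := by
  obtain ⟨⟨b, hb, rfl | rfl⟩ | ⟨c, hc, ⟨rfl, h'⟩ | ⟨rfl, h'⟩⟩, hi⟩ := h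
  · rw [E.blank a hb]
    simp
  · have hi' : b ∈ M.inner := by simpa using neg_mem_inner hi
    rw [← E.edge b hi', (C.blank_inv _).2 (E.blank b hb)]
    simp
  · rwa [(E.cut c hc).1]
  · rwa [(E.cut c hc).2.1]

/-- If `-b` is followed by `a` along a polygon, then `b` is the next dart counterclockwise around
the origin of `a`. -/
theorem turn_eq (E : M.Embeds o C ι) (a b : ℤ)
    (h : (∃ w ∈ M.faces, (-b, a) ∈ w.zip (w.rotate 1)) ∧ M.IsInner b ∧ M.ShowsCut b :=
      by decide) :
    C.turn (ι a) = ι b := by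
  obtain ⟨⟨w, hw, hwa⟩, hi, hc⟩ := h
  have h1 : C.rot (ι a) = ι b := by
    have h2 : C.next.symm (ι a) = ι (-b) := by
      rw [Equiv.symm_apply_eq]
      exact (E.face w hw _ hwa).symm
    have h3 := E.edge (-b) (neg_mem_inner hi)
    rw [neg_neg] at h3
    rw [SphereCells.rot_apply, h2, h3]
  rw [C.turn_eq_rot (by rw [h1]; exact E.isCut b ⟨hc, hi⟩), h1]

theorem label_neg (E : M.Embeds o C ι) (a : ℤ)
    (h : M.ShowsCut a ∧ M.IsInner a := by decide) : C.label (ι (-a)) = C.label (ι a) := by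
  rw [← E.inv_eq a h.2, C.label_inv _ (E.isCut a h)]

end CutDiagram

section BasedCutDiagram

variable {C : BasedCutDiagram n} {ι : ℤ → C.Dart} {i : Fin n} {v : C.Region → Color i}

theorem value_eq (E : M.Embeds o C.toCutDiagram ι) (v : C.Region → Color i) (a b : ℤ)
    (h : M.SameFace a b := by decide) : v (C.reg (ι a)) = v (C.reg (ι b)) := by
  obtain ⟨w, hw, ha, hb⟩ := h
  rw [E.reg_eq hw ha hb]

theorem value_neg (E : M.Embeds o C.toCutDiagram ι) (hv : C.IsFraming i v) (a : ℤ)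
    (h : M.ShowsCut a ∧ M.IsInner a := by decide) : v (C.reg (ι (-a))) =
      (v (C.reg (ι a))).act (C.colorLetter (fun R => (v R).mer) (ι a)) := by
  rw [← hv.cut _ (E.isCut a h), E.inv_eq a h.2]

theorem value_neg_of_blank (E : M.Embeds o C.toCutDiagram ι) (v : C.Region → Color i) (a : ℤ)
    (h : a ∈ M.blanks ∧ M.IsInner a := by decide) : v (C.reg (ι (-a))) = v (C.reg (ι a)) := by
  rw [← C.reg_inv _ (E.blank a h.1), E.inv_eq a h.2]

theorem letter_neg (E : M.Embeds o C.toCutDiagram ι) (v : C.Region → Color i) (a : ℤ)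
    (h : M.ShowsCut a ∧ M.IsInner a := by decide) :
    C.colorLetter (fun R => (v R).mer) (ι (-a)) =
      (C.colorLetter (fun R => (v R).mer) (ι a))⁻¹ := by
  rw [← E.inv_eq a h.2, C.colorLetter_inv _ (E.isCut a h)]

theorem finsum_inner_eq_zero' (E : M.Embeds o C.toCutDiagram ι) (v : C.Region → Color i)
    (h : ∀ a ∈ M.faces.flatten, -a ∈ M.faces.flatten → M.ShowsNonwhite a) :
    ∑ᶠ p ∈ C.whiteDots i ∩ ι '' M.inner, BasedCutDiagram.dotTerm v p = 0 :=
  finsum_inner_eq_zero v fun a ha => E.kind_ne_white a ⟨h a ha.1 ha.2, ha⟩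

/-- Only the white dots contribute to the sum over the darts of the patch. -/
theorem finsum_inner_of_nonwhite (E : M.Embeds o C.toCutDiagram ι) (v : C.Region → Color i)
    (S : Finset ℤ) (h : (∀ a ∈ S, M.IsInner a) ∧ ∀ a ∈ M.faces.flatten, -a ∈ M.faces.flatten →
      a ∈ S ∨ M.ShowsNonwhite a := by decide) :
    ∑ᶠ p ∈ C.whiteDots i ∩ ι '' M.inner, BasedCutDiagram.dotTerm v p =
      ∑ a ∈ S, if C.kind (ι a) = Kind.white ∧ C.comp (ι a) = i then
        BasedCutDiagram.dotTerm v (ι a) else 0 := by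
  have hS : ∀ a, a ∈ M.inner ↔ a ∈ M.faces.flatten.toFinset.filter (M.IsInner ·) := by
    intro a
    rw [Finset.mem_filter, List.mem_toFinset]
    exact ⟨fun ha => ⟨ha.1, ha⟩, fun ha => ha.2⟩
  rw [E.finsum_inner v _ hS]
  refine (Finset.sum_subset (fun a ha => (hS a).1 (h.1 a ha)) fun a ha haS =>
    if_neg fun hw => ?_).symm
  have hi := (hS a).2 ha
  exact E.kind_ne_white a ⟨(h.2 a hi.1 hi.2).resolve_left haS, hi⟩ hw.1

end BasedCutDiagram

end Embeds
end Patch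

/-- Darts with the same direction and label have the same letter. -/
theorem CutDiagram.colorLetter_congr {C : CutDiagram n} {K : Type*} [Group K] (c : C.Region → K)
    {d e : C.Dart} (h1 : C.dir d = C.dir e) (h2 : C.label d = C.label e) :
    C.colorLetter c d = C.colorLetter c e := by
  unfold CutDiagram.colorLetter
  rw [h1, h2]

namespace Move

open BasedCutDiagram

/-- A framing of the diagram after the move comes from a framing of the diagram before the move,
with the same sum over the white dots. -/
def Transfers (M : Move) : Prop :=
  ∀ ⦃n : ℕ⦄ ⦃C C' : BasedCutDiagram n⦄ ⦃o : ℕ → Bool⦄ ⦃ι : ℤ → C.Dart⦄ ⦃ι' : ℤ → C'.Dart⦄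
    ⦃θ : C.Dart → C'.Dart⦄ ⦃i : Fin n⦄ ⦃v' : C'.Region → Color i⦄, M.Connects C C' o ι ι' θ →
    C'.IsFraming i v' → ∃ v, C.IsFraming i v ∧
      ∑ᶠ p ∈ C.whiteDots i, dotTerm v p = ∑ᶠ p ∈ C'.whiteDots i, dotTerm v' p

namespace Connects

variable {M : Move} {C C' : BasedCutDiagram n} {o : ℕ → Bool} {ι : ℤ → C.Dart} {ι' : ℤ → C'.Dart}
  {θ : C.Dart → C'.Dart} {i : Fin n} {v : C.Region → Color i} {v' : C'.Region → Color i}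

theorem letter_eq (H : M.Connects C C' o ι ι' θ) (hA : Agree M ι θ v v') (a b : ℤ)
    (h : (a, b) ∈ M.track ∧ M.before.ShowsCut a ∧ M.before.IsInner a := by decide) :
    C.colorLetter (fun R => (v R).mer) (ι a) = C'.colorLetter (fun R => (v' R).mer) (ι' b) :=
  (H.colorLetter_eq hA (tracked_of_mem h.1) (H.embeds.isCut a h.2)).symm

/-- Construction of a framing before the move. -/
theorem exists_isFraming_of_cuts (H : M.Connects C C' o ι ι' θ) (hv' : C'.IsFraming i v')
    (u : ℤ → Color i)
    (hface : ∀ w ∈ M.before.faces, ∀ a ∈ w, ∀ b ∈ w, u a = u b)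
    (hbd : ∀ a ∈ M.before.faces.flatten, -a ∉ M.before.faces.flatten →
      u a = v' (C'.reg (ι' a)))
    (hcut : ∀ v : C.Region → Color i, Agree M ι θ v v' →
      (∀ a ∈ M.before.faces.flatten, v (C.reg (ι a)) = u a) →
      (∀ d ∈ M.before.kept C.toCutDiagram ι, C.IsCut d →
        v (C.reg (C.inv d)) = (v (C.reg d)).act (C.colorLetter (fun R => (v R).mer) d)) →
      ∀ c ∈ M.before.cuts,
        u (-c.1) = (u c.1).act (C.colorLetter (fun R => (v R).mer) (ι c.1)))
    (hinner : ∀ a ∈ M.before.faces.flatten, -a ∈ M.before.faces.flatten →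
      M.before.ShowsCut a := by decide) :
    ∃ v, C.IsFraming i v ∧ Agree M ι θ v v' ∧
      ∀ a ∈ M.before.faces.flatten, v (C.reg (ι a)) = u a := by
  refine H.exists_isFraming hv' u hface (fun a ha ha' => hbd a ha fun h => ha' ⟨ha, h⟩)
    (fun a ha h => ?_) fun v hA hp hk a ha _ => ?_
  · exact absurd h (H.embeds.isCut a ⟨hinner a ha.1 ha.2, ha⟩)
  · obtain ⟨c, hc, ⟨rfl, h'⟩ | ⟨rfl, h'⟩⟩ := hinner a ha.1 ha.2
    · exact hcut v hA hp hk c hc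
    · have hi : M.before.ShowsCut c.1 ∧ M.before.IsInner c.1 :=
        ⟨⟨c, hc, Or.inl ⟨rfl, h'⟩⟩, by have := Patch.neg_mem_inner ha; rwa [neg_neg] at this⟩
      rw [neg_neg, H.embeds.letter_neg v c.1 hi, hcut v hA hp hk c hc, Color.act_act_inv]

/-- Only the white dots in the disks after the move matter if there are none before the move and
if the ends of the strands are no white dots. -/
theorem finsum_eq_of_nonwhite (H : M.Connects C C' o ι ι' θ) (hA : Agree M ι θ v v')
    (hin : ∑ᶠ p ∈ C'.whiteDots i ∩ ι' '' M.after.inner, dotTerm v' p = 0)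
    (h : (∀ a ∈ M.before.faces.flatten, -a ∈ M.before.faces.flatten →
      M.before.ShowsNonwhite a) ∧ (∀ p ∈ M.track ++ M.dots, M.before.IsInner p.1) := by decide) :
    ∑ᶠ p ∈ C.whiteDots i, dotTerm v p = ∑ᶠ p ∈ C'.whiteDots i, dotTerm v' p := by
  refine H.finsum_eq hA (fun p hp hw => ?_) ?_
  · have hi := h.2 p hp
    exact absurd hw (H.embeds.kind_ne_white p.1 ⟨h.1 _ hi.1 hi.2, hi⟩)
  · rw [H.embeds.finsum_inner_eq_zero' v h.1, hin]

end Connects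

/-- A move without white dots transfers sums as soon as it transfers framings. -/
theorem transfers_of_framing {M : Move}
    (hM : ∀ ⦃n : ℕ⦄ ⦃C C' : BasedCutDiagram n⦄ ⦃o : ℕ → Bool⦄ ⦃ι : ℤ → C.Dart⦄ ⦃ι' : ℤ → C'.Dart⦄
      ⦃θ : C.Dart → C'.Dart⦄ ⦃i : Fin n⦄ ⦃v' : C'.Region → Color i⦄, M.Connects C C' o ι ι' θ →
      C'.IsFraming i v' → ∃ v, C.IsFraming i v ∧ Connects.Agree M ι θ v v')
    (h : (∀ a ∈ M.before.faces.flatten, -a ∈ M.before.faces.flatten →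
      M.before.ShowsNonwhite a) ∧ (∀ p ∈ M.track ++ M.dots, M.before.IsInner p.1) := by decide)
    (h' : ∀ a ∈ M.after.faces.flatten, -a ∈ M.after.faces.flatten →
      M.after.ShowsNonwhite a := by decide) : M.Transfers := by
  intro n C C' o ι ι' θ i v' H hv'
  obtain ⟨v, hv, hA⟩ := hM H hv'
  exact ⟨v, hv, H.finsum_eq_of_nonwhite hA (H.embeds'.finsum_inner_eq_zero' v' h') h⟩

/-! ## Topological moves -/

theorem transfers_moveIso : moveIso.Transfers := by
  refine transfers_of_framing fun n C C' o ι ι' θ i v' H hv' => ?_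
  obtain ⟨v, hv, hA, -⟩ := H.exists_isFraming_of_cuts hv' (fun a => v' (C'.reg (ι' a)))
    (by simp [moveIso]) (by simp [moveIso]) (by simp [moveIso])
  exact ⟨v, hv, hA⟩

theorem transfers_moveArc : moveArc.Transfers := by
  refine transfers_of_framing fun n C C' o ι ι' θ i v' H hv' => ?_
  obtain ⟨v, hv, hA, -⟩ := H.exists_isFraming_of_cuts hv' (fun a => v' (C'.reg (ι' a)))
    (by simp [moveArc]) (by simp [moveArc]) (by simp [moveArc])
  exact ⟨v, hv, hA⟩

theorem transfers_moveCircle : moveCircle.Transfers := by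
  refine transfers_of_framing fun n C C' o ι ι' θ i v' H hv' => ?_
  obtain ⟨v, hv, hA, -⟩ := H.exists_isFraming_of_cuts hv' (fun a => v' (C'.reg (ι' a)))
    (by simp [moveCircle]) (by simp [moveCircle]) (by simp [moveCircle])
  exact ⟨v, hv, hA⟩

/-- The middle polygon before the move joins two regions that are separated after it. Both are
reached from one region across the two new arcs, which have the same letter, so their colors agree.
-/
theorem transfers_moveSaddle : moveSaddle.Transfers := by
  refine transfers_of_framing fun n C C' o ι ι' θ i v' H hv' => ?_
  have E := H.embeds'
  let W : ℤ → Color i := fun a => v' (C'.reg (ι' a))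
  have e78 : C'.colorLetter (fun R => (v' R).mer) (ι' 7) =
      C'.colorLetter (fun R => (v' R).mer) (ι' 8) :=
    C'.colorLetter_congr _ ((E.cut (7, 0, Kind.reg, Kind.reg) (by decide)).2.2.trans
      (E.cut (8, 0, Kind.reg, Kind.reg) (by decide)).2.2.symm) (E.same (7, 8) (by decide))
  have h7 := E.value_neg hv' 7
  have h8 := E.value_neg hv' 8
  have f1 := E.value_eq v' (-7) 1
  have f2 := E.value_eq v' 7 4
  have f3 := E.value_eq v' 2 4
  have f4 := E.value_eq v' 8 4
  have f5 := E.value_eq v' (-8) 3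
  rw [f1, f2] at h7
  rw [f5, f4, ← e78, ← h7] at h8
  obtain ⟨v, hv, hA, -⟩ := H.exists_isFraming_of_cuts hv'
    (fun a => if a ∈ [-5, 1, -6, 3] then W 1 else W 4)
    (by simp [moveSaddle]) (by simp [moveSaddle, W, f3, h8]) (by
      intro v hA _ _
      have t5 := H.letter_eq hA 5 7
      have t6 := H.letter_eq hA 6 8
      simp [moveSaddle, W, t5, t6, ← e78, h7])
  exact ⟨v, hv, hA⟩

end Move
end KirkCut

/-! ### Kinks, Reidemeister 2, crossing changes, moves of black dots and cusps -/

namespace KirkCut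

variable {n : ℕ}

namespace Move

open BasedCutDiagram

/-- Outside the loop the strand still separates the same two regions, and its first end already
gives the relation between their colors. -/
theorem transfers_moveKink (l f : Bool) : (moveKink l f).Transfers := by
  refine transfers_of_framing (fun n C C' o ι ι' θ i v' H hv' => ?_)
    (by cases l <;> cases f <;> decide) (by cases l <;> cases f <;> decide)
  have E := H.embeds'
  let W : ℤ → Color i := fun a => v' (C'.reg (ι' a))
  have h3 := E.value_neg hv' 3 (by cases l <;> cases f <;> decide)
  have f1 := E.value_eq v' 3 1 (by cases l <;> cases f <;> decide)
  have f2 := E.value_eq v' (-3) 2 (by cases l <;> cases f <;> decide)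
  obtain ⟨v, hv, hA, -⟩ := H.exists_isFraming_of_cuts hv'
    (fun a => if a ∈ [3, 1] then W 1 else W 2)
    (by simp [moveKink]) (by simp [moveKink, W]) (by
      intro v hA _ _
      have t3 := H.letter_eq hA 3 3 (by cases l <;> cases f <;> decide)
      simp [moveKink, W, t3, ← f1, ← f2, h3]) (by cases l <;> cases f <;> decide)
  exact ⟨v, hv, hA⟩

/-- The over-strand keeps its label through both crossings, so its two ends have the same letter;
the regions at its two ends that become one before the move have equal colors. -/
theorem transfers_moveR2 : moveR2.Transfers := by
  refine transfers_of_framing fun n C C' o ι ι' θ i v' H hv' => ?_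
  have E := H.embeds'
  let W : ℤ → Color i := fun a => v' (C'.reg (ι' a))
  have s1 := C'.over_strand _ (E.kind_eq (a := -5) (k := Kind.upper))
  rw [E.turn_eq (-5) (-6), E.turn_eq (-6) 7] at s1
  have s2 := C'.over_strand _ (E.kind_eq (a := -7) (k := Kind.upper))
  rw [E.turn_eq (-7) 10, E.turn_eq 10 8] at s2
  have e58 : C'.colorLetter (fun R => (v' R).mer) (ι' 8) =
      C'.colorLetter (fun R => (v' R).mer) (ι' 5) :=
    C'.colorLetter_congr _ ((E.cut (8, 0, Kind.upper, Kind.reg) (by decide)).2.2.trans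
      (E.cut (5, 0, Kind.reg, Kind.upper) (by decide)).2.2.symm)
      (s2.2.2.2.2.2.trans ((E.label_neg 7).trans (s1.2.2.2.2.2.trans (E.label_neg 5))))
  have h5 := E.value_neg hv' 5
  have h6 := E.value_neg hv' 6
  have h8 := E.value_neg hv' 8
  rw [E.value_eq v' (-5) 1, E.value_eq v' 5 4] at h5
  rw [E.value_eq v' (-8) 3, E.value_eq v' 8 4, e58, ← h5] at h8
  rw [E.value_eq v' (-6) 2, E.value_eq v' 6 1] at h6
  obtain ⟨v, hv, hA, -⟩ := H.exists_isFraming_of_cuts hv'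
    (fun a => if a ∈ [-5, 1, 6, 3] then W 1 else if a ∈ [5, 4] then W 4 else W 2)
    (by simp [moveR2]) (by simp [moveR2, W, h8]) (by
      intro v hA _ _
      have t5 := H.letter_eq hA 5 5
      have t6 := H.letter_eq hA 6 6
      simp [moveR2, W, t5, t6, h5, h6])
  exact ⟨v, hv, hA⟩

/-- The four regions and the letters of the four strand ends are the same on both sides, so the same
colors work. -/
theorem transfers_moveCrossingChange : moveCrossingChange.Transfers := by
  refine transfers_of_framing fun n C C' o ι ι' θ i v' H hv' => ?_
  have E := H.embeds'
  let W : ℤ → Color i := fun a => v' (C'.reg (ι' a))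
  have h5 := E.value_neg hv' 5
  have h6 := E.value_neg hv' 6
  have h7 := E.value_neg hv' 7
  have h8 := E.value_neg hv' 8
  rw [E.value_eq v' (-5) 4, E.value_eq v' 5 3] at h5
  rw [E.value_eq v' (-6) 1, E.value_eq v' 6 2] at h6
  rw [E.value_eq v' (-7) 3, E.value_eq v' 7 2] at h7
  rw [E.value_eq v' (-8) 4, E.value_eq v' 8 1] at h8
  obtain ⟨v, hv, hA, -⟩ := H.exists_isFraming_of_cuts hv'
    (fun a => if a ∈ [1, -6, 8] then W 1 else if a ∈ [2, 7, 6] then W 2 else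
      if a ∈ [3, 5, -7] then W 3 else W 4)
    (by simp [moveCrossingChange]) (by simp [moveCrossingChange, W]) (by
      intro v hA _ _
      have t5 := H.letter_eq hA 5 5
      have t6 := H.letter_eq hA (-6) (-6)
      have t7 := H.letter_eq hA 7 7
      have t8 := H.letter_eq hA (-8) (-8)
      rw [H.embeds.letter_neg v 6, E.letter_neg v' 6, inv_inj] at t6
      rw [H.embeds.letter_neg v 8, E.letter_neg v' 8, inv_inj] at t8
      simp only [moveCrossingChange, t5, t6, t7, t8, List.forall_mem_cons]
      exact ⟨h5, h6, h7, h8, by simp⟩)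
  exact ⟨v, hv, hA⟩

theorem Connects.regionComp_label_black {M : Move} {C C' : BasedCutDiagram n} {o : ℕ → Bool}
    {ι : ℤ → C.Dart} {ι' : ℤ → C'.Dart} {θ : C.Dart → C'.Dart} (H : M.Connects C C' o ι ι' θ)
    (a c : ℤ)
    (h : M.before.ShowsCut a ∧ M.before.IsInner a ∧ M.before.HasKind (-a) Kind.black ∧
      (a, a) ∈ M.track ∧ M.before.SameFace (-a) c ∧ ¬ M.before.IsInner c ∧
      M.after.SameFace a c := by decide) :
    C'.regionComp (C'.reg (ι' a)) = C'.regionComp (C'.label (ι' a)) := by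
  obtain ⟨h1, h2, h3, h4, ⟨w, hw, haw, hcw⟩, h6, ⟨w', hw', haw', hcw'⟩⟩ := h
  have hb := C.rule_black _ (H.embeds.kind_eq h3)
  rw [H.embeds.label_neg a ⟨h1, h2⟩, H.embeds.reg_eq hw haw hcw] at hb
  rw [H.regionComp_label (tracked_of_mem h4) (H.embeds.isCut a ⟨h1, h2⟩), hb,
    H.embeds'.reg_eq hw' haw' hcw']
  exact H.comp_boundary (Patch.mem_darts.2 ⟨w, hw, hcw⟩) h6

/-- The arc at the black dot is labeled by a region of its own component. Its letter acts trivially,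
so the regions on both of its sides have one color. -/
theorem transfers_moveSlide : moveSlide.Transfers := by
  refine transfers_of_framing fun n C C' o ι ι' θ i v' H hv' => ?_
  have E := H.embeds'
  let W : ℤ → Color i := fun a => v' (C'.reg (ι' a))
  have hl := hv'.act_letter (H.regionComp_label_black 5 2)
  have h4 := E.value_neg hv' 4
  have h5 := E.value_neg hv' 5
  rw [hl, E.value_eq v' (-5) 3, E.value_eq v' 5 2] at h5
  rw [E.value_eq v' 5 2] at hl
  rw [E.value_eq v' (-4) 1, E.value_eq v' 4 3, h5] at h4
  obtain ⟨v, hv, hA, -⟩ := H.exists_isFraming_of_cuts hv'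
    (fun a => if a ∈ [-4, 1] then W 1 else W 2)
    (by simp [moveSlide]) (by simp [moveSlide, W, h5]) (by
      intro v hA _ _
      have t4 := H.letter_eq hA 4 4
      have t5 := H.letter_eq hA 5 5
      simp [moveSlide, W, t4, t5, h4, hl])
  exact ⟨v, hv, hA⟩

theorem transfers_moveFuse : moveFuse.Transfers := by
  refine transfers_of_framing fun n C C' o ι ι' θ i v' H hv' => ?_
  have E := H.embeds'
  let W : ℤ → Color i := fun a => v' (C'.reg (ι' a))
  have hl := hv'.act_letter (H.regionComp_label_black 3 2)
  have h3 := E.value_neg hv' 3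
  rw [hl, E.value_eq v' (-3) 1, E.value_eq v' 3 2] at h3
  rw [E.value_eq v' 3 2] at hl
  obtain ⟨v, hv, hA, -⟩ := H.exists_isFraming_of_cuts hv' (fun a => W 2)
    (by simp [moveFuse]) (by simp [moveFuse, W, h3]) (by
      intro v hA _ _
      have t3 := H.letter_eq hA 3 3
      have t4 := H.letter_eq hA (-4) (-3)
      rw [H.embeds.letter_neg v 4, E.letter_neg v' 3, inv_inj] at t4
      simp [moveFuse, W, t3, t4, hl])
  exact ⟨v, hv, hA⟩

/-- The two new paired dots lie in the same region, so the group element of the pair is trivial and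
the pair contributes nothing. -/
theorem transfers_moveCusp : moveCusp.Transfers := by
  intro n C C' o ι ι' θ i v' H hv'
  have E := H.embeds'
  let W : ℤ → Color i := fun a => v' (C'.reg (ι' a))
  have h3 := E.value_neg hv' 3
  rw [E.value_eq v' (-3) 1, E.value_eq v' 3 1] at h3
  obtain ⟨v, hv, hA, -⟩ := H.exists_isFraming_of_cuts hv' (fun a => W 1)
    (by simp [moveCusp]) (by simp [moveCusp, W]) (by
      intro v hA _ _
      have t3 := H.letter_eq hA 3 3
      simpa [moveCusp, W, t3] using h3)
  refine ⟨v, hv, H.finsum_eq_of_nonwhite hA ?_⟩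
  have p1 := E.pair (-3, -4) (by decide)
  have p2 := (C'.rule_white _ (E.kind_eq (a := -3) (k := Kind.white))).2.1
  dsimp only at p1
  rw [p1] at p2
  have t3 : dotTerm v' (ι' (-3)) = 0 := by
    rw [dotTerm, p1, E.value_eq v' (-4) (-3), mul_inv_cancel, posPart_one, map_one, sub_self,
      smul_zero]
  have t4 : dotTerm v' (ι' (-4)) = 0 := by
    rw [dotTerm, p2, E.value_eq v' (-4) (-3), mul_inv_cancel, posPart_one, map_one, sub_self,
      smul_zero]
  rw [E.finsum_inner_of_nonwhite v' {-3, -4}]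
  simp [t3, t4]

end Move
end KirkCut

/-! ### Changes of the cell decomposition and finger moves -/

namespace KirkCut

variable {n : ℕ}

namespace BasedCutDiagram

variable {C : BasedCutDiagram n} {i : Fin n}

theorem dotTerm_add_eq_zero (v : C.Region → Color i) {p q : C.Dart} (h : C.reg p = C.reg q)
    (h' : C.reg (C.pair p) = C.reg (C.pair q)) (hd : C.dir p = !(C.dir q)) :
    dotTerm v p + dotTerm v q = 0 := by
  rw [dotTerm, dotTerm, h, h', dotSign, dotSign, hd, ← add_smul]
  cases C.dir q <;> simp

theorem ite_dotTerm_add_eq_zero (v : C.Region → Color i) {p q : C.Dart} (h : C.reg p = C.reg q)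
    (h' : C.reg (C.pair p) = C.reg (C.pair q)) (hd : C.dir p = !(C.dir q))
    (hk : C.kind p = C.kind q) :
    (if C.kind p = Kind.white ∧ C.comp p = i then dotTerm v p else 0) +
      (if C.kind q = Kind.white ∧ C.comp q = i then dotTerm v q else 0) = 0 := by
  have hc : C.comp p = C.comp q := by
    rw [← C.regionComp_reg, h, C.regionComp_reg]
  rw [hk, hc]
  split_ifs
  · exact dotTerm_add_eq_zero v h h' hd
  · exact add_zero 0

end BasedCutDiagram

namespace Move

open BasedCutDiagram

theorem mem_moveSplit_before {a b : ℕ} {x : ℤ} :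
    x ∈ (moveSplit a b).before.faces.flatten ↔ ∃ k < a + b, (k : ℤ) + 1 = x := by
  simp [moveSplit]

theorem transfers_moveSplit (a b : ℕ) : (moveSplit a b).Transfers := by
  have hb : ∀ x ∈ (moveSplit a b).before.faces.flatten,
      -x ∉ (moveSplit a b).before.faces.flatten := by
    intro x hx hx'
    obtain ⟨k, -, rfl⟩ := mem_moveSplit_before.1 hx
    obtain ⟨l, -, hl⟩ := mem_moveSplit_before.1 hx'
    omega
  refine transfers_of_framing (fun n C C' o ι ι' θ i v' H hv' => ?_)
    ⟨fun x hx hx' => absurd hx' (hb x hx), by simp [moveSplit]⟩ ?_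
  · have E := H.embeds'
    let N : ℤ := ((a + b + 1 : ℕ) : ℤ)
    have hN : N ∈ (moveSplit a b).after.blanks ∧ (moveSplit a b).after.IsInner N := by
      simp [N, moveSplit, Patch.IsInner]
    -- Both sides of the new blank edge belong to one region, so all boundary darts of the polygon
    -- have the same color.
    have hall : ∀ x ∈ (moveSplit a b).before.faces.flatten,
        v' (C'.reg (ι' x)) = v' (C'.reg (ι' N)) := by
      intro x hx
      obtain ⟨k, hk, rfl⟩ := mem_moveSplit_before.1 hx
      by_cases hka : k < a
      · refine E.value_eq v' _ _ ⟨_, List.mem_cons_self, ?_, ?_⟩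
        · simp [hka]
        · simp [N]
      · rw [← E.value_neg_of_blank v' N hN]
        refine E.value_eq v' _ _ ⟨_, List.mem_cons_of_mem _ List.mem_cons_self, ?_, ?_⟩
        · have : ∃ l < b, a + l = k := ⟨k - a, by omega, by omega⟩
          obtain ⟨l, hl, rfl⟩ := this
          simp [hl]
        · simp [N]
    obtain ⟨v, hv, hA, -⟩ := H.exists_isFraming_of_cuts hv' (fun x => v' (C'.reg (ι' x)))
      (fun w hw x hx y hy => (hall x (List.mem_flatten_of_mem hw hx)).trans
        (hall y (List.mem_flatten_of_mem hw hy)).symm) (fun _ _ _ => rfl)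
      (by simp [moveSplit]) fun x hx hx' => absurd hx' (hb x hx)
    exact ⟨v, hv, hA⟩
  · intro x hx hx'
    refine Or.inl ⟨((a + b + 1 : ℕ) : ℤ), List.mem_singleton.2 rfl, ?_⟩
    have key : ∀ y ∈ (moveSplit a b).after.faces.flatten,
        0 < y ∨ y = -((a + b + 1 : ℕ) : ℤ) := by
      intro y hy
      simp [moveSplit] at hy
      rcases hy with ⟨k, -, rfl⟩ | rfl | rfl | ⟨k, -, rfl⟩ <;> push_cast <;> omega
    have h1 := key x hx
    have h2 := key _ hx'
    omega

/-- The dots on the interrupted strand lie in one region and their partners in another, with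
opposite signs. Hence the two pairs have the same group element and cancel. -/
theorem transfers_moveFinger : moveFinger.Transfers := by
  intro n C C' o ι ι' θ i v' H hv'
  have E := H.embeds'
  let W : ℤ → Color i := fun a => v' (C'.reg (ι' a))
  have h3 := E.value_neg hv' 3
  rw [E.value_eq v' (-3) 1, E.value_eq v' 3 2] at h3
  obtain ⟨v, hv, hA, -⟩ := H.exists_isFraming_of_cuts hv'
    (fun a => if a ∈ [3, 2] then W 2 else if a ∈ [-3, 1] then W 1 else W 11)
    (by simp [moveFinger]) (by simp [moveFinger, W]) (by
      intro v hA _ _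
      have t3 := H.letter_eq hA 3 3
      simpa [moveFinger, W, t3] using h3)
  refine ⟨v, hv, H.finsum_eq_of_nonwhite hA ?_⟩
  have p3 := E.pair (-3, -13) (by decide)
  have p4 := E.pair (4, 13) (by decide)
  dsimp only at p3 p4
  have k3 := E.kind_eq (a := -3) (k := Kind.white)
  have k4 := E.kind_eq (a := 4) (k := Kind.white)
  have k13 := E.kind_eq (a := 13) (k := Kind.white)
  have k13' := E.kind_eq (a := -13) (k := Kind.white)
  have p3' := (C'.rule_white _ k3).2.1
  have p4' := (C'.rule_white _ k4).2.1
  rw [p3] at p3'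
  rw [p4] at p4'
  have d3 := (E.cut (3, 0, Kind.reg, Kind.white) (by decide)).2.2
  have d4 := (E.cut (4, 0, Kind.white, Kind.reg) (by decide)).2.2
  have d3' := C'.dir_inv _ (E.isCut 3)
  have d13' := C'.dir_inv _ (E.isCut 13)
  rw [E.inv_eq 3] at d3'
  rw [E.inv_eq 13] at d13'
  have r1 : C'.reg (ι' (-3)) = C'.reg (ι' 4) :=
    E.reg_eq (w := [1, -4, 4, 2, 3, -3]) (by decide) (by decide) (by decide)
  have r2 : C'.reg (ι' (-13)) = C'.reg (ι' 13) :=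
    E.reg_eq (w := [11, 12, 13, -13, -12]) (by decide) (by decide) (by decide)
  have z1 := ite_dotTerm_add_eq_zero v' r1 (by rw [p3, p4, r2]) (by rw [d3', d3, d4])
    (k3.trans k4.symm)
  have z2 := ite_dotTerm_add_eq_zero v' r2 (by rw [p3', p4', r1]) d13' (k13'.trans k13.symm)
  rw [E.finsum_inner_of_nonwhite v' {-3, 4, -13, 13}, Finset.sum_insert (by decide),
    Finset.sum_insert (by decide), Finset.sum_insert (by decide), Finset.sum_singleton,
    ← add_assoc, z1, zero_add, z2]

theorem transfers_moveFinger' : moveFinger'.Transfers := by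
  intro n C C' o ι ι' θ i v' H hv'
  have E := H.embeds'
  obtain ⟨v, hv, hA, -⟩ := H.exists_isFraming_of_cuts hv' (fun a => v' (C'.reg (ι' a)))
    (by simp [moveFinger']) (by simp [moveFinger']) (by simp [moveFinger'])
  refine ⟨v, hv, H.finsum_eq_of_nonwhite hA ?_⟩
  have p3 := E.pair (3, 13) (by decide)
  have p3' := E.pair (-3, -13) (by decide)
  dsimp only at p3 p3'
  have k3 := E.kind_eq (a := 3) (k := Kind.white)
  have k3' := E.kind_eq (a := -3) (k := Kind.white)
  have k13 := E.kind_eq (a := 13) (k := Kind.white)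
  have k13' := E.kind_eq (a := -13) (k := Kind.white)
  have p13 := (C'.rule_white _ k3).2.1
  have p13' := (C'.rule_white _ k3').2.1
  rw [p3] at p13
  rw [p3'] at p13'
  have d3' := C'.dir_inv _ (E.isCut 3)
  have d13' := C'.dir_inv _ (E.isCut 13)
  rw [E.inv_eq 3] at d3'
  rw [E.inv_eq 13] at d13'
  have r1 : C'.reg (ι' (-3)) = C'.reg (ι' 3) :=
    E.reg_eq (w := [1, 2, 3, -3, -2]) (by decide) (by decide) (by decide)
  have r2 : C'.reg (ι' (-13)) = C'.reg (ι' 13) :=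
    E.reg_eq (w := [11, 12, 13, -13, -12]) (by decide) (by decide) (by decide)
  have z1 := ite_dotTerm_add_eq_zero v' r1 (by rw [p3, p3', r2]) d3' (k3'.trans k3.symm)
  have z2 := ite_dotTerm_add_eq_zero v' r2 (by rw [p13, p13', r1]) d13' (k13'.trans k13.symm)
  rw [E.finsum_inner_of_nonwhite v' {-3, 3, -13, 13}, Finset.sum_insert (by decide),
    Finset.sum_insert (by decide), Finset.sum_insert (by decide), Finset.sum_singleton,
    ← add_assoc, z1, zero_add, z2]

namespace Connects

variable {M : Move} {C C' : BasedCutDiagram n} {o : ℕ → Bool} {ι : ℤ → C.Dart} {ι' : ℤ → C'.Dart}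
  {θ : C.Dart → C'.Dart} {i : Fin n} {v : C.Region → Color i} {v' : C'.Region → Color i}

theorem comp_eq (H : M.Connects C C' o ι ι' θ) (a b c : ℤ)
    (h : M.before.SameFace a c ∧ M.after.SameFace b c ∧ ¬ M.before.IsInner c := by decide) :
    C'.comp (ι' b) = C.comp (ι a) := by
  obtain ⟨⟨w, hw, haw, hcw⟩, ⟨w', hw', hbw', hcw'⟩, h6⟩ := h
  rw [← C.regionComp_reg, ← C'.regionComp_reg, H.embeds.reg_eq hw haw hcw,
    H.embeds'.reg_eq hw' hbw' hcw']
  exact H.comp_boundary (Patch.mem_darts.2 ⟨w, hw, hcw⟩) h6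

/-- A version for arcs that have no counterpart after the move: their label still has a dart outside
the disks, where the colors are compared. -/
theorem act_letter (H : M.Connects C C' o ι ι' θ) (hv' : C'.IsFraming i v') (hA : Agree M ι θ v v')
    {d : C.Dart} (hd : C.IsCut d) {R : C'.Region}
    (h : C'.regionComp R = C.regionComp (C.label d)) :
    (v' R).act (C.colorLetter (fun R => (v R).mer) d) = v' R := by
  obtain ⟨e, he, her⟩ := H.label d hd
  have h1 : C'.regionComp R = C'.regionComp (C'.reg (θ e)) := by
    rw [h, ← her, C.regionComp_reg, C'.regionComp_reg, H.comp e he]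
  have h2 := hv'.act_mer h1
  rw [← hA e he, her] at h2
  unfold CutDiagram.colorLetter
  split_ifs
  · conv_lhs => rw [← h2]
    rw [Color.act_act_inv]
  · exact h2

end Connects

theorem transfers_moveSubdivide : moveSubdivide.Transfers := by
  intro n C C' o ι ι' θ i v' H hv'
  have E := H.embeds'
  let W : ℤ → Color i := fun a => v' (C'.reg (ι' a))
  have T1 : Connects.Tracked moveSubdivide ι ι' θ (ι 3) (ι' 3) :=
    Connects.tracked_of_mem (p := (3, 3)) (by decide)
  have T2 : Connects.Tracked moveSubdivide ι ι' θ (ι (-3)) (ι' (-4)) :=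
    Connects.tracked_of_mem (p := (-3, -4)) (by decide)
  have hin : ∀ a, a ∈ moveSubdivide.before.inner ↔ a ∈ ({3, -3} : Finset ℤ) := by
    simp [Patch.inner, Patch.darts, moveSubdivide]
    omega
  have hin' : ∀ a, a ∈ moveSubdivide.after.inner ↔ a ∈ ({3, -4, -3, 4} : Finset ℤ) := by
    simp [Patch.inner, Patch.darts, moveSubdivide]
    omega
  have f3 := E.value_eq v' 3 1
  have f3' := E.value_eq v' (-3) 2
  have f4 := E.value_eq v' 4 1
  have f4' := E.value_eq v' (-4) 2
  obtain ⟨v, hv, hA, hp⟩ := H.exists_isFraming hv' (fun a => if a ∈ [3, 1] then W 1 else W 2)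
    (by simp [moveSubdivide]) (by simp [Patch.inner, Patch.darts, moveSubdivide, W]) (by
      have key : C.kind (ι 3) = Kind.blank → W 2 = W 1 := by
        intro h
        have h' : C'.kind (ι' 3) = Kind.blank := (H.kind _ _ T1).1.trans h
        change v' _ = v' _
        rw [← f3, ← f3', ← C'.reg_inv _ h', E.inv_eq 3]
      intro a ha h
      rw [hin] at ha
      simp only [Finset.mem_insert, Finset.mem_singleton] at ha
      rcases ha with rfl | rfl
      · simpa using key h
      · rw [← H.embeds.inv_eq 3] at h
        simpa using (key ((C.blank_inv _).1 h)).symm) (by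
      intro v hA _ _ a ha h
      rw [hin] at ha
      simp only [Finset.mem_insert, Finset.mem_singleton] at ha
      rcases ha with rfl | rfl
      · have := hv'.cut _ ((H.isCut_iff T1).2 h)
        rw [E.inv_eq 3, f3, f3', H.colorLetter_eq hA T1 h] at this
        simpa using this
      · have := hv'.cut _ ((H.isCut_iff T2).2 h)
        rw [E.inv_eq (-4), neg_neg, f4, f4', H.colorLetter_eq hA T2 h] at this
        simpa using this)
  have ht : ∀ p ∈ moveSubdivide.track ++ moveSubdivide.dots,
      v (C.reg (ι p.1)) = v' (C'.reg (ι' p.2)) := by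
    have h3 := hp 3 (by simp [Patch.darts, moveSubdivide])
    have h3' := hp (-3) (by simp [Patch.darts, moveSubdivide])
    simp [moveSubdivide, h3, h3', f3, f4', W]
  refine ⟨v, hv, H.finsum_eq hA (fun p hp _ _ => ht p hp) ?_⟩
  classical
  have e1 : C'.rot (ι' (-3)) = ι' 4 := by
    have : C'.next (ι' (-4)) = ι' (-3) := E.face [-4, -3, 2] (by decide) (-4, -3) (by decide)
    rw [SphereCells.rot_apply, ← this, Equiv.symm_apply_apply, E.inv_eq (-4), neg_neg]
  have e2 : C'.rot (ι' 4) = ι' (-3) := by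
    have : C'.next (ι' 3) = ι' 4 := E.face [3, 4, 1] (by decide) (3, 4) (by decide)
    rw [SphereCells.rot_apply, ← this, Equiv.symm_apply_apply, E.inv_eq 3]
  have hne : ι' (-3) ≠ ι' 4 := by
    intro h
    have := E.injOn (x₁ := -3) (x₂ := 4) (by simp [Patch.darts, moveSubdivide])
      (by simp [Patch.darts, moveSubdivide]) h
    omega
  have hcut : C'.IsCut (ι' (-3)) ↔ C'.IsCut (ι' 4) := by
    have h1 := C'.isCut_inv (d := ι' 3)
    have h2 := C'.isCut_inv (d := ι' (-4))
    have h3 := C.isCut_inv (d := ι 3)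
    rw [E.inv_eq 3, H.isCut_iff T1] at h1
    rw [E.inv_eq (-4), neg_neg, H.isCut_iff T2] at h2
    rw [H.embeds.inv_eq 3] at h3
    rw [h1, h2, h3]
  -- The new vertex has exactly two darts, cut or blank together, and rotation exchanges them;
  -- neither can be the only cut dart of a univalent vertex.
  have w3 : C'.kind (ι' (-3)) ≠ Kind.white := by
    intro h
    have h1 : C'.IsCut (ι' (-3)) := by
      unfold Drawing.IsCut
      simp [h]
    have h2 := C'.univalent _ (Or.inr h)
    rw [C'.turn_eq_rot (by rw [e1]; exact hcut.1 h1), e1] at h2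
    exact hne h2.symm
  have w4 : C'.kind (ι' 4) ≠ Kind.white := by
    intro h
    have h1 : C'.IsCut (ι' 4) := by
      unfold Drawing.IsCut
      simp [h]
    have h2 := C'.univalent _ (Or.inr h)
    rw [C'.turn_eq_rot (by rw [e2]; exact hcut.2 h1), e2] at h2
    exact hne h2
  have g : ∀ p ∈ moveSubdivide.track, C'.comp (ι' p.2) = C.comp (ι p.1) →
      (if C.kind (ι p.1) = Kind.white ∧ C.comp (ι p.1) = i then dotTerm v (ι p.1) else 0) =
      (if C'.kind (ι' p.2) = Kind.white ∧ C'.comp (ι' p.2) = i then dotTerm v' (ι' p.2) else 0) := by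
    intro p hpt hc
    have T := Connects.tracked_of_mem (ι := ι) (ι' := ι') (θ := θ) hpt
    rw [(H.kind _ _ T).1, hc]
    split_ifs with hw
    · exact (H.dotTerm_eq hA T hw.1 (ht p (List.mem_append_left _ hpt))
        fun p hp _ _ => ht p hp).symm
    · rfl
  have g1 := g (3, 3) (by decide) (H.comp_eq 3 3 1)
  have g2 := g (-3, -4) (by decide) (H.comp_eq (-3) (-4) 2)
  have n3 : (if C'.kind (ι' (-3)) = Kind.white ∧ C'.comp (ι' (-3)) = i then dotTerm v' (ι' (-3))
      else 0) = 0 := if_neg fun h => w3 h.1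
  have n4 : (if C'.kind (ι' 4) = Kind.white ∧ C'.comp (ι' 4) = i then dotTerm v' (ι' 4)
      else 0) = 0 := if_neg fun h => w4 h.1
  rw [H.embeds.finsum_inner v _ hin, E.finsum_inner v' _ hin', Finset.sum_insert (by decide),
    Finset.sum_singleton, Finset.sum_insert (by decide), Finset.sum_insert (by decide),
    Finset.sum_insert (by decide), Finset.sum_singleton, n3, n4, add_zero, add_zero]
  exact congrArg₂ _ g1 g2

end Move
end KirkCut

/-! ### The simultaneous slide of two paired white dots -/

namespace KirkCut

variable {n : ℕ}

namespace Move

open BasedCutDiagram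

/-- The label of an arc at a white dot is the region of the partner, which lies on the same
component. -/
theorem Connects.regionComp_label_white {M : Move} {C C' : BasedCutDiagram n} {o : ℕ → Bool}
    {ι : ℤ → C.Dart} {ι' : ℤ → C'.Dart} {θ : C.Dart → C'.Dart} (H : M.Connects C C' o ι ι' θ)
    (a b c : ℤ)
    (h : M.before.ShowsCut a ∧ M.before.IsInner a ∧ M.before.HasKind (-a) Kind.white ∧
      M.before.SameFace (-a) c ∧ M.after.SameFace b c ∧ ¬ M.before.IsInner c := by decide) :
    C'.regionComp (C'.reg (ι' b)) = C.regionComp (C.label (ι a)) := by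
  obtain ⟨h1, h2, h3, h4⟩ := h
  obtain ⟨-, -, -, hc, hr, -⟩ := C.rule_white _ (H.embeds.kind_eq h3)
  rw [H.embeds.label_neg a ⟨h1, h2⟩] at hr
  rw [← hr, C.regionComp_reg, hc, C'.regionComp_reg, H.comp_eq (-a) b c h4]

/-- The arcs at the dots act trivially, so only the two strands that are passed matter. They have
the same letter `ℓ`, and if `g`, `h` are the colors of the dots on component `i`, then `(g ℓ) (h
ℓ)⁻¹ = g h⁻¹`. -/
theorem transfers_moveDotSlide : moveDotSlide.Transfers := by
  intro n C C' o ι ι' θ i v' H hv'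
  have E := H.embeds'
  let W : ℤ → Color i := fun a => v' (C'.reg (ι' a))
  have hl := hv'.act_letter ((H.regionComp_label_white 5 5 2).trans
    (H.regionComp_label (Connects.tracked_of_mem (p := (5, 5)) (by decide))
      (H.embeds.isCut 5)).symm)
  have h4 := E.value_neg hv' 4
  have h5 := E.value_neg hv' 5
  have h14 := E.value_neg hv' 14
  have h15 := E.value_neg hv' 15
  rw [hl, E.value_eq v' (-5) 3, E.value_eq v' 5 2] at h5
  rw [E.value_eq v' 5 2] at hl
  rw [E.value_eq v' (-4) 1, E.value_eq v' 4 3, h5] at h4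
  rw [E.value_eq v' (-14) 11, E.value_eq v' 14 13] at h14
  rw [E.value_eq v' (-15) 11, E.value_eq v' 15 11] at h15
  have f12 := E.value_eq v' 12 11
  obtain ⟨v, hv, hA, hp⟩ := H.exists_isFraming_of_cuts hv'
    (fun a => if a ∈ [-4, 1] then W 1 else if a ∈ [4, 2, 5, -5, 3] then W 2 else
      if a ∈ [14, 17, -17, 16, 13] then W 13 else W 11)
    (by simp [moveDotSlide]) (by simp [moveDotSlide, W, h5, f12]) (by
      intro v hA _ _
      have t4 := H.letter_eq hA 4 4
      have t5 := H.letter_eq hA 5 5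
      have t14 := H.letter_eq hA 14 14
      have t15 := H.letter_eq hA 15 15
      have t16 := H.letter_eq hA (-16) (-14)
      have t17 := H.act_letter hv' hA (H.embeds.isCut 17) (H.regionComp_label_white 17 13 13)
      rw [H.embeds.letter_neg v 16, E.letter_neg v' 14, inv_inj] at t16
      simp only [moveDotSlide, t4, t5, t14, t15, t16, List.forall_mem_cons]
      exact ⟨h4, hl.symm, h14, h14, h15, t17.symm, by simp⟩)
  have p1 : C.pair (ι (-5)) = ι (-17) := H.embeds.pair (-5, -17) (by decide)
  have p2 : C'.pair (ι' (-7)) = ι' (-15) := E.pair (-7, -15) (by decide)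
  have k5 := H.embeds.kind_eq (a := -5) (k := Kind.white)
  have k17 := H.embeds.kind_eq (a := -17) (k := Kind.white)
  have k7 := E.kind_eq (a := -7) (k := Kind.white)
  have k15 := E.kind_eq (a := -15) (k := Kind.white)
  have c7 : C'.comp (ι' (-7)) = C.comp (ι (-5)) := by
    rw [H.comp_eq (-4) (-7) 1, ← H.embeds.inv_eq 4, C.comp_inv, ← C.regionComp_reg,
      H.embeds.reg_eq (w := [4, 2, 5, -5, 3]) (b := -5) (by decide) (by decide) (by decide),
      C.regionComp_reg]
  have c17 : C.comp (ι (-17)) = C.comp (ι (-5)) := by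
    rw [← p1, (C.rule_white _ k5).2.2.2.1]
  have c15 : C'.comp (ι' (-15)) = C.comp (ι (-5)) := by
    rw [← p2, (C'.rule_white _ k7).2.2.2.1, c7]
  have p1' : C.pair (ι (-17)) = ι (-5) := by rw [← p1, (C.rule_white _ k5).2.1]
  have in5 : ι (-5) ∉ moveDotSlide.before.kept C.toCutDiagram ι :=
    fun h => h ⟨-5, (by decide : moveDotSlide.before.IsInner (-5)), rfl⟩
  have in17 : ι (-17) ∉ moveDotSlide.before.kept C.toCutDiagram ι :=
    fun h => h ⟨-17, (by decide : moveDotSlide.before.IsInner (-17)), rfl⟩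
  refine ⟨v, hv, H.finsum_eq hA ?_ ?_⟩
  · intro p hp hw hk
    simp only [moveDotSlide, List.cons_append, List.nil_append, List.mem_cons,
      List.not_mem_nil, or_false] at hp
    rcases hp with rfl | rfl | rfl | rfl | rfl | rfl | rfl | rfl
    · exact absurd hw (H.embeds.kind_ne_white 4)
    · exact absurd hw (H.embeds.kind_ne_white (-4))
    · exact absurd hw (H.embeds.kind_ne_white 5)
    · exact absurd hw (H.embeds.kind_ne_white 14)
    · exact absurd hw (H.embeds.kind_ne_white (-16))
    · exact absurd hw (H.embeds.kind_ne_white 15)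
    · exact absurd (show C.pair (ι (-5)) ∈ _ from hk) (by rw [p1]; exact in17)
    · exact absurd (show C.pair (ι (-17)) ∈ _ from hk) (by rw [p1']; exact in5)
  · rw [H.embeds.finsum_inner_of_nonwhite v {-5, -17}, E.finsum_inner_of_nonwhite v' {-7, -15},
      Finset.sum_insert (by decide), Finset.sum_singleton, Finset.sum_insert (by decide),
      Finset.sum_singleton]
    simp only [k5, k17, k7, k15, c7, c15, c17, true_and]
    by_cases hi : C.comp (ι (-5)) = i
    · simp only [if_pos hi]
      -- Both dots of the pair have equal terms, so it suffices to compare one of them before and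
      -- after.
      have q1 := dotTerm_pair v (p := ι (-5)) ⟨k5, hi⟩
      have q2 := dotTerm_pair v' (p := ι' (-7)) ⟨k7, c7.trans hi⟩
      rw [p1] at q1
      rw [p2] at q2
      have e1 : v (C.reg (ι (-5))) = W 2 := (hp (-5) (by decide)).trans (by simp)
      have e2 : v (C.reg (ι (-17))) = W 13 := (hp (-17) (by decide)).trans (by simp)
      have e3 : v' (C'.reg (ι' (-7))) = W 1 := E.value_eq v' (-7) 1
      have e4 : v' (C'.reg (ι' (-15))) = W 11 := E.value_eq v' (-15) 11
      have i2 : (W 2).1 = i := by rw [← e1, hv.comp, C.regionComp_reg, hi]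
      have i13 : (W 13).1 = i := by rw [← e2, hv.comp, C.regionComp_reg, c17, hi]
      have l : C'.colorLetter (fun R => (v' R).mer) (ι' 4) =
          C'.colorLetter (fun R => (v' R).mer) (ι' 14) :=
        C'.colorLetter_congr _ ((E.cut (4, 0, Kind.reg, Kind.upper) (by decide)).2.2.trans
          (E.cut (14, 0, Kind.reg, Kind.reg) (by decide)).2.2.symm) (E.same (4, 14) (by decide))
      have d5 := C.dir_inv _ (H.embeds.isCut 5)
      have d7 := C'.dir_inv _ (E.isCut 7)
      rw [H.embeds.inv_eq 5, (H.embeds.cut (5, 1, Kind.reg, Kind.white) (by decide)).2.2] at d5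
      rw [E.inv_eq 7, (E.cut (7, 1, Kind.lower, Kind.white) (by decide)).2.2] at d7
      have h4' : W 1 = _ := h4
      have h14' : W 11 = _ := h14
      have key : dotTerm v (ι (-5)) = dotTerm v' (ι' (-7)) := by
        rw [dotTerm, dotTerm, p1, p2, e1, e2, e3, e4, h4', h14', Color.act_snd_of_eq i2,
          Color.act_snd_of_eq i13, l, dotSign, dotSign, d5, d7]
        simp only [W, mul_inv_rev, mul_assoc, mul_inv_cancel_left]
      rw [q1, q2, key]
    · simp only [if_neg hi]

end Move
end KirkCut

/-! ### The Reidemeister 3 move -/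

namespace KirkCut

variable {n : ℕ}

theorem CutDiagram.colorLetter_conj {C : CutDiagram n} {K : Type*} [Group K] {c : C.Region → K}
    {d e : C.Dart} {g : K} (h1 : C.dir d = C.dir e)
    (h2 : c (C.label d) = g⁻¹ * c (C.label e) * g) :
    C.colorLetter c d = g⁻¹ * C.colorLetter c e * g := by
  unfold CutDiagram.colorLetter
  rw [h1, h2]
  split_ifs
  · group
  · rfl

/-- The relation at a crossing between the values at the labels of the under-strand, provided that
the values at labels satisfy the relations of the group. -/
theorem CutDiagram.conj_of_crossing {C : CutDiagram n} {K : Type*} [Group K] {c : C.Region → K}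
    (hc : ∀ e, C.IsCut e → (∃ d, C.IsCut d ∧ C.label d = C.reg e) →
      (∃ d, C.IsCut d ∧ C.label d = C.reg (C.inv e)) →
      c (C.reg (C.inv e)) = (C.colorLetter c e)⁻¹ * c (C.reg e) * C.colorLetter c e)
    {d : C.Dart} (hd : C.kind d = Kind.upper) :
    c (C.label (C.turn (C.turn (C.turn d)))) =
      (C.colorLetter c d)⁻¹ * c (C.label (C.turn d)) * C.colorLetter c d := by
  obtain ⟨h1, h2, -, h4, h5, h6⟩ := C.over_strand d hd
  have hcut : C.IsCut d := by
    unfold Drawing.IsCut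
    simp [hd]
  have k1 := C.isCut_turn hcut
  have k3 := C.isCut_turn (C.isCut_turn k1)
  by_cases hdir : C.dir d = true
  · obtain ⟨e, he, hed, hel, he1, he2⟩ := C.rule_crossing d hd hdir
    have := hc e he ⟨_, k1, he1.symm⟩ ⟨_, k3, he2.symm⟩
    rwa [he1, he2, C.colorLetter_congr c (hed.trans hdir.symm) hel] at this
  · have hdir' : C.dir (C.turn (C.turn d)) = true := by rw [h5]; simpa using hdir
    obtain ⟨e, he, hed, hel, he1, he2⟩ := C.rule_crossing _ h2 hdir'
    rw [h4] at he2
    have := hc e he ⟨_, k3, he1.symm⟩ ⟨_, k1, he2.symm⟩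
    have hl : C.colorLetter c e = (C.colorLetter c d)⁻¹ := by
      unfold CutDiagram.colorLetter
      rw [hed, hel, h6, if_pos rfl, if_neg hdir]
    rw [he1, he2, hl] at this
    rw [this]
    group

namespace Move

open BasedCutDiagram

/-- A face of the patch all of whose sides are cut is no label if its sides are interior. -/
theorem Connects.label_ne_reg {M : Move} {C C' : BasedCutDiagram n} {o : ℕ → Bool}
    {ι : ℤ → C.Dart} {ι' : ℤ → C'.Dart} {θ : C.Dart → C'.Dart} (H : M.Connects C C' o ι ι' θ)
    (w : List ℤ) (a : ℤ)
    (h : w ∈ M.before.faces ∧ a ∈ w ∧ ∀ b ∈ w, M.before.ShowsCut b ∧ M.before.IsInner b)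
    {d : C.Dart} (hd : C.IsCut d) : C.label d ≠ C.reg (ι a) := by
  obtain ⟨hw, ha, hb⟩ := h
  have E := H.embeds
  let P : C.Region → Prop := C.regionLift (fun d => ∃ b ∈ w, ι b = d) (by
    intro e
    apply propext
    constructor
    · rintro ⟨b, hbw, hbe⟩
      obtain ⟨c, hc⟩ := exists_mem_zip_rotate_right hbw
      have h1 := E.face w hw _ hc
      dsimp only at h1
      rw [hbe] at h1
      exact ⟨c, (List.of_mem_zip hc).1, C.next.injective h1⟩
    · rintro ⟨b, hbw, rfl⟩
      obtain ⟨c, hc⟩ := exists_mem_zip_rotate_left hbw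
      exact ⟨c, List.mem_rotate.1 (List.of_mem_zip hc).2, (E.face w hw _ hc).symm⟩) (by
    intro e he
    apply propext
    constructor
    · rintro ⟨b, hbw, hbe⟩
      have := E.isCut b (hb b hbw)
      rw [hbe, C.isCut_inv] at this
      exact absurd he this
    · rintro ⟨b, hbw, rfl⟩
      exact absurd he (E.isCut b (hb b hbw)))
  intro hl
  obtain ⟨e, he, hel⟩ := H.label d hd
  have h1 : P (C.reg e) := by
    rw [hel, hl]
    exact ⟨a, ha, rfl⟩
  obtain ⟨b, hbw, rfl⟩ := h1
  exact he ⟨b, (hb b hbw).2, rfl⟩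

/-- The six outer regions keep their colors, and the color of the triangle is forced across the top
strand. The relations along its other two sides follow from the crossings with the top strand. These
crossing relations come from arcs elsewhere whose two sides are labels. The triangle is no label, so
its undecided sides are never needed and the argument is not circular. -/
theorem transfers_moveR3 (f : Bool) : (moveR3 f).Transfers := by
  refine transfers_of_framing (fun n C C' o ι ι' θ i v' H hv' => ?_)
    (by cases f <;> decide) (by cases f <;> decide)
  have E := H.embeds'
  have E0 := H.embeds
  let W : ℤ → Color i := fun a => v' (C'.reg (ι' a))
  let ℓ : ℤ → ReducedFree {j : Fin n // j ≠ i} :=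
    fun a => C'.colorLetter (fun R => (v' R).mer) (ι' a)
  have h11 : W 1 = (W 6).act (ℓ 11) := by
    have := E.value_neg hv' 11 (by cases f <;> decide)
    rwa [E.value_eq v' (-11) 1 (by cases f <;> decide),
      E.value_eq v' 11 6 (by cases f <;> decide)] at this
  have h13 : W 3 = (W 4).act (ℓ 13) := by
    have := E.value_neg hv' 13 (by cases f <;> decide)
    rwa [E.value_eq v' (-13) 3 (by cases f <;> decide),
      E.value_eq v' 13 4 (by cases f <;> decide)] at this
  have h21 : W 2 = (W 1).act (ℓ 21) := by
    have := E.value_neg hv' 21 (by cases f <;> decide)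
    rwa [E.value_eq v' (-21) 2 (by cases f <;> decide),
      E.value_eq v' 21 1 (by cases f <;> decide)] at this
  have h23 : W 4 = (W 5).act (ℓ 23) := by
    have := E.value_neg hv' 23 (by cases f <;> decide)
    rwa [E.value_eq v' (-23) 4 (by cases f <;> decide),
      E.value_eq v' 23 5 (by cases f <;> decide)] at this
  have h31 : W 3 = (W 2).act (ℓ 31) := by
    have := E.value_neg hv' 31 (by cases f <;> decide)
    rwa [E.value_eq v' (-31) 3 (by cases f <;> decide),
      E.value_eq v' 31 2 (by cases f <;> decide)] at this
  have h33 : W 5 = (W 6).act (ℓ 33) := by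
    have := E.value_neg hv' 33 (by cases f <;> decide)
    rwa [E.value_eq v' (-33) 5 (by cases f <;> decide),
      E.value_eq v' 33 6 (by cases f <;> decide)] at this
  -- The last value belongs to the triangle: the top strand, whose letter is `ℓ 11` all along,
  -- separates it from region `2`.
  let u : ℤ → Color i := fun a => if a ∈ [1, 21, -11] then W 1 else
    if a ∈ [2, 31, -12, -21] then W 2 else if a ∈ [3, -13, -31] then W 3 else
    if a ∈ [4, -23, -32, 13] then W 4 else if a ∈ [5, -33, 23] then W 5 else
    if a ∈ [6, 11, 22, 33] then W 6 else (W 2).act (ℓ 11)⁻¹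
  obtain ⟨v, hv, hA, -⟩ := H.exists_isFraming_of_cuts hv' u
    (by simp [moveR3, u]) (by simp [moveR3, u, W]) (by
      intro v hA hp hk
      let m : ℤ → ReducedFree {j : Fin n // j ≠ i} :=
        fun a => C.colorLetter (fun R => (v R).mer) (ι a)
      have t11 : m 11 = ℓ 11 := H.letter_eq hA 11 11 (by cases f <;> decide)
      have t13 : m 13 = ℓ 13 := by
        have := H.letter_eq hA (-13) (-13) (by cases f <;> decide)
        rwa [E0.letter_neg v 13 (by cases f <;> decide), E.letter_neg v' 13 (by cases f <;> decide),
          inv_inj] at this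
      have t21 : m 21 = ℓ 21 := H.letter_eq hA 21 21 (by cases f <;> decide)
      have t23 : m 23 = ℓ 23 := by
        have := H.letter_eq hA (-23) (-23) (by cases f <;> decide)
        rwa [E0.letter_neg v 23 (by cases f <;> decide), E.letter_neg v' 23 (by cases f <;> decide),
          inv_inj] at this
      have t31 : m 31 = ℓ 31 := H.letter_eq hA 31 31 (by cases f <;> decide)
      have t33 : m 33 = ℓ 33 := by
        have := H.letter_eq hA (-33) (-33) (by cases f <;> decide)
        rwa [E0.letter_neg v 33 (by cases f <;> decide), E.letter_neg v' 33 (by cases f <;> decide),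
          inv_inj] at this
      have u11 : u (-11) = (u 11).act (m 11) := by rw [t11]; exact h11
      have u13 : u (-13) = (u 13).act (m 13) := by rw [t13]; exact h13
      have u21 : u (-21) = (u 21).act (m 21) := by rw [t21]; exact h21
      have u23 : u (-23) = (u 23).act (m 23) := by rw [t23]; exact h23
      have u31 : u (-31) = (u 31).act (m 31) := by rw [t31]; exact h31
      have u33 : u (-33) = (u 33).act (m 33) := by rw [t33]; exact h33
      have hrel : ∀ a, (moveR3 f).before.ShowsCut a ∧ (moveR3 f).before.IsInner a →
          u (-a) = (u a).act (m a) → ∀ e, e = ι a ∨ e = ι (-a) →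
          v (C.reg (C.inv e)) = (v (C.reg e)).act (C.colorLetter (fun R => (v R).mer) e) := by
        rintro a ha hu e (rfl | rfl)
        · rw [E0.inv_eq a ha.2, hp _ ha.2.2, hp _ ha.2.1, hu]
        · rw [← E0.inv_eq a ha.2, C.inv_inv, C.colorLetter_inv _ (E0.isCut a ha),
            E0.inv_eq a ha.2, hp _ ha.2.2, hp _ ha.2.1, hu, Color.act_act_inv]
      have hF : ∀ a ∈ ([12, 32, -22] : List ℤ), ∀ d, C.IsCut d → C.label d ≠ C.reg (ι a) :=
        fun a ha d hd => H.label_ne_reg [12, 32, -22] a ⟨by cases f <;> decide, ha,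
          by cases f <;> decide⟩ hd
      -- An arc between two labels is outside the disks or is one of the six strand ends, for which
      -- the relation is already known.
      have hc : ∀ e, C.IsCut e → (∃ d, C.IsCut d ∧ C.label d = C.reg e) →
          (∃ d, C.IsCut d ∧ C.label d = C.reg (C.inv e)) →
          v (C.reg (C.inv e)) = (v (C.reg e)).act (C.colorLetter (fun R => (v R).mer) e) := by
        rintro e he ⟨d, hd, hde⟩ ⟨d', hd', hde'⟩
        by_cases hek : e ∈ (moveR3 f).before.kept C.toCutDiagram ι
        · exact hk e hek he
        · obtain ⟨a, ha, rfl⟩ := not_not.1 hek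
          rw [E0.edge a ha] at hde'
          have ha' : a ∉ ([12, 32, -22] : List ℤ) := fun h => hF a h d hd hde
          have ha'' : -a ∉ ([12, 32, -22] : List ℤ) := fun h => hF _ h d' hd' hde'
          have key : ∀ a ∈ (moveR3 f).before.faces.flatten, -a ∈ (moveR3 f).before.faces.flatten →
              a ∉ ([12, 32, -22] : List ℤ) → -a ∉ ([12, 32, -22] : List ℤ) →
              (a = 11 ∨ a = -11) ∨ (a = 13 ∨ a = -13) ∨ (a = 21 ∨ a = -21) ∨
                (a = 23 ∨ a = -23) ∨ (a = 31 ∨ a = -31) ∨ (a = 33 ∨ a = -33) := by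
            cases f <;> decide
          rcases key a ha.1 ha.2 ha' ha'' with h | h | h | h | h | h
          · exact hrel 11 (by cases f <;> decide) u11 _ (h.imp (congrArg ι) (congrArg ι))
          · exact hrel 13 (by cases f <;> decide) u13 _ (h.imp (congrArg ι) (congrArg ι))
          · exact hrel 21 (by cases f <;> decide) u21 _ (h.imp (congrArg ι) (congrArg ι))
          · exact hrel 23 (by cases f <;> decide) u23 _ (h.imp (congrArg ι) (congrArg ι))
          · exact hrel 31 (by cases f <;> decide) u31 _ (h.imp (congrArg ι) (congrArg ι))
          · exact hrel 33 (by cases f <;> decide) u33 _ (h.imp (congrArg ι) (congrArg ι))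
      have hm : ∀ e, C.IsCut e → (∃ d, C.IsCut d ∧ C.label d = C.reg e) →
          (∃ d, C.IsCut d ∧ C.label d = C.reg (C.inv e)) →
          (v (C.reg (C.inv e))).mer = (C.colorLetter (fun R => (v R).mer) e)⁻¹ *
            (v (C.reg e)).mer * C.colorLetter (fun R => (v R).mer) e :=
        fun e he h h' => by rw [hc e he h h', Color.mer_act]
      have d11 : C.dir (ι 11) = o 0 :=
        (E0.cut (11, 0, Kind.reg, Kind.upper) (by cases f <;> decide)).2.2
      have d12 : C.dir (ι 12) = o 0 :=
        (E0.cut (12, 0, Kind.upper, Kind.upper) (by cases f <;> decide)).2.2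
      have d13 : C.dir (ι 13) = o 0 :=
        (E0.cut (13, 0, Kind.upper, Kind.reg) (by cases f <;> decide)).2.2
      have d21 : C.dir (ι 21) = o 1 :=
        (E0.cut (21, 1, Kind.reg, Kind.lower) (by cases f <;> decide)).2.2
      have d22 : C.dir (ι 22) = o 1 :=
        (E0.cut (22, 1, Kind.lower, strandKind f) (by cases f <;> decide)).2.2
      have d31 : C.dir (ι 31) = o 2 :=
        (E0.cut (31, 2, Kind.reg, Kind.lower) (by cases f <;> decide)).2.2
      have d32 : C.dir (ι 32) = o 2 :=
        (E0.cut (32, 2, Kind.lower, strandKind (!f)) (by cases f <;> decide)).2.2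
      have s1 :=
        (C.over_strand _ (E0.kind_eq (a := -11) (k := Kind.upper) (by cases f <;> decide))).2.2.2.2.2
      rw [E0.turn_eq (-11) (-21) (by cases f <;> decide),
        E0.turn_eq (-21) 12 (by cases f <;> decide),
        E0.label_neg 11 (by cases f <;> decide)] at s1
      have s2 :=
        (C.over_strand _ (E0.kind_eq (a := -12) (k := Kind.upper) (by cases f <;> decide))).2.2.2.2.2
      rw [E0.turn_eq (-12) (-31) (by cases f <;> decide),
        E0.turn_eq (-31) 13 (by cases f <;> decide),
        E0.label_neg 12 (by cases f <;> decide)] at s2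
      have m12 : m 12 = m 11 := C.colorLetter_congr _ (d12.trans d11.symm) s1
      have m13 : m 13 = m 11 := C.colorLetter_congr _ (d13.trans d11.symm) (s2.trans s1)
      have x1 := CutDiagram.conj_of_crossing (c := fun R => (v R).mer) hm
        (E0.kind_eq (a := 12) (k := Kind.upper) (by cases f <;> decide))
      rw [E0.turn_eq 12 22 (by cases f <;> decide),
        E0.turn_eq 22 (-11) (by cases f <;> decide),
        E0.turn_eq (-11) (-21) (by cases f <;> decide),
        E0.label_neg 21 (by cases f <;> decide)] at x1
      have x2 := CutDiagram.conj_of_crossing (c := fun R => (v R).mer) hm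
        (E0.kind_eq (a := 13) (k := Kind.upper) (by cases f <;> decide))
      rw [E0.turn_eq 13 32 (by cases f <;> decide),
        E0.turn_eq 32 (-12) (by cases f <;> decide),
        E0.turn_eq (-12) (-31) (by cases f <;> decide),
        E0.label_neg 31 (by cases f <;> decide)] at x2
      -- The two lower strands pass under the top one, so their letters on the two sides of it are
      -- conjugate by its letter.
      have m21 : m 21 = (m 12)⁻¹ * m 22 * m 12 :=
        CutDiagram.colorLetter_conj (d21.trans d22.symm) x1
      have m31 : m 31 = (m 13)⁻¹ * m 32 * m 13 :=
        CutDiagram.colorLetter_conj (d31.trans d32.symm) x2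
      have u12 : u (-12) = (u 12).act (m 12) := by
        rw [m12, t11]
        exact (Color.act_inv_act _ _).symm
      have u22 : u (-22) = (u 22).act (m 22) := by
        change (W 2).act (ℓ 11)⁻¹ = (W 6).act (m 22)
        rw [h21, h11, ← t21, ← t11, m21, m12, ← Color.act_mul, ← Color.act_mul]
        congr 1
        group
      have u32 : u (-32) = (u 32).act (m 32) := by
        change W 4 = ((W 2).act (ℓ 11)⁻¹).act (m 32)
        rw [← Color.act_left_inj (ℓ 13), ← h13, h31, ← t31, ← t11, ← t13, m31, m13, ← Color.act_mul,
          ← Color.act_mul]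
        congr 1
        group
      simp only [moveR3, List.forall_mem_cons]
      exact ⟨u11, u12, u13, u21, u22, u23, u31, u32, u33, by simp⟩) (by cases f <;> decide)
  exact ⟨v, hv, hA⟩

end Move

theorem IsMove.transfers {M : Move} (h : IsMove M) : M.Transfers := by
  cases h with
  | iso => exact Move.transfers_moveIso
  | split a b => exact Move.transfers_moveSplit a b
  | subdivide => exact Move.transfers_moveSubdivide
  | arc => exact Move.transfers_moveArc
  | circle => exact Move.transfers_moveCircle
  | kink l f => exact Move.transfers_moveKink l f
  | saddle => exact Move.transfers_moveSaddle
  | slide => exact Move.transfers_moveSlide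
  | fuse => exact Move.transfers_moveFuse
  | r2 => exact Move.transfers_moveR2
  | r3 f => exact Move.transfers_moveR3 f
  | crossingChange => exact Move.transfers_moveCrossingChange
  | dotSlide => exact Move.transfers_moveDotSlide
  | finger => exact Move.transfers_moveFinger
  | finger' => exact Move.transfers_moveFinger'
  | cusp => exact Move.transfers_moveCusp

/-! ### Invariance of the sum -/

namespace BasedCutDiagram

theorem IsKirkSum.eq_of_equiv {C C' : BasedCutDiagram n} (h : SelfSingularEquiv C C') (i : Fin n)
    {s s' : MonoidAlgebra ℤ (ReducedFree {j : Fin n // j ≠ i})} (hs : C.IsKirkSum i s)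
    (hs' : C'.IsKirkSum i s') : s = s' := by
  induction h generalizing s s' with
  | rel C C' h =>
    obtain ⟨M, hM, o, ι, ι', θ, H⟩ := h
    obtain ⟨v', hv'⟩ := C'.exists_isFraming i
    obtain ⟨v, hv, e⟩ := hM.transfers H hv'
    exact add_self_injective (((hs.two_smul hv).trans e).trans (hs'.two_smul hv').symm)
  | refl C => exact hs.unique hs'
  | symm C C' _ ih => exact (ih hs' hs).symm
  | trans C C' C'' _ _ ih₁ ih₂ =>
    -- Transitivity requires a value of the sum for the intermediate diagram.
    obtain ⟨t, ht⟩ := C'.exists_isKirkSum (i := i)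
    exact (ih₁ hs ht).trans (ih₂ ht hs')

end BasedCutDiagram
end KirkCut

theorem mainTheorem5 (n : ℕ) :
    (∀ (C : KirkCut.BasedCutDiagram n) (i : Fin n), ∃! s, C.IsKirkSum i s) ∧
    ∀ C C' : KirkCut.BasedCutDiagram n, KirkCut.SelfSingularEquiv C C' →
      ∀ i : Fin n, ∀ s s', C.IsKirkSum i s → C'.IsKirkSum i s' → s = s' := by
  refine ⟨fun C i => ?_, fun C C' h i s s' hs hs' => hs.eq_of_equiv h i hs'⟩
  obtain ⟨s, hs⟩ := C.exists_isKirkSum (i := i)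
  exact ⟨s, hs, fun t ht => ht.unique hs⟩
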